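/- Let $M$ be a closed (compact, without boundary) smooth manifold of dimension four with a smooth Riemannian metric and a symplectic form $\omega$ (a smooth, closed, nondegenerate 2-form), and let $f:M\to M$ be a $C^2$ diffeomorphism with $f^*\omega=\omega$. Assume that $f$ is partially hyperbolic: there is a continuous splitting $T_pM=E^s(p)\oplus E^c(p)\oplus E^u(p)$ with $Df_p E^\sigma(p)=E^\sigma(f(p))$ for $\sigma=s,c,u$ and all $p\in M$, and there are $\lambda\in(0,1)$ and $C>0$ such that for all $n\ge 1$, all $p\in M$ and all unit vectors $X^\sigma\in E^\sigma(p)$, $\sigma=s,c,u$, $$\|Df^n_pX^s\|,\quad \|Df^{-n}_pX^u\|,\quad \frac{\|Df^n_pX^s\|}{\|Df^n_pX^c\|},\quad \frac{\|Df^n_pX^c\|}{\|Df^n_pX^u\|}\ \le\ C\lambda^n .$$ Suppose that $E^s$ and $E^u$ are line bundles (of rank one) and that they are of class $C^1$. Then $f$ is dynamically coherent, with $C^1$ foliations: there are $f$-invariant foliations $\mathcal F^{sc}$, $\mathcal F^{cu}$ and $\mathcal F^{c}$ of $M$, each given by an atlas of $C^1$ foliated charts, that are tangent to $E^s\oplus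 E^c$, $E^c\oplus E^u$ and $E^c$ respectively; and $\mathcal F^c=\mathcal F^{sc}\cap\mathcal F^{cu}$, that is, the leaf of $\mathcal F^c$ through any $p\in M$ is the path component containing $p$ of the intersection of the leaves of $\mathcal F^{sc}$ and $\mathcal F^{cu}$ through $p$. -/

import Mathlib

open Set Filter Topology Manifold ContDiff

noncomputable section

namespace SymplecticPH

/-- Euclidean space of dimension `n`. -/
abbrev Euc (n : ℕ) : Type := EuclideanSpace ℝ (Fin n)

section Forms

variable {n : ℕ} {M : Type*} [TopologicalSpace M] [ChartedSpace (Euc n) M]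

/-- The local expression of a differential 2-form `Ω` in the preferred chart at `x₀`: the pullback
of `Ω` by the inverse of that chart (meaningful on the open target of the chart). -/
def formInChart (Ω : ∀ p : M, TangentSpace (𝓡 n) p [⋀^Fin 2]→L[ℝ] ℝ) (x₀ : M) :
    Euc n → Euc n [⋀^Fin 2]→L[ℝ] ℝ := fun y =>
  (Ω ((extChartAt (𝓡 n) x₀).symm y)).compContinuousLinearMap
    (mfderiv 𝓘(ℝ, Euc n) (𝓡 n) (extChartAt (𝓡 n) x₀).symm y : Euc n →L[ℝ] _)

/-- A symplectic form: a smooth, closed, nondegenerate differential 2-form. -/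
structure IsSymplecticForm (Ω : ∀ p : M, TangentSpace (𝓡 n) p [⋀^Fin 2]→L[ℝ] ℝ) : Prop where
  smooth : ∀ x₀ : M, ContDiffOn ℝ ∞ (formInChart Ω x₀) (extChartAt (𝓡 n) x₀).target
  closed : ∀ x₀ : M, ∀ y ∈ (extChartAt (𝓡 n) x₀).target, extDeriv (formInChart Ω x₀) y = 0
  nondegenerate : ∀ (p : M) (v : TangentSpace (𝓡 n) p), (∀ w, Ω p ![v, w] = 0) → v = 0

/-- `f` leaves `Ω` invariant: `f^* Ω = Ω`. -/
def PreservesForm (f : M → M) (Ω : ∀ p : M, TangentSpace (𝓡 n) p [⋀^Fin 2]→L[ℝ] ℝ) : Prop :=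
  ∀ p : M, (Ω (f p)).compContinuousLinearMap (mfderiv (𝓡 n) (𝓡 n) f p) = Ω p

end Forms

section Bundles

variable {n : ℕ} {M : Type*} [TopologicalSpace M] [ChartedSpace (Euc n) M]
  [IsManifold (𝓡 n) ∞ M]

/-- The family `E` of subspaces of the tangent spaces is a `C^k` subbundle of the tangent bundle:
near every point it has a frame made of `C^k` local vector fields (`k = 0`: continuous). -/
def IsSubbundle (k : ℕ∞ω) (E : ∀ p : M, Submodule ℝ (TangentSpace (𝓡 n) p)) : Prop :=
  ∀ p : M, ∃ U : Set M, IsOpen U ∧ p ∈ U ∧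
    ∃ (r : ℕ) (X : Fin r → ∀ q : M, TangentSpace (𝓡 n) q),
      (∀ i, ContMDiffOn (𝓡 n) (𝓡 n).tangent k
        (fun q => (⟨q, X i q⟩ : TangentBundle (𝓡 n) M)) U) ∧
      ∀ q ∈ U, LinearIndependent ℝ (fun i => X i q) ∧
        Submodule.span ℝ (range fun i => X i q) = E q

/-- The family `E` is invariant under the derivative of `f`: `Df_p (E p) = E (f p)`. -/
def IsDInvariant (f : M → M) (E : ∀ p : M, Submodule ℝ (TangentSpace (𝓡 n) p)) : Prop :=
  ∀ p : M, (E p).map (mfderiv (𝓡 n) (𝓡 n) f p).toLinearMap = E (f p)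

/-- The length of a tangent vector for the Riemannian metric `g`. -/
def gnorm (g : Bundle.ContMDiffRiemannianMetric (𝓡 n) ∞ (Euc n)
    (TangentSpace (𝓡 n) : M → Type)) {p : M} (v : TangentSpace (𝓡 n) p) : ℝ :=
  √(g.inner p v v)

/-- `f` is partially hyperbolic (with respect to the metric `g`) with splitting
`TM = Es ⊕ Ec ⊕ Eu`. The comparisons are made between vectors with the same base point. -/
structure IsPartiallyHyperbolic
    (g : Bundle.ContMDiffRiemannianMetric (𝓡 n) ∞ (Euc n) (TangentSpace (𝓡 n) : M → Type))
    {k : ℕ∞ω} (f : Diffeomorph (𝓡 n) (𝓡 n) M M k)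
    (Es Ec Eu : ∀ p : M, Submodule ℝ (TangentSpace (𝓡 n) p)) : Prop where
  /-- `T_p M` is the direct sum of the three subspaces. -/
  isCompl : ∀ p, IsCompl (Es p) (Ec p ⊔ Eu p)
  disjoint : ∀ p, Disjoint (Ec p) (Eu p)
  continuous_s : IsSubbundle 0 Es
  continuous_c : IsSubbundle 0 Ec
  continuous_u : IsSubbundle 0 Eu
  invariant_s : IsDInvariant f Es
  invariant_c : IsDInvariant f Ec
  invariant_u : IsDInvariant f Eu
  hyperbolic : ∃ lam C : ℝ, 0 < lam ∧ lam < 1 ∧ 0 < C ∧ ∀ m : ℕ, 1 ≤ m → ∀ p : M,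
    (∀ v ∈ Es p, gnorm g v = 1 →
      gnorm g (mfderiv (𝓡 n) (𝓡 n) f^[m] p v) ≤ C * lam ^ m) ∧
    (∀ v ∈ Eu p, gnorm g v = 1 →
      gnorm g (mfderiv (𝓡 n) (𝓡 n) f.symm^[m] p v) ≤ C * lam ^ m) ∧
    (∀ v ∈ Es p, ∀ w ∈ Ec p, gnorm g v = 1 → gnorm g w = 1 →
      gnorm g (mfderiv (𝓡 n) (𝓡 n) f^[m] p v) / gnorm g (mfderiv (𝓡 n) (𝓡 n) f^[m] p w)
        ≤ C * lam ^ m) ∧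
    (∀ v ∈ Ec p, ∀ w ∈ Eu p, gnorm g v = 1 → gnorm g w = 1 →
      gnorm g (mfderiv (𝓡 n) (𝓡 n) f^[m] p v) / gnorm g (mfderiv (𝓡 n) (𝓡 n) f^[m] p w)
        ≤ C * lam ^ m)

end Bundles

section Foliations

/-- A `C^k` foliation with `d`-dimensional leaves and codimension `c`, given by a foliated atlas:
`C^k` charts with values in `ℝ^d × ℝ^c` that cover `M`, whose plaques
(the sets `{second coordinate = const}`) are connected, and whose changes of charts
locally send plaques into plaques. -/
structure Foliation (n : ℕ) (M : Type*) [TopologicalSpace M] [ChartedSpace (Euc n) M]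
    (k : ℕ∞ω) (d c : ℕ) where
  charts : Set (OpenPartialHomeomorph M (Euc d × Euc c))
  cover : ∀ p : M, ∃ φ ∈ charts, p ∈ φ.source
  contMDiffOn : ∀ φ ∈ charts, ContMDiffOn (𝓡 n) 𝓘(ℝ, Euc d × Euc c) k φ φ.source
  contMDiffOn_symm : ∀ φ ∈ charts, ContMDiffOn 𝓘(ℝ, Euc d × Euc c) (𝓡 n) k φ.symm φ.target
  plaque_connected : ∀ φ ∈ charts, ∀ y : Euc c, IsPreconnected {x : Euc d | (x, y) ∈ φ.target}
  compatible : ∀ φ ∈ charts, ∀ ψ ∈ charts, ∀ p ∈ φ.source ∩ ψ.source, ∃ V ∈ 𝓝 p,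
    ∀ q ∈ V, ∀ q' ∈ V, (φ q).2 = (φ q').2 → (ψ q).2 = (ψ q').2

namespace Foliation

variable {n : ℕ} {M : Type*} [TopologicalSpace M] [ChartedSpace (Euc n) M]
  {k : ℕ∞ω} {d c : ℕ}

/-- `p` and `q` lie on a common plaque. -/
def SamePlaque (F : Foliation n M k d c) (p q : M) : Prop :=
  ∃ φ ∈ F.charts, p ∈ φ.source ∧ q ∈ φ.source ∧ (φ p).2 = (φ q).2

/-- The leaf through `p`: the points that are joined to `p` by a finite chain of plaques. -/
def leaf (F : Foliation n M k d c) (p : M) : Set M :=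
  {q | Relation.EqvGen F.SamePlaque p q}

/-- `F` is tangent to `E`: at every point the tangent space of the leaf (the kernel of the
derivative of the transverse coordinate of a foliated chart) is `E p`. -/
def IsTangentTo (F : Foliation n M k d c)
    (E : ∀ p : M, Submodule ℝ (TangentSpace (𝓡 n) p)) : Prop :=
  ∀ φ ∈ F.charts, ∀ p ∈ φ.source,
    (mfderiv (𝓡 n) 𝓘(ℝ, Euc c) (fun q => (φ q).2) p).ker = E p

/-- `f` maps leaves onto leaves. -/
def IsInvariant (F : Foliation n M k d c) (f : M → M) : Prop :=
  ∀ p : M, f '' F.leaf p = F.leaf (f p)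

end Foliation

end Foliations

end SymplecticPH

end

open SymplecticPH

/-! The plan is to show that `Es ⊕ Ec` is the kernel of a `C^1` 1-form satisfying the Frobenius
condition, and then to reverse time to treat `Ec ⊕ Eu`.

Regularity comes from the symplectic form: domination forces `Es` to be Ω-orthogonal to `Ec`
(`orthogonal_of_domination`). If `X` is a local `C^1` frame of `Es`, the form `α = Ω(X, ·)` is
therefore `C^1` and its kernel is exactly `Es ⊕ Ec`, although `Ec` is only assumed continuous
(`exists_isDefiningForm`).

Integrability comes from the dynamics. On `ker α` the form `dα / α`, a 2-form with values in the
dual of the line of `α`, is natural under `C^2` maps (`extDeriv_transform`), and compactness makes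
the defining forms uniformly bounded. Hence, for `u` in `Eu`, `|dα(v, w)| ‖Df^m u‖` is at most a
constant times `|dα'(Df^m v, Df^m w)|`, with `α'` a defining form near the image point. If `v ∈ Es`
and `w ∈ Ec`, then `‖Df^m v‖` decays and `‖Df^m w‖` is dominated by `‖Df^m u‖`, so `dα(v, w) = 0`.
If `v, w ∈ Ec`, domination alone does not suffice; but `Ec` is a plane on which Ω is uniformly
nondegenerate, so `dα'` is bounded there by the invariant form Ω. The right-hand side stays bounded
while `‖Df^m u‖` tends to infinity, so again `dα(v, w) = 0` (`curvature_eq_zero_of_domination`). A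
line carries no nonzero alternating form, which settles `Es × Es`.

The Frobenius theorem for `C^1` forms (`exists_firstIntegral`) then gives local first integrals. A
first integral for `Ec` is the pair of those for `Es ⊕ Ec` and `Ec ⊕ Eu`. First integrals are
completed to foliated charts (`exists_foliation_of_hasFirstIntegral`), and invariance of the
foliations follows from invariance of the bundles. For the last assertion, a leaf meets a chart in
countably many plaques, so a path in a leaf stays locally in one plaque; a path in both big leaves
thus keeps both transverse coordinates locally constant and lies in a leaf of the center foliation
(`leaf_eq_pathComponentIn_inter`). -/

noncomputable section

namespace SymplecticPH

/-! ### Composition operators on spaces of continuous functions. -/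

section Nemytskii

variable {K E F : Type*} [TopologicalSpace K] [CompactSpace K]
  [NormedAddCommGroup E] [NormedSpace ℝ E] [NormedAddCommGroup F] [NormedSpace ℝ F]

/-- Pointwise evaluation of a continuous family of operators on a continuous function. -/
def pointwiseApply : C(K, E →L[ℝ] F) →L[ℝ] C(K, E) →L[ℝ] C(K, F) :=
  LinearMap.mkContinuous₂
    (LinearMap.mk₂ ℝ (fun (A : C(K, E →L[ℝ] F)) (η : C(K, E)) =>
      (⟨fun s => A s (η s), A.continuous.clm_apply η.continuous⟩ : C(K, F)))
      (fun A B η => by ext s; simp) (fun c A η => by ext s; simp)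
      (fun A η θ => by ext s; simp) (fun c A η => by ext s; simp)) 1 fun A η => by
    rw [ContinuousMap.norm_le _ (by positivity)]
    intro s
    rw [one_mul]
    exact (A s).le_of_opNorm_le_of_le (A.norm_coe_le_norm s) (η.norm_coe_le_norm s)

/-- The mean value inequality is applied at each `s`, with an error uniform in `s`: since `K` is
compact, `ζ ↦ DG ∘ ζ` is continuous for the sup norm. No uniform continuity of `DG` on `E` is
needed. -/
lemma hasFDerivAt_postcomp {G : E → F} (hG : ContDiff ℝ 1 G) (ζ : C(K, E)) :
    HasFDerivAt (fun ζ : C(K, E) => (⟨G, hG.continuous⟩ : C(E, F)).comp ζ)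
      (pointwiseApply ((⟨fderiv ℝ G, hG.continuous_fderiv one_ne_zero⟩ :
        C(E, E →L[ℝ] F)).comp ζ)) ζ := by
  set D : C(E, E →L[ℝ] F) := ⟨fderiv ℝ G, hG.continuous_fderiv one_ne_zero⟩ with hD
  rw [hasFDerivAt_iff_isLittleO_nhds_zero, Asymptotics.isLittleO_iff]
  intro ε hε
  have hc : Continuous fun η : C(K, E) => D.comp η := ContinuousMap.continuous_postcomp D
  have hm := hc.tendsto ζ (Metric.ball_mem_nhds (D.comp ζ) hε)
  obtain ⟨δ, hδ, h⟩ := Metric.mem_nhds_iff.1 hm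
  filter_upwards [Metric.ball_mem_nhds (0 : C(K, E)) hδ] with η hη
  rw [mem_ball_zero_iff] at hη
  rw [ContinuousMap.norm_le _ (by positivity)]
  intro s
  have key : ‖G (ζ s + η s) - G (ζ s) - fderiv ℝ G (ζ s) (ζ s + η s - ζ s)‖
      ≤ ε * ‖ζ s + η s - ζ s‖ := by
    refine (convex_segment (𝕜 := ℝ) (ζ s) (ζ s + η s)).norm_image_sub_le_of_norm_hasFDerivWithin_le'
      (f' := fderiv ℝ G)
      (fun x _ => ((hG.differentiable one_ne_zero) x).hasFDerivAt.hasFDerivWithinAt) ?_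
      (left_mem_segment _ _ _) (right_mem_segment _ _ _)
    intro x hx
    rw [segment_eq_image'] at hx
    obtain ⟨τ, hτ, rfl⟩ := hx
    -- The point of the segment is the value at `s` of the function `ζ + τ • η`, which is still
    -- within `δ` of `ζ`.
    have h1 : dist (D.comp (ζ + τ • η)) (D.comp ζ) < ε := @h (ζ + τ • η) (by
      rw [Metric.mem_ball, dist_eq_norm, add_sub_cancel_left, norm_smul, Real.norm_of_nonneg hτ.1]
      exact (mul_le_of_le_one_left (norm_nonneg _) hτ.2).trans_lt hη)
    have h2 := (ContinuousMap.dist_apply_le_dist (f := D.comp (ζ + τ • η)) (g := D.comp ζ) s).trans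
      h1.le
    simpa [hD, dist_eq_norm] using h2
  simp only [add_sub_cancel_left] at key
  refine key.trans ?_
  gcongr
  exact η.norm_coe_le_norm s

lemma contDiff_postcomp {G : E → F} (hG : ContDiff ℝ 1 G) :
    ContDiff ℝ 1 (fun ζ : C(K, E) => (⟨G, hG.continuous⟩ : C(E, F)).comp ζ) := by
  rw [contDiff_one_iff_hasFDerivAt]
  exact ⟨_, pointwiseApply.continuous.comp (ContinuousMap.continuous_postcomp _),
    hasFDerivAt_postcomp hG⟩

end Nemytskii

/-! ### Integration as a bounded operator on `C([0,1])`. -/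

section Primitive

open unitInterval MeasureTheory

/-- Functions on the interval are extended to the line by constants, so that primitives are
differentiable at every real number, endpoints included. -/
lemma continuous_projIcc_comp (η : C(I, ℝ)) : Continuous fun s : ℝ => η (projIcc 0 1 zero_le_one s) :=
  η.continuous.comp continuous_projIcc

/-- The primitive vanishing at `0` of a continuous function on the unit interval. -/
def primitive : C(I, ℝ) →L[ℝ] C(I, ℝ) :=
  LinearMap.mkContinuous
    { toFun := fun η => ⟨fun t => ∫ s in (0 : ℝ)..t, η (projIcc 0 1 zero_le_one s),
        (intervalIntegral.continuous_primitive
          (fun _ _ => (continuous_projIcc_comp η).intervalIntegrable _ _) 0).comp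
          continuous_subtype_val⟩
      map_add' := fun η θ => by
        ext t
        exact intervalIntegral.integral_add ((continuous_projIcc_comp η).intervalIntegrable _ _)
          ((continuous_projIcc_comp θ).intervalIntegrable _ _)
      map_smul' := fun c η => by
        ext t
        exact intervalIntegral.integral_const_mul c fun s => η (projIcc 0 1 zero_le_one s) } 1 fun η => by
    rw [ContinuousMap.norm_le _ (by positivity)]
    intro t
    have := intervalIntegral.norm_integral_le_of_norm_le_const (a := 0) (b := (t : ℝ))
      (f := fun s : ℝ => η (projIcc 0 1 zero_le_one s)) (C := ‖η‖)
      (fun s _ => η.norm_coe_le_norm _)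
    refine this.trans ?_
    rw [sub_zero, abs_of_nonneg t.2.1, one_mul]
    exact mul_le_of_le_one_right (norm_nonneg _) t.2.2

lemma primitive_apply (η : C(I, ℝ)) (t : I) :
    primitive η t = ∫ s in (0 : ℝ)..t, η (projIcc 0 1 zero_le_one s) := rfl

lemma norm_primitive_le (η : C(I, ℝ)) : ‖primitive η‖ ≤ ‖η‖ := by
  simpa using (primitive.le_of_opNorm_le (LinearMap.mkContinuous_norm_le _ zero_le_one _) η)

/-- A function on the unit interval is the primitive of its derivative. -/
lemma primitive_eq_of_hasDerivAt {A : ℝ → ℝ} {η : C(I, ℝ)} (hA : ContinuousOn A (Icc 0 1))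
    (hd : ∀ t (ht : t ∈ Ioo (0 : ℝ) 1), HasDerivAt A (η ⟨t, Ioo_subset_Icc_self ht⟩) t) (t : I) :
    primitive η t = A t - A 0 := by
  rw [primitive_apply]
  refine intervalIntegral.integral_eq_sub_of_hasDerivAt_of_le t.2.1
    (hA.mono (Icc_subset_Icc_right t.2.2)) (fun s hs => ?_)
    ((continuous_projIcc_comp η).intervalIntegrable _ _)
  have hs' : s ∈ Ioo (0 : ℝ) 1 := ⟨hs.1, hs.2.trans_le t.2.2⟩
  rw [projIcc_of_mem zero_le_one (Ioo_subset_Icc_self hs')]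
  exact hd s hs'

lemma hasDerivAt_primitive (η : C(I, ℝ)) (t : ℝ) :
    HasDerivAt (fun t : ℝ => ∫ s in (0 : ℝ)..t, η (projIcc 0 1 zero_le_one s))
      (η (projIcc 0 1 zero_le_one t)) t :=
  (continuous_projIcc_comp η).integral_hasStrictDerivAt 0 t |>.hasDerivAt

end Primitive

/-! ### Frobenius theorem for total differential equations, by integration along rays. -/

section TotalDifferential

open unitInterval

variable {H : Type*} [NormedAddCommGroup H] [NormedSpace ℝ H]

/-- The curve `s ↦ (s h, h, ζ s)`. -/
def rayLift : H × C(I, ℝ) →L[ℝ] C(I, H × H × ℝ) :=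
  LinearMap.mkContinuous
    { toFun := fun q => ⟨fun s => ((s : ℝ) • q.1, q.1, q.2 s), by fun_prop⟩
      map_add' := fun q r => by ext s <;> simp
      map_smul' := fun c q => by ext s <;> simp [smul_comm c] } 1 fun q => by
    rw [ContinuousMap.norm_le _ (by positivity), one_mul]
    intro s
    refine norm_prod_le_iff.2 ⟨?_, norm_prod_le_iff.2 ⟨norm_fst_le q, ?_⟩⟩
    · change ‖(s : ℝ) • q.1‖ ≤ _
      rw [norm_smul, Real.norm_of_nonneg s.2.1]
      exact (mul_le_of_le_one_left (norm_nonneg _) s.2.2).trans (norm_fst_le q)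
    · exact (q.2.norm_coe_le_norm s).trans (norm_snd_le q)

@[simp] lemma rayLift_apply (q : H × C(I, ℝ)) (s : I) :
    rayLift q s = ((s : ℝ) • q.1, q.1, q.2 s) := rfl

variable {a : H × ℝ → H →L[ℝ] ℝ}

/-- The right-hand side of the ray equation `ζ' = a(s h, ζ) h`. -/
def raySpeed (a : H × ℝ → H →L[ℝ] ℝ) (x : H × H × ℝ) : ℝ := a (x.1, x.2.2) x.2.1

lemma contDiff_raySpeed (ha : ContDiff ℝ 1 a) : ContDiff ℝ 1 (raySpeed a) :=
  (ha.comp (contDiff_fst.prodMk (contDiff_snd.comp contDiff_snd))).clm_apply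
    (contDiff_fst.comp contDiff_snd)

lemma fderiv_raySpeed (ha : ContDiff ℝ 1 a) (x v : H × H × ℝ) :
    fderiv ℝ (raySpeed a) x v =
      fderiv ℝ a (x.1, x.2.2) (v.1, v.2.2) x.2.1 + a (x.1, x.2.2) v.2.1 := by
  have h1 : HasFDerivAt (fun x : H × H × ℝ => (x.1, x.2.2))
      ((ContinuousLinearMap.fst ℝ H (H × ℝ)).prod
        ((ContinuousLinearMap.snd ℝ H ℝ).comp (ContinuousLinearMap.snd ℝ H (H × ℝ)))) x :=
    ((ContinuousLinearMap.fst ℝ H (H × ℝ)).prod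
        ((ContinuousLinearMap.snd ℝ H ℝ).comp (ContinuousLinearMap.snd ℝ H (H × ℝ)))).hasFDerivAt
  have h2 : HasFDerivAt (fun x : H × H × ℝ => x.2.1)
      ((ContinuousLinearMap.fst ℝ H ℝ).comp (ContinuousLinearMap.snd ℝ H (H × ℝ))) x :=
    ((ContinuousLinearMap.fst ℝ H ℝ).comp (ContinuousLinearMap.snd ℝ H (H × ℝ))).hasFDerivAt
  have h3 := (((ha.differentiable one_ne_zero) (x.1, x.2.2)).hasFDerivAt.comp x h1).clm_apply h2
  have h4 : fderiv ℝ (raySpeed a) x = _ := h3.fderiv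
  rw [h4]
  simp [add_comm]

/-- The operator whose zeros are the solutions of the ray equation in integral form. -/
def rayOperator (ha : ContDiff ℝ 1 a) (p : (H × ℝ) × C(I, ℝ)) : C(I, ℝ) :=
  p.2 - p.1.2 • (1 : C(I, ℝ)) -
    primitive ((⟨raySpeed a, (contDiff_raySpeed ha).continuous⟩ : C(H × H × ℝ, ℝ)).comp
      (rayLift (p.1.1, p.2)))

lemma contDiff_rayOperator (ha : ContDiff ℝ 1 a) : ContDiff ℝ 1 (rayOperator ha) := by
  have h1 : ContDiff ℝ 1 fun p : (H × ℝ) × C(I, ℝ) => rayLift (p.1.1, p.2) :=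
    (rayLift (H := H)).contDiff.comp (f := fun p : (H × ℝ) × C(I, ℝ) => (p.1.1, p.2))
      ((contDiff_fst.comp contDiff_fst).prodMk contDiff_snd)
  have h2 := primitive.contDiff.comp ((contDiff_postcomp (contDiff_raySpeed ha)).comp h1)
  exact (contDiff_snd.sub ((contDiff_snd.comp contDiff_fst).smul contDiff_const)).sub h2

/-- The linearization of the ray equation. -/
def rayLinearization (ha : ContDiff ℝ 1 a) (h : H) (ζ : C(I, ℝ)) :
    C(I, H × H × ℝ) →L[ℝ] C(I, ℝ) :=
  pointwiseApply ((⟨fderiv ℝ (raySpeed a), (contDiff_raySpeed ha).continuous_fderiv one_ne_zero⟩ :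
        C(H × H × ℝ, H × H × ℝ →L[ℝ] ℝ)).comp (rayLift (h, ζ)))

lemma rayLinearization_apply (ha : ContDiff ℝ 1 a) (h : H) (ζ : C(I, ℝ)) (k : H) (η : C(I, ℝ))
    (s : I) : rayLinearization ha h ζ (rayLift (k, η)) s =
      fderiv ℝ a ((s : ℝ) • h, ζ s) ((s : ℝ) • k, η s) h + a ((s : ℝ) • h, ζ s) k :=
  fderiv_raySpeed ha _ _

lemma fderiv_rayOperator (ha : ContDiff ℝ 1 a) (p q : (H × ℝ) × C(I, ℝ)) :
    fderiv ℝ (rayOperator ha) p q = q.2 - q.1.2 • (1 : C(I, ℝ)) -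
      primitive (rayLinearization ha p.1.1 p.2 (rayLift (q.1.1, q.2))) := by
  let P := (ContinuousLinearMap.fst ℝ H ℝ).comp (ContinuousLinearMap.fst ℝ (H × ℝ) C(I, ℝ))
  let P' := (ContinuousLinearMap.snd ℝ H ℝ).comp (ContinuousLinearMap.fst ℝ (H × ℝ) C(I, ℝ))
  let Q := ContinuousLinearMap.snd ℝ (H × ℝ) C(I, ℝ)
  have h1 : HasFDerivAt (fun p : (H × ℝ) × C(I, ℝ) => rayLift (p.1.1, p.2))
      (rayLift.comp (P.prod Q)) p := (rayLift.comp (P.prod Q)).hasFDerivAt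
  have h2 := (primitive.hasFDerivAt).comp p
    ((hasFDerivAt_postcomp (contDiff_raySpeed ha) (rayLift (p.1.1, p.2))).comp p h1)
  have h3 : HasFDerivAt (fun p : (H × ℝ) × C(I, ℝ) => p.1.2 • (1 : C(I, ℝ)))
      (P'.smulRight 1) p := (P'.smulRight (1 : C(I, ℝ))).hasFDerivAt
  have h4 : fderiv ℝ (rayOperator ha) p = _ := ((Q.hasFDerivAt.sub h3).sub h2).fderiv
  rw [h4]
  rfl

/-- If `a(x, z)` satisfies the Frobenius condition, then along a solution `ζ` of the ray equation
`t ↦ t a(t h, ζ t) k` solves the linearized equation. -/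
lemma ray_variation (ha : ContDiff ℝ 1 a) {h : H} {z : ℝ} {ζ : C(I, ℝ)}
    (hζ : rayOperator ha ((h, z), ζ) = 0)
    (hint : ∀ s : I, ∀ k l, fderiv ℝ a ((s : ℝ) • h, ζ s) (k, a ((s : ℝ) • h, ζ s) k) l =
      fderiv ℝ a ((s : ℝ) • h, ζ s) (l, a ((s : ℝ) • h, ζ s) l) k) (k : H)
    {A : C(I, ℝ)} (hA : ∀ s : I, A s = (s : ℝ) * a ((s : ℝ) • h, ζ s) k) :
    primitive (rayLinearization ha h ζ (rayLift (k, A))) = A := by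
  set η : C(I, ℝ) := (⟨raySpeed a, (contDiff_raySpeed ha).continuous⟩ : C(H × H × ℝ, ℝ)).comp
      (rayLift (h, ζ)) with hη
  set Z : ℝ → ℝ := fun t => z + ∫ s in (0 : ℝ)..t, η (projIcc 0 1 zero_le_one s) with hZ
  have hZd : ∀ t, HasDerivAt Z (η (projIcc 0 1 zero_le_one t)) t := fun t =>
    (hasDerivAt_primitive η t).const_add z
  have hZζ : ∀ s : I, ζ s = Z s := fun s => by
    have := congrArg (fun θ : C(I, ℝ) => θ s) hζ
    simp only [rayOperator, ContinuousMap.sub_apply, ContinuousMap.smul_apply,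
      ContinuousMap.one_apply, smul_eq_mul, mul_one, ContinuousMap.zero_apply,
      primitive_apply] at this
    simp only [hZ]
    linarith
  set B : ℝ → ℝ := fun t => t * a (t • h, Z t) k with hB
  have hBA : ∀ s : I, B s = A s := fun s => by rw [hA, hZζ]
  have hd : ∀ t (ht : t ∈ Icc (0 : ℝ) 1), HasDerivAt B
      (rayLinearization ha h ζ (rayLift (k, A)) ⟨t, ht⟩) t := by
    intro t ht
    have e1 : HasDerivAt (fun t : ℝ => (t • h, Z t)) (h, η ⟨t, ht⟩) t := by
      have := hZd t
      rw [projIcc_of_mem zero_le_one ht] at this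
      simpa using ((hasDerivAt_id t).smul_const h).prodMk this
    have e2 := ((ha.differentiable one_ne_zero) (t • h, Z t)).hasFDerivAt.comp_hasDerivAt t e1
    have e3 := (hasDerivAt_id t).mul (e2.clm_apply (hasDerivAt_const t k))
    have e3' : HasDerivAt B _ t := e3
    refine e3'.congr_deriv ?_
    rw [rayLinearization_apply]
    -- The derivative of `t a(t h, ζ) k` is `a k + t Da(h, a h) k`. The Frobenius condition
    -- exchanges `h` and `k` in the last term, giving `Da(t k, A) h + a k`, the linearized
    -- right-hand side.
    have e4 := hint ⟨t, ht⟩ h k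
    have e5 : η ⟨t, ht⟩ = a (t • h, ζ ⟨t, ht⟩) h := rfl
    have e6 : ((t • k, A ⟨t, ht⟩) : H × ℝ) = t • (k, a (t • h, ζ ⟨t, ht⟩) k) := by
      rw [hA]; rfl
    have e7 := hZζ ⟨t, ht⟩
    simp only at e4 e7
    rw [e5]
    simp only [e6, map_smul, smul_apply, smul_eq_mul, id, one_mul, map_zero,
      add_zero, ← e7, Function.comp]
    rw [e4, add_comm]
  ext t
  rw [primitive_eq_of_hasDerivAt (A := B)
    (fun t ht => (hd t ht).continuousAt.continuousWithinAt)
    (fun t ht => hd t (Ioo_subset_Icc_self ht)) t, hBA, hB]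
  simp

/-- **Frobenius theorem** for a total differential equation `∂Z/∂x = a(x, Z)` with `C^1` right-hand
side: there is a `C^1` family of local solutions. -/
theorem exists_solution_total_differential [CompleteSpace H] (ha : ContDiff ℝ 1 a)
    (hint : ∀ᶠ x in 𝓝 (0 : H × ℝ), ∀ k l,
      fderiv ℝ a x (k, a x k) l = fderiv ℝ a x (l, a x l) k) :
    ∃ Z : H × ℝ → ℝ, ContDiffAt ℝ 1 Z 0 ∧ Z 0 = 0 ∧
      (∀ k c, fderiv ℝ Z 0 (k, c) = c + a 0 k) ∧
      ∀ᶠ x in 𝓝 (0 : H × ℝ), ∀ k, fderiv ℝ Z x (k, 0) = a (x.1, Z x) k := by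
  have hΦ := (contDiff_rayOperator ha).contDiffAt (x := (0 : (H × ℝ) × C(I, ℝ)))
  have hΦ0 : rayOperator ha 0 = 0 := by
    have : (⟨raySpeed a, (contDiff_raySpeed ha).continuous⟩ : C(H × H × ℝ, ℝ)).comp
        (rayLift ((0 : H), (0 : C(I, ℝ)))) = 0 := by
      ext s; simp [raySpeed]
    simp [rayOperator, this]
  -- At `h = 0` the ray equation reads `ζ' = 0`, so the partial derivative in `ζ` is the identity.
  have hinv : (fderiv ℝ (rayOperator ha) 0 ∘L .inr ℝ (H × ℝ) C(I, ℝ)).IsInvertible := by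
    have : fderiv ℝ (rayOperator ha) 0 ∘L .inr ℝ (H × ℝ) C(I, ℝ)
        = ContinuousLinearEquiv.refl ℝ C(I, ℝ) := by
      ext η t
      have : rayLinearization ha (0 : H) (0 : C(I, ℝ)) (rayLift ((0 : H), η)) = 0 := by
        ext s; simp [rayLinearization_apply]
      simp [fderiv_rayOperator, this]
    rw [this]
    exact ContinuousLinearMap.isInvertible_equiv
  set ψ := hΦ.implicitFunction one_ne_zero hinv with hψ
  have hψC : ContDiffAt ℝ 1 ψ 0 := hΦ.contDiffAt_implicitFunction one_ne_zero hinv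
  have hψ0 : ψ 0 = 0 := hΦ.implicitFunction_apply_self one_ne_zero hinv
  have hψe : ∀ᶠ x in 𝓝 (0 : H × ℝ), rayOperator ha (x, ψ x) = 0 := by
    filter_upwards [hΦ.eventually_apply_implicitFunction one_ne_zero hinv] with x hx
    exact hx.trans hΦ0
  -- Obtained by differentiating the identity `rayOperator (x, ψ x) = 0` in `x`.
  have hlin : ∀ᶠ x in 𝓝 (0 : H × ℝ), ∀ k c, fderiv ℝ ψ x (k, c) =
      c • (1 : C(I, ℝ)) + primitive (rayLinearization ha x.1 (ψ x)
        (rayLift (k, fderiv ℝ ψ x (k, c)))) := by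
    filter_upwards [hψe.eventually_nhds, hψC.eventually (by simp)] with x hx hxC k c
    have h1 := (hxC.differentiableAt one_ne_zero).hasFDerivAt
    have h2 := (((contDiff_rayOperator ha).differentiable one_ne_zero)
      (x, ψ x)).hasFDerivAt.comp x ((hasFDerivAt_id x).prodMk h1)
    have h3 : HasFDerivAt (rayOperator ha ∘ fun x => (id x, ψ x)) (0 : H × ℝ →L[ℝ] C(I, ℝ)) x :=
      (hasFDerivAt_const (0 : C(I, ℝ)) x).congr_of_eventuallyEq hx
    have h4 := congrArg (fun T : H × ℝ →L[ℝ] C(I, ℝ) => T (k, c)) (h2.unique h3)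
    simp only [ContinuousLinearMap.comp_apply, fderiv_rayOperator, ContinuousLinearMap.prod_apply,
      zero_apply, ContinuousLinearMap.id_apply] at h4
    rw [sub_sub, sub_eq_zero] at h4
    exact h4
  let ev : C(I, ℝ) →L[ℝ] ℝ := ContinuousMap.evalCLM ℝ (1 : I)
  have hev : ∀ η : C(I, ℝ), ev η = η 1 := fun η => rfl
  have hfd : ∀ᶠ x in 𝓝 (0 : H × ℝ), ∀ v, fderiv ℝ (fun x => ψ x 1) x v = fderiv ℝ ψ x v 1 := by
    filter_upwards [hψC.eventually (by simp)] with x hxC v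
    have := (ev.hasFDerivAt.comp x (hxC.differentiableAt one_ne_zero).hasFDerivAt).fderiv
    change fderiv ℝ (ev ∘ ψ) x v = _
    rw [this]; rfl
  -- `Z (h, z)` is the value at time 1 of the solution over the ray `t ↦ t h` that starts at `z`.
  refine ⟨fun x => ψ x 1, ev.contDiff.contDiffAt.comp 0 hψC, by simp [hψ0], ?_, ?_⟩
  · intro k c
    rw [hfd.self_of_nhds, hlin.self_of_nhds, hψ0]
    have : rayLinearization ha (0 : H × ℝ).1 (0 : C(I, ℝ))
        (rayLift (k, fderiv ℝ ψ 0 (k, c))) = (a 0 k) • (1 : C(I, ℝ)) := by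
      ext s; simp [rayLinearization_apply, ← Prod.zero_eq_mk]
    rw [this]
    simp [primitive_apply]
  · obtain ⟨r, hr, hball⟩ := Metric.mem_nhds_iff.1 hint
    have hM : ∀ᶠ y in 𝓝 (0 : H × ℝ), ‖fderiv ℝ a y‖ < ‖fderiv ℝ a 0‖ + 1 :=
      ((ha.continuous_fderiv one_ne_zero).norm.tendsto 0).eventually (gt_mem_nhds (by simp))
    obtain ⟨r', hr', hball'⟩ := Metric.mem_nhds_iff.1 hM
    set M := ‖fderiv ℝ a 0‖ + 1 with hMdef
    have hMpos : 0 < M := by positivity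
    have hψt : Tendsto (fun x => ‖ψ x‖) (𝓝 0) (𝓝 0) := by
      have := hψC.continuousAt.norm
      simpa [ContinuousAt, hψ0] using this
    have hxt : Tendsto (fun x : H × ℝ => ‖x.1‖) (𝓝 0) (𝓝 0) := by
      have : ContinuousAt (fun x : H × ℝ => ‖x.1‖) 0 := by fun_prop
      simpa [ContinuousAt] using this
    filter_upwards [hψe, hlin, hfd, hψt.eventually (gt_mem_nhds (lt_min hr hr')),
      hxt.eventually (gt_mem_nhds (lt_min hr hr')),
      hxt.eventually (gt_mem_nhds (inv_pos.2 hMpos))] with x h1 h2 h3 h4 h5 h6 k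
    -- The whole solution curve stays in the region where the Frobenius condition and the bound `M`
    -- on `Da` hold.
    have hmem : ∀ s : I, ‖(((s : ℝ) • x.1, ψ x s) : H × ℝ)‖ < min r r' := fun s => by
      refine (norm_prod_le_iff.2 ⟨?_, (ψ x).norm_coe_le_norm s |>.trans (le_max_right ‖x.1‖ _)⟩
        |>.trans_lt (max_lt h5 h4))
      change ‖(s : ℝ) • x.1‖ ≤ _
      rw [norm_smul, Real.norm_of_nonneg s.2.1]
      exact (mul_le_of_le_one_left (norm_nonneg _) s.2.2).trans (le_max_left _ _)
    let A : C(I, ℝ) := ⟨fun s => (s : ℝ) * a ((s : ℝ) • x.1, ψ x s) k, by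
      have := ha.continuous
      fun_prop⟩
    have hA := ray_variation ha h1 (fun s => hball (by
      simpa using (hmem s).trans_le (min_le_left _ _))) k (A := A) (fun s => rfl)
    set W := fderiv ℝ ψ x (k, 0) with hW
    have hWe := h2 k 0
    rw [← hW, zero_smul, zero_add] at hWe
    -- `W` and `A` solve the same affine integral equation. Their difference solves the homogeneous
    -- one, whose operator has norm at most `M * ‖x.1‖ < 1`, so it vanishes; evaluation at time 1
    -- gives the claim.
    have hD : W - A = primitive (rayLinearization ha x.1 (ψ x) (rayLift ((0 : H), W - A))) := by
      conv_lhs => rw [hWe, ← hA, ← map_sub, ← map_sub, ← map_sub]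
      simp
    have hDn : ‖W - A‖ ≤ M * ‖x.1‖ * ‖W - A‖ := by
      conv_lhs => rw [hD]
      refine (norm_primitive_le _).trans ((ContinuousMap.norm_le _ (by positivity)).2 fun s => ?_)
      rw [rayLinearization_apply, smul_zero, map_zero, add_zero]
      refine (ContinuousLinearMap.le_opNorm _ _).trans ?_
      have e1 : ‖fderiv ℝ a ((s : ℝ) • x.1, ψ x s)‖ ≤ M :=
        (hball' (by simpa using (hmem s).trans_le (min_le_right _ _)) : _ < M).le
      have e2 : ‖(((0 : H), (W - A) s) : H × ℝ)‖ ≤ ‖W - A‖ := by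
        simpa using (W - A).norm_coe_le_norm s
      calc _ ≤ (M * ‖W - A‖) * ‖x.1‖ := by
            gcongr
            exact ContinuousLinearMap.le_of_opNorm_le_of_le _ e1 e2
        _ = _ := by ring
    have h7 : M * ‖x.1‖ < 1 := by
      rwa [← lt_inv_mul_iff₀ hMpos, mul_one] 
    have h8 : W = A := by
      by_contra hne
      have : 0 < ‖W - A‖ := norm_pos_iff.2 (sub_ne_zero.2 hne)
      nlinarith
    rw [h3, ← hW, h8]
    simp [A]

end TotalDifferential

/-! ### Inverse function theorem with a ball as target. -/

section LocalChart

variable {E F : Type*} [NormedAddCommGroup E] [NormedSpace ℝ E] [CompleteSpace E]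
  [NormedAddCommGroup F] [NormedSpace ℝ F]

/-- The inverse function theorem, with a chart whose target is a ball. -/
lemma exists_chart_of_fderiv_equiv {G : E → F} {O : Set E} (hO : IsOpen O)
    (hG : ContDiffOn ℝ 1 G O) {y₀ : E} (hy₀ : y₀ ∈ O) (e : E ≃L[ℝ] F)
    (he : fderiv ℝ G y₀ = e) :
    ∃ φ : OpenPartialHomeomorph E F, y₀ ∈ φ.source ∧ φ.source ⊆ O ∧ ⇑φ = G ∧
      (∃ r > 0, φ.target = Metric.ball (G y₀) r) ∧ ContDiffOn ℝ 1 φ.symm φ.target ∧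
      ∀ y ∈ φ.source, ∃ e' : E ≃L[ℝ] F, HasFDerivAt G (e' : E →L[ℝ] F) y := by
  have hGa : ∀ y ∈ O, ContDiffAt ℝ 1 G y := fun y hy => hG.contDiffAt (hO.mem_nhds hy)
  have hGd : ∀ y ∈ O, HasFDerivAt G (fderiv ℝ G y) y := fun y hy =>
    ((hGa y hy).differentiableAt one_ne_zero).hasFDerivAt
  have hd := hGd y₀ hy₀
  rw [he] at hd
  let φ₀ := (hGa y₀ hy₀).toOpenPartialHomeomorph G hd one_ne_zero
  have hφ₀ : ⇑φ₀ = G := rfl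
  let S : Set E := O ∩ fderiv ℝ G ⁻¹' range ((↑) : (E ≃L[ℝ] F) → E →L[ℝ] F)
  have hS : IsOpen S := (hG.continuousOn_fderiv_of_isOpen hO le_rfl).isOpen_inter_preimage hO
    ContinuousLinearEquiv.isOpen
  have hyS : y₀ ∈ S := ⟨hy₀, e, he.symm⟩
  have hy₀s : y₀ ∈ φ₀.source := (hGa y₀ hy₀).mem_toOpenPartialHomeomorph_source hd one_ne_zero
  let φ₁ := φ₀.restrOpen S hS
  have hφ₁s : φ₁.source = φ₀.source ∩ S := φ₀.restrOpen_source S hS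
  have hy₁ : y₀ ∈ φ₁.source := by rw [hφ₁s]; exact ⟨hy₀s, hyS⟩
  obtain ⟨r, hr, hball⟩ := Metric.isOpen_iff.1 φ₁.open_target (G y₀) (φ₁.map_source hy₁)
  -- The restriction is made on the target side: a ball has convex slices, which later makes the
  -- plaques connected.
  let φ := (φ₁.symm.restrOpen (Metric.ball (G y₀) r) Metric.isOpen_ball).symm
  have ht : φ.target = Metric.ball (G y₀) r := by
    change (φ₁.symm.restrOpen _ Metric.isOpen_ball).source = _
    rw [OpenPartialHomeomorph.restrOpen_source]
    exact inter_eq_right.2 hball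
  have hφ : ⇑φ = G := rfl
  have hsub : φ.source ⊆ S := by
    intro y hy
    have h1 : φ y ∈ φ₁.target := hball (ht ▸ φ.map_source hy)
    have h2 : φ₁.symm (φ y) = y := φ.left_inv hy
    have h3 := φ₁.map_target h1
    rw [h2, hφ₁s] at h3
    exact h3.2
  have hys : y₀ ∈ φ.source := by
    have h1 : G y₀ ∈ φ.target := by rw [ht]; exact Metric.mem_ball_self hr
    have h2 := φ.map_target h1
    have h3 : φ.symm (G y₀) = y₀ := φ₁.left_inv hy₁
    rwa [h3] at h2
  have hequiv : ∀ y ∈ φ.source, ∃ e' : E ≃L[ℝ] F, HasFDerivAt G (e' : E →L[ℝ] F) y := by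
    intro y hy
    obtain ⟨e', he'⟩ := (hsub hy).2
    exact ⟨e', he' ▸ hGd y (hsub hy).1⟩
  refine ⟨φ, hys, fun y hy => (hsub hy).1, hφ, ⟨r, hr, ht⟩, fun x hx => ?_, hequiv⟩
  obtain ⟨e', he'⟩ := hequiv _ (φ.map_target hx)
  exact (φ.contDiffAt_symm hx he' (hGa _ (hsub (φ.map_target hx)).1)).contDiffWithinAt

end LocalChart

/-! ### First integrals of `C^1` forms satisfying the Frobenius condition. -/

section FirstIntegral

variable {E : Type*} [NormedAddCommGroup E] [NormedSpace ℝ E] [FiniteDimensional ℝ E]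

/-- In the coordinates `P`, the kernel of `α` is the graph of `a = -(α ∘ ι) / α(e)`, as long as
`α(e) ≠ 0`. The solutions of `∂Z/∂x = a(x, Z)` give a local diffeomorphism `G(x, z) = (x, Z(x, z))`
that sends the slices `z = const` to integral manifolds; the first integral is the second component
of its inverse. -/
lemma exists_firstIntegral_of_splitting {H : Type*} [NormedAddCommGroup H] [NormedSpace ℝ H]
    [FiniteDimensional ℝ H] {α : E → E →L[ℝ] ℝ} {O : Set E} (hO : IsOpen O)
    (hα : ContDiffOn ℝ 1 α O) {y₀ : E} (hy₀ : y₀ ∈ O) {e : E} (he : α y₀ e = 1)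
    (hint : ∀ y ∈ O, ∀ v w, α y v = 0 → α y w = 0 → fderiv ℝ α y v w = fderiv ℝ α y w v)
    (ι : H →L[ℝ] E) (P : (H × ℝ) ≃L[ℝ] E) (hP : ∀ x : H × ℝ, P x = ι x.1 + x.2 • e) :
    ∃ W : Set E, IsOpen W ∧ y₀ ∈ W ∧ W ⊆ O ∧ ∃ u : E → ℝ, ContDiffOn ℝ 1 u W ∧
      ∀ y ∈ W, ∀ v, fderiv ℝ u y v = 0 ↔ α y v = 0 := by
  have := FiniteDimensional.complete ℝ E
  have := FiniteDimensional.complete ℝ H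
  have hPs : ∀ v : E, ι (P.symm v).1 + (P.symm v).2 • e = v := fun v => by
    rw [← hP, P.apply_symm_apply]
  let T : H × ℝ → E := fun x => y₀ + P x
  have hT : ContDiff ℝ 1 T := contDiff_const.add P.contDiff
  have hT0 : T 0 = y₀ := by simp [T]
  have hTd : ∀ x, HasFDerivAt T (P : (H × ℝ) →L[ℝ] E) x := fun x =>
    P.hasFDerivAt.const_add y₀
  let O' : Set (H × ℝ) := (T ⁻¹' O) ∩ (fun x => α (T x) e) ⁻¹' {0}ᶜ
  have hαT : ContDiffOn ℝ 1 (fun x => α (T x)) (T ⁻¹' O) :=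
    hα.comp hT.contDiffOn (fun x hx => hx)
  have hO' : IsOpen O' := (hαT.clm_apply contDiffOn_const).continuousOn.isOpen_inter_preimage
    (hO.preimage hT.continuous) isOpen_compl_singleton
  have h0O' : (0 : H × ℝ) ∈ O' := by
    refine ⟨by simpa [hT0] using hy₀, ?_⟩
    simp [hT0, he]
  obtain ⟨R, hR, hRO⟩ := Metric.isOpen_iff.1 hO' 0 h0O'
  -- `exists_solution_total_differential` wants `a` to be `C^1` everywhere. The cutoff is 1 on the
  -- ball of radius `R / 3`, where the actual equation is needed, and its support lies inside `O'`.
  let b : ContDiffBump (0 : H × ℝ) := ⟨R / 3, R / 2, by positivity, by linarith⟩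
  let a₀ : H × ℝ → H →L[ℝ] ℝ := fun x => -(α (T x) e)⁻¹ • (α (T x)).comp ι
  have ha₀ : ∀ x ∈ O', ContDiffAt ℝ 1 a₀ x := fun x hx => by
    have h1 : ContDiffAt ℝ 1 (fun x => α (T x)) x :=
      hαT.contDiffAt ((hO.preimage hT.continuous).mem_nhds hx.1)
    exact (((h1.clm_apply contDiffAt_const).inv hx.2).neg).smul (h1.clm_comp contDiffAt_const)
  let a : H × ℝ → H →L[ℝ] ℝ := fun x => b x • a₀ x
  have ha : ContDiff ℝ 1 a := by
    rw [contDiff_iff_contDiffAt]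
    intro x
    by_cases hx : x ∈ Metric.ball 0 R
    · exact b.contDiff.contDiffAt.smul (ha₀ x (hRO hx))
    · have h1 : x ∉ tsupport b := by
        rw [b.tsupport_eq]
        simp only [Metric.mem_ball, Metric.mem_closedBall, not_lt, not_le, b] at hx ⊢
        linarith
      have h2 : a =ᶠ[𝓝 x] fun _ => 0 := by
        filter_upwards [(isClosed_tsupport b).isOpen_compl.mem_nhds h1] with z hz
        simp [a, image_eq_zero_of_notMem_tsupport hz]
      exact contDiffAt_const.congr_of_eventuallyEq h2
  have haa : ∀ x ∈ Metric.ball (0 : H × ℝ) (R / 3), a x = a₀ x := fun x hx => by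
    have : b x = 1 := b.one_of_mem_closedBall (Metric.ball_subset_closedBall hx)
    simp [a, this]
  have hball : Metric.ball (0 : H × ℝ) (R / 3) ⊆ O' :=
    (Metric.ball_subset_ball (by linarith)).trans hRO
  have hrel : ∀ x ∈ Metric.ball (0 : H × ℝ) (R / 3), ∀ l : H,
      α (T x) (ι l + a x l • e) = 0 := fun x hx l => by
    have := (hball hx).2
    simp only [mem_preimage, mem_compl_iff, mem_singleton_iff] at this
    rw [haa x hx]
    simp only [a₀, map_add, map_smul, smul_apply, ContinuousLinearMap.comp_apply,
      smul_eq_mul]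
    field_simp
    ring
  -- Differentiation of the identity `hrel`. For `v = (k, a x k)` the vector `P v` is the lift of
  -- `k` to the kernel of `α`, so `hint` becomes the Frobenius condition on `a`.
  have hda : ∀ x ∈ Metric.ball (0 : H × ℝ) (R / 3), ∀ v, ∀ l : H,
      fderiv ℝ a x v l * α (T x) e = - fderiv ℝ α (T x) (P v) (ι l + a x l • e) := by
    intro x hx v l
    have e1 : HasFDerivAt (fun x => α (T x)) ((fderiv ℝ α (T x)).comp (P : (H × ℝ) →L[ℝ] E)) x :=
      (((hα.contDiffAt (hO.mem_nhds (hball hx).1)).differentiableAt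
        one_ne_zero).hasFDerivAt).comp x (hTd x)
    have e2 := ((ha.differentiable one_ne_zero) x).hasFDerivAt.clm_apply (hasFDerivAt_const l x)
    have e3 := e1.clm_apply ((e2.smul_const e).const_add (ι l))
    have e4 := e3.unique ((hasFDerivAt_const (0 : ℝ) x).congr_of_eventuallyEq (by
      filter_upwards [Metric.isOpen_ball.mem_nhds hx] with z hz using hrel z hz l))
    have e5 := congrArg (fun A : (H × ℝ) →L[ℝ] ℝ => A v) e4
    simp at e5
    rw [map_add, map_smul, smul_eq_mul]
    linarith
  have hfrob : ∀ᶠ x in 𝓝 (0 : H × ℝ), ∀ k l,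
      fderiv ℝ a x (k, a x k) l = fderiv ℝ a x (l, a x l) k := by
    filter_upwards [Metric.ball_mem_nhds (0 : H × ℝ) (by positivity : 0 < R / 3)] with x hx k l
    have hne : α (T x) e ≠ 0 := (hball hx).2
    refine mul_right_cancel₀ hne ?_
    rw [hda x hx, hda x hx, hP, hP]
    rw [hint (T x) (hball hx).1 _ _ (hrel x hx k) (hrel x hx l)]
  obtain ⟨Z, hZ, hZ0, hZd, hZe⟩ := exists_solution_total_differential ha hfrob
  have hmem : ∀ᶠ x in 𝓝 (0 : H × ℝ), ((x.1, Z x) : H × ℝ) ∈ Metric.ball (0 : H × ℝ) (R / 3) := by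
    have : ContinuousAt (fun x : H × ℝ => ((x.1, Z x) : H × ℝ)) 0 :=
      continuousAt_fst.prodMk hZ.continuousAt
    refine this.eventually (Metric.isOpen_ball.mem_nhds ?_)
    simp only [Prod.fst_zero, hZ0]
    exact Metric.mem_ball_self (by positivity)
  obtain ⟨U, hU, hUo, h0U⟩ := eventually_nhds_iff.1
    ((hZ.eventually (by simp)).and (hZe.and hmem))
  let G : H × ℝ → H × ℝ := fun x => (x.1, Z x)
  have hG : ContDiffOn ℝ 1 G U := fun x hx =>
    (contDiffAt_fst.prodMk (hU x hx).1).contDiffWithinAt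
  have hGd : ∀ x ∈ U, HasFDerivAt G ((ContinuousLinearMap.fst ℝ H ℝ).prod (fderiv ℝ Z x)) x :=
    fun x hx => (ContinuousLinearMap.fst ℝ H ℝ).hasFDerivAt.prodMk
      ((hU x hx).1.differentiableAt one_ne_zero).hasFDerivAt
  let Q : (H × ℝ) ≃L[ℝ] (H × ℝ) := ContinuousLinearEquiv.equivOfInverse
    ((ContinuousLinearMap.fst ℝ H ℝ).prod (fderiv ℝ Z 0))
    ((ContinuousLinearMap.fst ℝ H ℝ).prod ((ContinuousLinearMap.snd ℝ H ℝ) -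
      (a 0).comp (ContinuousLinearMap.fst ℝ H ℝ)))
    (fun x => by simp [hZd x.1 x.2]) (fun x => by simp [hZd])
  obtain ⟨φ, hφ0, hφs, hφG, ⟨r, hr, hφt⟩, hφC, hφe⟩ := exists_chart_of_fderiv_equiv hUo hG h0U Q
    ((hGd 0 h0U).fderiv)
  have hG0 : G 0 = 0 := by simp [G, hZ0]
  let S : E → H × ℝ := fun y => P.symm (y - y₀)
  have hS : ContDiff ℝ 1 S := P.symm.contDiff.comp (contDiff_id.sub contDiff_const)
  have hSd : ∀ y, HasFDerivAt S (P.symm : E →L[ℝ] H × ℝ) y := fun y =>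
    P.symm.hasFDerivAt.comp y ((hasFDerivAt_id y).sub_const y₀)
  have hTS : ∀ y, T (S y) = y := fun y => by simp [T, S]
  have hWo : IsOpen (S ⁻¹' φ.target) := φ.open_target.preimage hS.continuous
  refine ⟨S ⁻¹' φ.target, hWo, ?_, ?_, fun y => (φ.symm (S y)).2, ?_, ?_⟩
  · have : S y₀ = 0 := by simp [S]
    rw [mem_preimage, this, ← hG0, ← hφG]
    exact φ.map_source hφ0
  · intro y hy
    have h1 := hφs (φ.map_target hy)
    have h2 := (hU _ h1).2.2
    have h3 : φ (φ.symm (S y)) = S y := φ.right_inv hy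
    rw [hφG] at h3
    change G _ ∈ _ at h2
    rw [h3] at h2
    have := (hball h2).1
    rwa [mem_preimage, hTS] at this
  · exact contDiff_snd.comp_contDiffOn (hφC.comp hS.contDiffOn (fun y hy => hy))
  · intro y hy v
    set x := φ.symm (S y) with hx
    have hxs : x ∈ φ.source := φ.map_target hy
    have hxG : G x = S y := by rw [← hφG]; exact φ.right_inv hy
    obtain ⟨A, hA⟩ := hφe x hxs
    have hA' := hA.unique (hGd x (hφs hxs))
    have hsymm : HasFDerivAt φ.symm (A.symm : (H × ℝ) →L[ℝ] (H × ℝ)) (S y) :=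
      φ.hasFDerivAt_symm hy (by rw [hφG]; exact hA)
    have hu : HasFDerivAt (fun y => (φ.symm (S y)).2)
        ((ContinuousLinearMap.snd ℝ H ℝ).comp
          ((A.symm : (H × ℝ) →L[ℝ] (H × ℝ)).comp (P.symm : E →L[ℝ] H × ℝ))) y :=
      (ContinuousLinearMap.snd ℝ H ℝ).hasFDerivAt.comp y (hsymm.comp y (hSd y))
    rw [hu.fderiv]
    have hb : S y ∈ Metric.ball (0 : H × ℝ) (R / 3) := hxG ▸ (hU x (hφs hxs)).2.2
    have hAk : ∀ k, A (k, 0) = (k, a (S y) k) := fun k => by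
      have h1 : A (k, 0) = (k, fderiv ℝ Z x (k, 0)) := by
        have := congrArg (fun B : (H × ℝ) →L[ℝ] (H × ℝ) => B (k, 0)) hA'
        simpa using this
      rw [h1, (hU x (hφs hxs)).2.1 k]
      change _ = (k, a (S y) k)
      rw [← hxG]
    have hrel' := hrel (S y) hb (P.symm v).1
    have hne : α y e ≠ 0 := by have := (hball hb).2; rwa [mem_preimage, hTS] at this
    rw [hTS] at hrel'
    -- The kernel of `α` is the graph of `a`, and by `hAk` the derivative `A` of `G` maps `H × 0`
    -- onto this graph.
    have key : α y v = 0 ↔ (P.symm v).2 = a (S y) (P.symm v).1 := by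
      have h1 : α y v = ((P.symm v).2 - a (S y) (P.symm v).1) * α y e := by
        conv_lhs => rw [← hPs v]
        rw [map_add, map_smul, smul_eq_mul] at hrel' ⊢
        linarith
      rw [h1, mul_eq_zero, or_iff_left hne, sub_eq_zero]
    rw [key]
    change (A.symm (P.symm v)).2 = 0 ↔ _
    constructor
    · intro h
      have h1 : A.symm (P.symm v) = ((A.symm (P.symm v)).1, 0) := Prod.ext rfl h
      have h2 := congrArg A h1
      rw [A.apply_symm_apply, hAk] at h2
      rw [h2]
    · intro h
      have h1 : P.symm v = A ((P.symm v).1, 0) := by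
        rw [hAk]; exact Prod.ext rfl h
      rw [h1, A.symm_apply_apply]

/-- **Frobenius theorem**: the kernel of a nonvanishing `C^1` form `α` on which the exterior
derivative of `α` vanishes is locally the kernel of the derivative of a `C^1` function. -/
theorem exists_firstIntegral {α : E → E →L[ℝ] ℝ} {O : Set E} (hO : IsOpen O)
    (hα : ContDiffOn ℝ 1 α O) {y₀ : E} (hy₀ : y₀ ∈ O) (h0 : α y₀ ≠ 0)
    (hint : ∀ y ∈ O, ∀ v w, α y v = 0 → α y w = 0 → fderiv ℝ α y v w = fderiv ℝ α y w v) :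
    ∃ W : Set E, IsOpen W ∧ y₀ ∈ W ∧ W ⊆ O ∧ ∃ u : E → ℝ, ContDiffOn ℝ 1 u W ∧
      ∀ y ∈ W, ∀ v, fderiv ℝ u y v = 0 ↔ α y v = 0 := by
  obtain ⟨e, he⟩ : ∃ e, α y₀ e = 1 := by
    obtain ⟨e, he⟩ := DFunLike.ne_iff.1 h0
    exact ⟨(α y₀ e)⁻¹ • e, by rw [map_smul, smul_eq_mul, inv_mul_cancel₀ he]⟩
  let H := (α y₀).ker
  have hri : Function.RightInverse (ContinuousLinearMap.toSpanSingleton ℝ e) (α y₀) := fun c => by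
    simp [he]
  let P : (H × ℝ) ≃L[ℝ] E := (ContinuousLinearEquiv.prodComm ℝ H ℝ).trans
    (ContinuousLinearEquiv.equivOfRightInverse _ _ hri).symm
  have hP : ∀ x : H × ℝ, P x = (x.1 : E) + x.2 • e := fun x =>
    (ContinuousLinearEquiv.equivOfRightInverse_symm_apply _ _ hri x.swap).trans (by simp [add_comm])
  exact exists_firstIntegral_of_splitting hO hα hy₀ he hint H.subtypeL P hP

end FirstIntegral

/-! ### Naturality of `dα / α` on the kernel of `α`. -/

section FormTransform

variable {E E' : Type*} [NormedAddCommGroup E] [NormedSpace ℝ E]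
  [NormedAddCommGroup E'] [NormedSpace ℝ E']

/-- If a `C^2` map `F` sends the kernel of `α` into the kernel of `α'`, then on the kernel of `α`
the forms `dα / α` and `F^* (dα' / α')` agree. -/
lemma extDeriv_transform {α : E → E →L[ℝ] ℝ} {α' : E' → E' →L[ℝ] ℝ} {F : E → E'} {y : E}
    (hα : DifferentiableAt ℝ α y) (hα' : DifferentiableAt ℝ α' (F y)) (hF : ContDiffAt ℝ 2 F y)
    (hker : ∀ᶠ z in 𝓝 y, ∀ v, α z v = 0 → α' (F z) (fderiv ℝ F z v) = 0) {v w : E} (u : E)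
    (hv : α y v = 0) (hw : α y w = 0) :
    (fderiv ℝ α' (F y) (fderiv ℝ F y v) (fderiv ℝ F y w) -
      fderiv ℝ α' (F y) (fderiv ℝ F y w) (fderiv ℝ F y v)) * α y u =
    (fderiv ℝ α y v w - fderiv ℝ α y w v) * α' (F y) (fderiv ℝ F y u) := by
  let β : E → E →L[ℝ] ℝ := fun z => (α' (F z)).comp (fderiv ℝ F z)
  have hFd : HasFDerivAt F (fderiv ℝ F y) y := (hF.differentiableAt two_ne_zero).hasFDerivAt
  have hF2 : HasFDerivAt (fderiv ℝ F) (fderiv ℝ (fderiv ℝ F) y) y :=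
    ((hF.fderiv_right (m := 1) (by norm_num)).differentiableAt one_ne_zero).hasFDerivAt
  have hβ := (hα'.hasFDerivAt.comp y hFd).clm_comp hF2
  have hβe : ∀ v w, fderiv ℝ β y v w = fderiv ℝ α' (F y) (fderiv ℝ F y v) (fderiv ℝ F y w) +
      α' (F y) (fderiv ℝ (fderiv ℝ F) y v w) := fun v w => by
    have : fderiv ℝ β y = _ := hβ.fderiv
    rw [this]
    simp [add_comm]
  have hβd : DifferentiableAt ℝ β y := hβ.differentiableAt
  have hsymm := (hF.isSymmSndFDerivAt (by simp)).eq v w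
  -- The pullback `β` of `α'` vanishes on `ker α`, so it is proportional to `α`; this is the
  -- proportionality without division. Its derivative in a direction `v`, on vectors `w` of the
  -- kernel, gives `main`. The second derivatives of `F` then drop out by symmetry.
  have hprop : ∀ᶠ z in 𝓝 y, ∀ w u, β z w * α z u - β z u * α z w = 0 := by
    filter_upwards [hker] with z hz w u
    have := hz (α z u • w - α z w • u) (by simp; ring)
    have h2 : β z (α z u • w - α z w • u) = 0 := this
    simp only [map_sub, map_smul, smul_eq_mul] at h2
    linarith
  have hβ0 : ∀ w, α y w = 0 → β y w = 0 := fun w hw => hker.self_of_nhds w hw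
  have main : ∀ v w, α y v = 0 → α y w = 0 →
      fderiv ℝ β y v w * α y u = β y u * fderiv ℝ α y v w := by
    intro v w hv hw
    have d1 := hβd.hasFDerivAt.clm_apply (hasFDerivAt_const w y)
    have d2 := hβd.hasFDerivAt.clm_apply (hasFDerivAt_const u y)
    have d3 := hα.hasFDerivAt.clm_apply (hasFDerivAt_const w y)
    have d4 := hα.hasFDerivAt.clm_apply (hasFDerivAt_const u y)
    have d5 := ((d1.mul d4).sub (d2.mul d3)).unique
      ((hasFDerivAt_const (0 : ℝ) y).congr_of_eventuallyEq
        (hprop.mono fun z hz => hz w u))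
    have d6 := congrArg (fun A : E →L[ℝ] ℝ => A v) d5
    simp [hw, hβ0 w hw] at d6
    linarith
  have m1 := main v w hv hw
  have m2 := main w v hw hv
  rw [hβe] at m1 m2
  rw [hsymm] at m1
  change _ = _ * β y u
  linarith

end FormTransform

/-! ### Iterates and inverses of diffeomorphisms. -/

section Diffeomorphisms

variable {n : ℕ} {M : Type*} [TopologicalSpace M] [ChartedSpace (Euc n) M]

variable {k : ℕ∞ω}

/-- The iterates of a diffeomorphism. -/
def diffeoIterate (f : Diffeomorph (𝓡 n) (𝓡 n) M M k) : ℕ → Diffeomorph (𝓡 n) (𝓡 n) M M k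
  | 0 => Diffeomorph.refl (𝓡 n) M k
  | m + 1 => (diffeoIterate f m).trans f

lemma coe_diffeoIterate (f : Diffeomorph (𝓡 n) (𝓡 n) M M k) (m : ℕ) :
    ⇑(diffeoIterate f m) = f^[m] := by
  induction m with
  | zero => rfl
  | succ m ih => rw [Function.iterate_succ', ← ih]; rfl

lemma coe_diffeoIterate_symm (f : Diffeomorph (𝓡 n) (𝓡 n) M M k) (m : ℕ) :
    ⇑(diffeoIterate f m).symm = f.symm^[m] := by
  induction m with
  | zero => rfl
  | succ m ih => rw [Function.iterate_succ, ← ih]; rfl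

/-- Vectors are read in `Euc n`, to which every tangent space unfolds, because `f.symm (f p)` and
`p` are not definitionally equal. -/
lemma mfderiv_symm_apply_mfderiv (f : Diffeomorph (𝓡 n) (𝓡 n) M M k) (hk : k ≠ 0) (p : M)
    (v : Euc n) :
    (mfderiv (𝓡 n) (𝓡 n) f.symm (f p) (mfderiv (𝓡 n) (𝓡 n) f p v) : Euc n) = v := by
  have h1 := ((f.symm.mdifferentiable hk (f p)).hasMFDerivAt.comp p
    (f.mdifferentiable hk p).hasMFDerivAt).mfderiv
  have h2 : f.symm ∘ f = id := by ext x; simp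
  rw [h2, mfderiv_id] at h1
  exact (congrArg (fun A : Euc n →L[ℝ] Euc n => A v) h1).symm

lemma mfderiv_ne_zero (f : Diffeomorph (𝓡 n) (𝓡 n) M M k) (hk : k ≠ 0) (p : M)
    {v : TangentSpace (𝓡 n) p} (hv : v ≠ 0) : mfderiv (𝓡 n) (𝓡 n) f p v ≠ 0 := by
  intro h
  apply hv
  have h1 := mfderiv_symm_apply_mfderiv f hk p v
  rw [h] at h1
  exact h1.symm.trans (map_zero _)

lemma IsDInvariant.iterate {f : Diffeomorph (𝓡 n) (𝓡 n) M M k} (hk : k ≠ 0)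
    {E : ∀ p : M, Submodule ℝ (TangentSpace (𝓡 n) p)} (h : IsDInvariant f E) (m : ℕ) :
    IsDInvariant (diffeoIterate f m) E := by
  induction m with
  | zero =>
    intro p
    change (E p).map (mfderiv (𝓡 n) (𝓡 n) id p).toLinearMap = E p
    rw [mfderiv_id]
    exact Submodule.map_id _
  | succ m ih =>
    intro p
    have h1 := ((f.mdifferentiable hk (diffeoIterate f m p)).hasMFDerivAt.comp p
      ((diffeoIterate f m).mdifferentiable hk p).hasMFDerivAt).mfderiv
    change (E p).map (mfderiv (𝓡 n) (𝓡 n) (f ∘ diffeoIterate f m) p).toLinearMap =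
      E (f (diffeoIterate f m p))
    rw [h1, ← h, ← ih]
    exact Submodule.map_comp _ _ _

lemma IsDInvariant.symm {f : Diffeomorph (𝓡 n) (𝓡 n) M M k} (hk : k ≠ 0)
    {E : ∀ p : M, Submodule ℝ (TangentSpace (𝓡 n) p)} (h : IsDInvariant f E) :
    IsDInvariant f.symm E := by
  intro q
  obtain ⟨p, rfl⟩ : ∃ p, f p = q := ⟨f.symm q, f.apply_symm_apply q⟩
  have e : f.symm (f p) = p := f.symm_apply_apply p
  rw [e, ← h p]
  ext v
  constructor
  · rintro ⟨_, ⟨w, hw, rfl⟩, rfl⟩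
    have := mfderiv_symm_apply_mfderiv f hk p w
    change mfderiv (𝓡 n) (𝓡 n) f.symm (f p) (mfderiv (𝓡 n) (𝓡 n) f p w) ∈ E p
    rw [this]
    exact hw
  · intro hv
    exact ⟨_, ⟨v, hv, rfl⟩, mfderiv_symm_apply_mfderiv f hk p v⟩

/-- The data at `p` and at the `m`-th preimage of `p` used to exchange `f` and its inverse. -/
lemma iterate_symm_data (f : Diffeomorph (𝓡 n) (𝓡 n) M M k) (hk : k ≠ 0) (m : ℕ) (p : M) :
    ∃ q, f.symm^[m] p = q ∧ f^[m] q = p ∧ ∀ v : Euc n,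
      (mfderiv (𝓡 n) (𝓡 n) f^[m] q (mfderiv (𝓡 n) (𝓡 n) f.symm^[m] p v : Euc n) : Euc n) = v := by
  refine ⟨_, rfl, ?_, fun v => ?_⟩
  · rw [← coe_diffeoIterate f, ← coe_diffeoIterate_symm f]
    exact (diffeoIterate f m).apply_symm_apply p
  · rw [← coe_diffeoIterate f, ← coe_diffeoIterate_symm f]
    exact mfderiv_symm_apply_mfderiv (diffeoIterate f m).symm hk p v

end Diffeomorphisms

/-! ### Leaves, plaques and paths. -/

namespace Foliation

section Leaves

variable {n : ℕ} {M : Type*} [TopologicalSpace M] [ChartedSpace (Euc n) M]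
  {k : ℕ∞ω} {d c : ℕ} (F : Foliation n M k d c)

lemma samePlaque_symm {p q : M} (h : F.SamePlaque p q) : F.SamePlaque q p := by
  obtain ⟨φ, hφ, hp, hq, h⟩ := h
  exact ⟨φ, hφ, hq, hp, h.symm⟩

lemma mem_leaf_self (p : M) : p ∈ F.leaf p := Relation.EqvGen.refl p

lemma mem_leaf_symm {p q : M} (h : q ∈ F.leaf p) : p ∈ F.leaf q := Relation.EqvGen.symm _ _ h

lemma mem_leaf_trans {p q r : M} (h : q ∈ F.leaf p) (h' : r ∈ F.leaf q) : r ∈ F.leaf p :=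
  Relation.EqvGen.trans _ _ _ h h'

lemma SamePlaque.mem_leaf {F : Foliation n M k d c} {p q : M} (h : F.SamePlaque p q) :
    q ∈ F.leaf p := Relation.EqvGen.rel _ _ h

lemma leaf_eq_of_mem {p q : M} (h : q ∈ F.leaf p) : F.leaf q = F.leaf p := by
  ext r
  exact ⟨fun h' => F.mem_leaf_trans h h', fun h' => F.mem_leaf_trans (F.mem_leaf_symm h) h'⟩

/-- An equivalence relation that holds locally along plaques holds along leaves. -/
lemma rel_of_mem_leaf {R : M → M → Prop} (hR : Equivalence R)
    (hloc : ∀ φ ∈ F.charts, ∀ p ∈ φ.source, ∀ᶠ q in 𝓝 p, (φ p).2 = (φ q).2 → R p q)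
    {p q : M} (h : q ∈ F.leaf p) : R p q := by
  induction h with
  | refl p => exact hR.refl p
  | symm p q _ ih => exact hR.symm ih
  | trans p q r _ _ ih ih' => exact hR.trans ih ih'
  | rel p q h =>
    obtain ⟨φ, hφ, hp, hq, heq⟩ := h
    -- Connectedness of the plaque turns the local relation into a relation between any two of its
    -- points.
    have key := (F.plaque_connected φ hφ (φ p).2).induction₂
      (fun x x' => R (φ.symm (x, (φ p).2)) (φ.symm (x', (φ p).2)))
      (fun x hx => by
        have hx' : (x, (φ p).2) ∈ φ.target := hx
        have h1 := hloc φ hφ _ (φ.map_target hx')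
        have h2 : ContinuousAt (fun x' => φ.symm (x', (φ p).2)) x :=
          (φ.continuousAt_symm hx').comp
            (f := fun x' : Euc d => (x', (φ p).2)) (by fun_prop)
        filter_upwards [nhdsWithin_le_nhds (h2.eventually h1), self_mem_nhdsWithin] with x' h3 h4
        refine h3 ?_
        rw [φ.right_inv hx', φ.right_inv h4])
      (fun _ _ _ _ _ _ h h' => hR.trans h h') (fun _ _ _ _ h => hR.symm h)
      (x := (φ p).1) (y := (φ q).1) (φ.map_source hp)
      (by change ((φ q).1, (φ p).2) ∈ φ.target; rw [heq]; exact φ.map_source hq)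
    simp only [Prod.mk.eta] at key
    rw [φ.left_inv hp] at key
    rw [heq, Prod.mk.eta, φ.left_inv hq] at key
    exact key

/-- Being joined inside the leaf is an equivalence relation, so it is enough to join nearby points
of a plaque, and a segment in a ball of the chart does this. -/
lemma joinedIn_leaf {p q : M} (h : q ∈ F.leaf p) : JoinedIn (F.leaf p) p q := by
  refine F.rel_of_mem_leaf (R := fun p q => JoinedIn (F.leaf p) p q)
    ⟨fun p => JoinedIn.refl (F.mem_leaf_self p), fun {p q} h => ?_, fun {p q r} h h' => ?_⟩ ?_ h
  · rw [F.leaf_eq_of_mem h.target_mem]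
    exact h.symm
  · rw [F.leaf_eq_of_mem h.target_mem] at h'
    exact h.trans h'
  · intro φ hφ p hp
    obtain ⟨r, hr, hball⟩ := Metric.isOpen_iff.1 φ.open_target _ (φ.map_source hp)
    filter_upwards [(φ.continuousAt hp).eventually (Metric.ball_mem_nhds _ hr),
      φ.open_source.mem_nhds hp] with q hq hqs heq
    have hseg : ∀ t ∈ Icc (0 : ℝ) 1,
        AffineMap.lineMap (k := ℝ) (φ p) (φ q) t ∈ Metric.ball (φ p) r := fun t ht =>
      (convex_ball _ _).lineMap_mem (Metric.mem_ball_self hr) hq ht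
    refine JoinedIn.ofLine (f := fun t => φ.symm (AffineMap.lineMap (k := ℝ) (φ p) (φ q) t)) ?_
      (by simp [φ.left_inv hp]) (by simp [φ.left_inv hqs]) ?_
    · exact φ.continuousOn_symm.comp AffineMap.lineMap_continuous.continuousOn
        fun t ht => hball (hseg t ht)
    · rintro _ ⟨t, ht, rfl⟩
      have h1 := hball (hseg t ht)
      refine SamePlaque.mem_leaf ⟨φ, hφ, hp, φ.map_target h1, ?_⟩
      rw [φ.right_inv h1]
      simp [AffineMap.lineMap_apply, heq]

/-- A leaf meets every chart in countably many plaques. -/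
lemma countable_plaques [SecondCountableTopology M] (hF : F.charts.Countable) (p : M)
    {φ : OpenPartialHomeomorph M (Euc d × Euc c)} (hφ : φ ∈ F.charts) :
    ((fun q => (φ q).2) '' (F.leaf p ∩ φ.source)).Countable := by
  -- On one plaque of `ψ` the transverse coordinate of `φ` is locally constant, hence takes
  -- countably many values by the Lindelöf property.
  have plaque : ∀ ψ ∈ F.charts, ∀ y, ∀ φ ∈ F.charts,
      ((fun q => (φ q).2) '' ({q | q ∈ ψ.source ∧ (ψ q).2 = y} ∩ φ.source)).Countable := by
    intro ψ hψ y φ hφ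
    obtain ⟨t, -, htc, hts⟩ := TopologicalSpace.countable_cover_nhdsWithin
      (s := {q | q ∈ ψ.source ∧ (ψ q).2 = y} ∩ φ.source)
      (f := fun x => {q | (φ q).2 = (φ x).2}) (fun x hx => by
        obtain ⟨V, hV, hV'⟩ := F.compatible ψ hψ φ hφ x ⟨hx.1.1, hx.2⟩
        filter_upwards [nhdsWithin_le_nhds hV, self_mem_nhdsWithin] with q hq hq'
        exact hV' q hq x (mem_of_mem_nhds hV) (hq'.1.2.trans hx.1.2.symm))
    refine (htc.image fun x => (φ x).2).mono ?_
    rintro _ ⟨q, hq, rfl⟩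
    obtain ⟨x, hx, hxq⟩ := mem_iUnion₂.1 (hts hq)
    exact ⟨x, hx, hxq.symm⟩
  -- The points reached from `p` through `m` plaques; their union is the leaf.
  let S : ℕ → Set M := fun m => Nat.rec {p} (fun _ s => {q | ∃ q' ∈ s, F.SamePlaque q' q}) m
  have hS : ∀ m, ∀ φ ∈ F.charts, ((fun q => (φ q).2) '' (S m ∩ φ.source)).Countable := by
    intro m
    induction m with
    | zero => exact fun φ _ => ((countable_singleton p).mono inter_subset_left).image _
    | succ m ih =>
      intro φ hφ
      have : (fun q => (φ q).2) '' (S (m + 1) ∩ φ.source) ⊆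
          ⋃ ψ ∈ F.charts, ⋃ y ∈ (fun q => (ψ q).2) '' (S m ∩ ψ.source),
            (fun q => (φ q).2) '' ({q | q ∈ ψ.source ∧ (ψ q).2 = y} ∩ φ.source) := by
        rintro _ ⟨q, ⟨⟨q', hq', ψ, hψ, h1, h2, h3⟩, hq⟩, rfl⟩
        simp only [mem_iUnion]
        exact ⟨ψ, hψ, _, ⟨q', ⟨hq', h1⟩, rfl⟩, q, ⟨⟨h2, h3.symm⟩, hq⟩, rfl⟩
      exact (hF.biUnion fun ψ hψ => (ih ψ hψ).biUnion fun y _ => plaque ψ hψ y φ hφ).mono this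
  have hleaf : ∀ a b, b ∈ F.leaf a → ((∃ m, a ∈ S m) ↔ ∃ m, b ∈ S m) := by
    intro a b h
    induction h with
    | refl a => exact Iff.rfl
    | symm a b _ ih => exact ih.symm
    | trans a b c _ _ ih ih' => exact ih.trans ih'
    | rel a b h =>
      exact ⟨fun ⟨m, hm⟩ => ⟨m + 1, a, hm, h⟩,
        fun ⟨m, hm⟩ => ⟨m + 1, b, hm, F.samePlaque_symm h⟩⟩
  refine (countable_iUnion fun m => hS m φ hφ).mono ?_
  rintro _ ⟨q, ⟨hq, hqs⟩, rfl⟩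
  obtain ⟨m, hm⟩ := (hleaf p q hq).1 ⟨0, rfl⟩
  exact mem_iUnion.2 ⟨m, q, ⟨hm, hqs⟩, rfl⟩

/-- A path contained in a leaf stays locally in one plaque. -/
lemma eventually_samePlaque_of_path [SecondCountableTopology M] (hF : F.charts.Countable) {p : M}
    {γ : ℝ → M} (hγ : Continuous γ) (hleaf : ∀ t, γ t ∈ F.leaf p) (t : ℝ)
    {φ : OpenPartialHomeomorph M (Euc d × Euc c)} (hφ : φ ∈ F.charts) (ht : γ t ∈ φ.source) :
    ∀ᶠ s in 𝓝 t, γ s ∈ φ.source ∧ (φ (γ t)).2 = (φ (γ s)).2 := by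
  have hO : IsOpen (γ ⁻¹' φ.source) := φ.open_source.preimage hγ
  obtain ⟨V, hV, hVsub, htV, hVc⟩ := locallyConnectedSpace_iff_subsets_isOpen_isConnected.1
    inferInstance t _ (hO.mem_nhds ht)
  filter_upwards [hVsub.mem_nhds htV] with s hs
  refine ⟨hV hs, ?_⟩
  have hcont : ContinuousOn (fun s => (φ (γ s)).2) V :=
    continuous_snd.comp_continuousOn (φ.continuousOn.comp hγ.continuousOn fun s hs => hV hs)
  -- Near `t` the transverse coordinate maps an interval continuously into a countable, hence
  -- totally disconnected, set.
  refine (F.countable_plaques hF p hφ).isTotallyDisconnected _ ?_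
    (hVc.isPreconnected.image _ hcont) ⟨t, htV, rfl⟩ ⟨s, hs, rfl⟩
  rintro _ ⟨s, hs, rfl⟩
  exact ⟨γ s, ⟨hleaf s, hV hs⟩, rfl⟩

end Leaves

/-! ### Foliations and their tangent bundles. -/

section Tangency

variable {n : ℕ} {M : Type*} [TopologicalSpace M] [ChartedSpace (Euc n) M]

/-- A function whose derivative vanishes on the kernel of the derivative of the transverse
coordinate of a foliated chart is locally constant on the plaques. -/
lemma eventually_eq_of_ker_le {d c : ℕ} {φ : OpenPartialHomeomorph M (Euc d × Euc c)}
    (hφ : ContMDiffOn (𝓡 n) 𝓘(ℝ, Euc d × Euc c) 1 φ φ.source)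
    (hφs : ContMDiffOn 𝓘(ℝ, Euc d × Euc c) (𝓡 n) 1 φ.symm φ.target)
    {p : M} (hp : p ∈ φ.source) {F : Type*} [NormedAddCommGroup F] [NormedSpace ℝ F] {h : M → F}
    (hh : ∀ᶠ q in 𝓝 p, MDifferentiableAt (𝓡 n) 𝓘(ℝ, F) h q ∧
      ∀ v, mfderiv (𝓡 n) 𝓘(ℝ, Euc c) (fun q => (φ q).2) q v = 0 →
        mfderiv (𝓡 n) 𝓘(ℝ, F) h q v = 0) :
    ∃ V ∈ 𝓝 p, ∀ q ∈ V, ∀ q' ∈ V, (φ q).2 = (φ q').2 → h q = h q' := by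
  obtain ⟨W, hW, hWo, hpW⟩ := eventually_nhds_iff.1 hh
  have hO : IsOpen (φ.target ∩ φ.symm ⁻¹' W) := φ.isOpen_inter_preimage_symm hWo
  have hpO : φ p ∈ φ.target ∩ φ.symm ⁻¹' W :=
    ⟨φ.map_source hp, by rwa [mem_preimage, φ.left_inv hp]⟩
  obtain ⟨r, hr, hball⟩ := Metric.isOpen_iff.1 hO _ hpO
  -- Read in the chart, `h` has zero derivative along the plaque directions, so it is constant on
  -- the convex slices of a ball.
  have hder : ∀ z ∈ Metric.ball (φ p) r, ∃ D : Euc d × Euc c →L[ℝ] F,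
      HasFDerivAt (h ∘ φ.symm) D z ∧ ∀ v, D (v, 0) = 0 := by
    intro z hz
    obtain ⟨hzt, hzW⟩ := hball hz
    obtain ⟨h1, h2⟩ := hW _ hzW
    have h3 : HasMFDerivAt 𝓘(ℝ, Euc d × Euc c) (𝓡 n) φ.symm z _ :=
      ((hφs.mdifferentiableOn one_ne_zero z hzt).mdifferentiableAt
        (φ.open_target.mem_nhds hzt)).hasMFDerivAt
    have h4 := h1.hasMFDerivAt.comp z h3
    refine ⟨_, h4.hasFDerivAt, fun v => ?_⟩
    refine h2 _ ?_
    have h5 : MDifferentiableAt (𝓡 n) 𝓘(ℝ, Euc d × Euc c) φ (φ.symm z) :=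
      (hφ.mdifferentiableOn one_ne_zero _ (φ.map_target hzt)).mdifferentiableAt
        (φ.open_source.mem_nhds (φ.map_target hzt))
    have h6 : MDifferentiableAt (𝓡 n) 𝓘(ℝ, Euc c) (fun q => (φ q).2) (φ.symm z) :=
      ((ContinuousLinearMap.snd ℝ (Euc d) (Euc c)).mdifferentiable).mdifferentiableAt.comp _ h5
    let A : Euc d × Euc c →L[ℝ] Euc c :=
      (mfderiv (𝓡 n) 𝓘(ℝ, Euc c) (fun q => (φ q).2) (φ.symm z)).comp
        (mfderiv 𝓘(ℝ, Euc d × Euc c) (𝓡 n) φ.symm z)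
    have h7 : HasFDerivAt (fun z => (φ (φ.symm z)).2) A z :=
      (h6.hasMFDerivAt.comp z h3).hasFDerivAt
    have h8 : HasFDerivAt (fun z : Euc d × Euc c => z.2)
        (ContinuousLinearMap.snd ℝ (Euc d) (Euc c)) z :=
      (ContinuousLinearMap.snd ℝ (Euc d) (Euc c)).hasFDerivAt
    have h9 := h7.unique (h8.congr_of_eventuallyEq (by
      filter_upwards [φ.open_target.mem_nhds hzt] with z' hz'
      rw [φ.right_inv hz']))
    exact congrArg (fun A : Euc d × Euc c →L[ℝ] Euc c => A (v, 0)) h9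
  refine ⟨φ.source ∩ φ ⁻¹' Metric.ball (φ p) r,
    Filter.inter_mem (φ.open_source.mem_nhds hp)
      ((φ.continuousAt hp).preimage_mem_nhds (Metric.ball_mem_nhds _ hr)), ?_⟩
  rintro q ⟨hq, hqb⟩ q' ⟨hq', hqb'⟩ heq
  have hconv : Convex ℝ {x : Euc d | (x, (φ q).2) ∈ Metric.ball (φ p) r} := by
    intro x hx x' hx' a b ha hb hab
    have := convex_ball (φ p) r hx hx' ha hb hab
    have e : a • (φ q).2 + b • (φ q).2 = (φ q).2 := by rw [← add_smul, hab, one_smul]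
    simpa [e] using this
  have hopen : IsOpen {x : Euc d | (x, (φ q).2) ∈ Metric.ball (φ p) r} :=
    Metric.isOpen_ball.preimage (by fun_prop : Continuous fun x : Euc d => (x, (φ q).2))
  have hx : ∀ x ∈ {x : Euc d | (x, (φ q).2) ∈ Metric.ball (φ p) r},
      HasFDerivAt (fun x => h (φ.symm (x, (φ q).2))) (0 : Euc d →L[ℝ] F) x := by
    intro x hx
    obtain ⟨D, hD, hD0⟩ := hder _ hx
    have h1 : HasFDerivAt (fun x : Euc d => (x, (φ q).2))
        (ContinuousLinearMap.inl ℝ (Euc d) (Euc c)) x := hasFDerivAt_prodMk_left x _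
    have h2 := hD.comp x h1
    have h3 : D.comp (ContinuousLinearMap.inl ℝ (Euc d) (Euc c)) = 0 := by
      ext v; simp [hD0]
    rwa [h3] at h2
  have key := hconv.is_const_of_fderivWithin_eq_zero (𝕜 := ℝ)
    (f := fun x => h (φ.symm (x, (φ q).2)))
    (fun x h => (hx x h).differentiableAt.differentiableWithinAt)
    (fun x h => by
      rw [fderivWithin_of_isOpen hopen h]
      exact (hx x h).fderiv)
    (x := (φ q).1) (y := (φ q').1) hqb (by
      change ((φ q').1, (φ q).2) ∈ Metric.ball (φ p) r
      rw [heq]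
      exact hqb')
  simp only [Prod.mk.eta] at key
  rw [φ.left_inv hq, heq, Prod.mk.eta, φ.left_inv hq'] at key
  exact key

variable {d c d' c' : ℕ} {F : Foliation n M 1 d c}
  {F' : Foliation n M 1 d' c'} {E E' : ∀ p : M, Submodule ℝ (TangentSpace (𝓡 n) p)}

lemma mdifferentiableAt_snd {φ : OpenPartialHomeomorph M (Euc d × Euc c)} (hφ : φ ∈ F.charts)
    {p : M} (hp : p ∈ φ.source) :
    MDifferentiableAt (𝓡 n) 𝓘(ℝ, Euc c) (fun q => (φ q).2) p :=
  ((ContinuousLinearMap.snd ℝ (Euc d) (Euc c)).mdifferentiable).mdifferentiableAt.comp _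
    (((F.contMDiffOn φ hφ).mdifferentiableOn one_ne_zero _ hp).mdifferentiableAt
      (φ.open_source.mem_nhds hp))

/-- A `C^1` map whose derivative sends `E` into `E'` sends leaves of a foliation tangent to `E`
into leaves of a foliation tangent to `E'`. -/
lemma map_mem_leaf (hF : F.IsTangentTo E) (hF' : F'.IsTangentTo E') {f : M → M}
    (hf : ContMDiff (𝓡 n) (𝓡 n) 1 f)
    (hE : ∀ p, ∀ v ∈ E p, mfderiv (𝓡 n) (𝓡 n) f p v ∈ E' (f p)) {p q : M} (h : q ∈ F.leaf p) :
    f q ∈ F'.leaf (f p) := by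
  refine F.rel_of_mem_leaf (R := fun p q => f q ∈ F'.leaf (f p))
    ⟨fun p => F'.mem_leaf_self _, fun h => F'.mem_leaf_symm h, fun h h' => F'.mem_leaf_trans h h'⟩
    ?_ h
  intro φ hφ p hp
  obtain ⟨ψ, hψ, hfp⟩ := F'.cover (f p)
  have hsrc : ∀ᶠ q in 𝓝 p, f q ∈ ψ.source :=
    hf.continuous.continuousAt.eventually (ψ.open_source.mem_nhds hfp)
  obtain ⟨V, hV, hV'⟩ := eventually_eq_of_ker_le (F.contMDiffOn φ hφ) (F.contMDiffOn_symm φ hφ) hp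
    (h := fun q => (ψ (f q)).2) (by
      filter_upwards [hsrc, φ.open_source.mem_nhds hp] with q hq hqs
      have h1 := (mdifferentiableAt_snd hψ hq)
      have h2 : MDifferentiableAt (𝓡 n) (𝓡 n) f q := hf.mdifferentiable one_ne_zero q
      refine ⟨h1.comp q h2, fun v hv => ?_⟩
      have h3 : v ∈ E q := by
        rw [← hF φ hφ q hqs]; exact hv
      have h4 := hE q v h3
      rw [← hF' ψ hψ _ hq] at h4
      have h5 := (h1.hasMFDerivAt.comp q h2.hasMFDerivAt).mfderiv
      change mfderiv _ _ ((fun q => (ψ q).2) ∘ f) q v = 0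
      rw [h5]
      exact h4)
  filter_upwards [hV, hsrc] with q hq hqs heq
  exact SamePlaque.mem_leaf ⟨ψ, hψ, hfp, hqs, hV' p (mem_of_mem_nhds hV) q hq heq⟩

lemma leaf_subset_of_le (hF : F.IsTangentTo E) (hF' : F'.IsTangentTo E') (hE : ∀ p, E p ≤ E' p)
    (p : M) : F.leaf p ⊆ F'.leaf p := fun q hq => by
  refine map_mem_leaf hF hF' contMDiff_id (fun p v hv => ?_) hq
  rw [mfderiv_id]
  exact hE p hv

/-- A foliation tangent to an invariant family of subspaces is invariant. -/
lemma isInvariant_of_isDInvariant (hF : F.IsTangentTo E) {m : ℕ∞ω}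
    (f : Diffeomorph (𝓡 n) (𝓡 n) M M m) (hm : 1 ≤ m) (hE : IsDInvariant f E) :
    F.IsInvariant f := by
  have hm0 : m ≠ 0 := (zero_lt_one.trans_le hm).ne'
  intro p
  have hfwd : ∀ p, ∀ v ∈ E p, mfderiv (𝓡 n) (𝓡 n) f p v ∈ E (f p) := fun p v hv => by
    rw [← hE p]
    exact Submodule.mem_map_of_mem hv
  have hbwd : ∀ p, ∀ v ∈ E p, mfderiv (𝓡 n) (𝓡 n) f.symm p v ∈ E (f.symm p) := fun p v hv => by
    rw [← hE.symm hm0 p]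
    exact Submodule.mem_map_of_mem hv
  ext q
  constructor
  · rintro ⟨q, hq, rfl⟩
    exact map_mem_leaf hF hF (f.contMDiff.of_le hm) hfwd hq
  · intro hq
    have := map_mem_leaf hF hF (f.symm.contMDiff.of_le hm) hbwd hq
    rw [f.symm_apply_apply] at this
    exact ⟨f.symm q, this, f.apply_symm_apply q⟩

/-- If `E = E₁ ∩ E₂`, the leaves of the foliation tangent to `E` are the path components of the
intersections of the leaves of the foliations tangent to `E₁` and `E₂`. -/
lemma leaf_eq_pathComponentIn_inter [SecondCountableTopology M] {d₁ c₁ d₂ c₂ : ℕ}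
    {F₁ : Foliation n M 1 d₁ c₁} {F₂ : Foliation n M 1 d₂ c₂}
    {E₁ E₂ : ∀ p : M, Submodule ℝ (TangentSpace (𝓡 n) p)}
    (hF : F.IsTangentTo E) (hF₁ : F₁.IsTangentTo E₁) (hF₂ : F₂.IsTangentTo E₂)
    (hE : ∀ p, E p = E₁ p ⊓ E₂ p) (hc₁ : F₁.charts.Countable) (hc₂ : F₂.charts.Countable)
    (p : M) : F.leaf p = pathComponentIn (F₁.leaf p ∩ F₂.leaf p) p := by
  apply Subset.antisymm
  · intro q hq
    exact (F.joinedIn_leaf hq).mono (subset_inter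
      (leaf_subset_of_le hF hF₁ (fun p => (hE p).trans_le inf_le_left) p)
      (leaf_subset_of_le hF hF₂ (fun p => (hE p).trans_le inf_le_right) p))
  · rintro q ⟨γ', hγ'⟩
    obtain ⟨γ, hγc, hγ0, hγ1, hγ⟩ : ∃ γ : ℝ → M, Continuous γ ∧ γ 0 = p ∧ γ 1 = q ∧
        ∀ t, γ t ∈ F₁.leaf p ∩ F₂.leaf p :=
      ⟨γ'.extend, γ'.continuous_extend, γ'.extend_zero, γ'.extend_one, fun t => hγ' _⟩
    have main : ∀ t : ℝ, ∀ᶠ s in 𝓝 t, γ s ∈ F.leaf (γ t) := by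
      intro t
      obtain ⟨φ, hφ, hφt⟩ := F.cover (γ t)
      obtain ⟨φ₁, hφ₁, hφt₁⟩ := F₁.cover (γ t)
      obtain ⟨φ₂, hφ₂, hφt₂⟩ := F₂.cover (γ t)
      have e₁ := F₁.eventually_samePlaque_of_path hc₁ hγc (fun t => (hγ t).1) t hφ₁ hφt₁
      have e₂ := F₂.eventually_samePlaque_of_path hc₂ hγc (fun t => (hγ t).2) t hφ₂ hφt₂
      -- By `e₁` and `e₂` this map is constant along `γ` near `t`. Its derivative has kernel `E₁ ⊓
      -- E₂ = E`, so locally it depends only on the transverse coordinate of `φ`, and it does so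
      -- injectively. Hence that coordinate is constant along `γ` too.
      let h : M → Euc c₁ × Euc c₂ := fun q => ((φ₁ q).2, (φ₂ q).2)
      have hsrc : ∀ᶠ q in 𝓝 (γ t), q ∈ φ.source ∧ q ∈ φ₁.source ∧ q ∈ φ₂.source :=
        (φ.open_source.eventually_mem hφt).and ((φ₁.open_source.eventually_mem hφt₁).and
          (φ₂.open_source.eventually_mem hφt₂))
      have hmd : ∀ q, q ∈ φ.source ∧ q ∈ φ₁.source ∧ q ∈ φ₂.source →
          HasMFDerivAt (𝓡 n) 𝓘(ℝ, Euc c₁ × Euc c₂) h q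
            ((mfderiv (𝓡 n) 𝓘(ℝ, Euc c₁) (fun q => (φ₁ q).2) q).prod
              (mfderiv (𝓡 n) 𝓘(ℝ, Euc c₂) (fun q => (φ₂ q).2) q)) := fun q hq =>
        ⟨(mdifferentiableAt_snd hφ₁ hq.2.1).continuousAt.prodMk
          (mdifferentiableAt_snd hφ₂ hq.2.2).continuousAt,
          (mdifferentiableAt_snd hφ₁ hq.2.1).hasMFDerivAt.2.prodMk
          (mdifferentiableAt_snd hφ₂ hq.2.2).hasMFDerivAt.2⟩
      have hker : ∀ q (hq : q ∈ φ.source ∧ q ∈ φ₁.source ∧ q ∈ φ₂.source) (v : Euc n),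
          mfderiv (𝓡 n) 𝓘(ℝ, Euc c₁ × Euc c₂) h q v = 0 ↔
            mfderiv (𝓡 n) 𝓘(ℝ, Euc c) (fun q => (φ q).2) q v = 0 := by
        intro q hq v
        have h1 : v ∈ E q ↔ v ∈ E₁ q ∧ v ∈ E₂ q := by rw [hE]; rfl
        rw [← hF φ hφ q hq.1, ← hF₁ φ₁ hφ₁ q hq.2.1, ← hF₂ φ₂ hφ₂ q hq.2.2] at h1
        rw [(hmd q hq).mfderiv]
        exact Prod.ext_iff.trans h1.symm
      obtain ⟨V, hV, hV'⟩ := eventually_eq_of_ker_le (F.contMDiffOn φ hφ)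
        (F.contMDiffOn_symm φ hφ) hφt (h := h) (by
          filter_upwards [hsrc] with q hq
          exact ⟨(hmd q hq).mdifferentiableAt, fun v => (hker q hq v).2⟩)
      set x₀ := (φ (γ t)).1 with hx₀
      set y₀ := (φ (γ t)).2 with hy₀
      have hz₀ : (x₀, y₀) = φ (γ t) := rfl
      have hz₀t : (x₀, y₀) ∈ φ.target := φ.map_source hφt
      have hz₀s : φ.symm (x₀, y₀) = γ t := φ.left_inv hφt
      let κ : Euc c → Euc c₁ × Euc c₂ := fun y => h (φ.symm (x₀, y))
      have hκ : ContDiffAt ℝ 1 κ y₀ := by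
        have k1 : ContMDiffAt 𝓘(ℝ, Euc d × Euc c) (𝓡 n) 1 φ.symm (x₀, y₀) :=
          (F.contMDiffOn_symm φ hφ).contMDiffAt (φ.open_target.mem_nhds hz₀t)
        have k2 : ContMDiffAt (𝓡 n) 𝓘(ℝ, Euc c₁ × Euc c₂) 1 h (φ.symm (x₀, y₀)) := by
          rw [hz₀s]
          refine ContMDiffAt.prodMk_space ?_ ?_
          · exact ((ContinuousLinearMap.snd ℝ (Euc d₁) (Euc c₁)).contMDiff.contMDiffAt).comp _
              ((F₁.contMDiffOn φ₁ hφ₁).contMDiffAt (φ₁.open_source.mem_nhds hφt₁))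
          · exact ((ContinuousLinearMap.snd ℝ (Euc d₂) (Euc c₂)).contMDiff.contMDiffAt).comp _
              ((F₂.contMDiffOn φ₂ hφ₂).contMDiffAt (φ₂.open_source.mem_nhds hφt₂))
        have k3 : ContDiffAt ℝ 1 (fun y : Euc c => (x₀, y)) y₀ :=
          contDiffAt_const.prodMk contDiffAt_id
        exact (k2.comp _ k1).contDiffAt.comp y₀ k3
      have hinj : Function.Injective (fderiv ℝ κ y₀) := by
        rw [injective_iff_map_eq_zero]
        intro w hw
        have k1 : HasMFDerivAt 𝓘(ℝ, Euc d × Euc c) (𝓡 n) φ.symm (x₀, y₀) _ :=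
          (((F.contMDiffOn_symm φ hφ).mdifferentiableOn one_ne_zero _ hz₀t).mdifferentiableAt
            (φ.open_target.mem_nhds hz₀t)).hasMFDerivAt
        have hs : φ.symm (x₀, y₀) ∈ φ.source ∧ φ.symm (x₀, y₀) ∈ φ₁.source ∧
            φ.symm (x₀, y₀) ∈ φ₂.source := by rw [hz₀s]; exact ⟨hφt, hφt₁, hφt₂⟩
        have k2 := (((hmd _ hs).mdifferentiableAt.hasMFDerivAt).comp _ k1).hasFDerivAt
        have k3 : HasFDerivAt (fun y : Euc c => (x₀, y))
          (ContinuousLinearMap.inr ℝ (Euc d) (Euc c)) y₀ := hasFDerivAt_prodMk_right x₀ y₀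
        have k4 : HasFDerivAt κ _ y₀ := k2.comp y₀ k3
        rw [k4.fderiv] at hw
        have k5 := (hker _ hs _).1 hw
        let A : Euc d × Euc c →L[ℝ] Euc c :=
          (mfderiv (𝓡 n) 𝓘(ℝ, Euc c) (fun q => (φ q).2) (φ.symm (x₀, y₀))).comp
            (mfderiv 𝓘(ℝ, Euc d × Euc c) (𝓡 n) φ.symm (x₀, y₀))
        have k6 : HasFDerivAt (fun z => (φ (φ.symm z)).2) A (x₀, y₀) :=
          ((mdifferentiableAt_snd hφ hs.1).hasMFDerivAt.comp _ k1).hasFDerivAt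
        have k7 : HasFDerivAt (fun z : Euc d × Euc c => z.2)
            (ContinuousLinearMap.snd ℝ (Euc d) (Euc c)) (x₀, y₀) :=
          (ContinuousLinearMap.snd ℝ (Euc d) (Euc c)).hasFDerivAt
        have k8 := k6.unique (k7.congr_of_eventuallyEq (by
          filter_upwards [φ.open_target.mem_nhds hz₀t] with z' hz'
          rw [φ.right_inv hz']))
        have k9 := congrArg (fun A : Euc d × Euc c →L[ℝ] Euc c => A (0, w)) k8
        exact k9.symm.trans k5
      -- If `L` is a left inverse of the derivative of `κ`, then `L ∘ κ` has the identity as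
      -- derivative and is locally injective; so is `κ`.
      obtain ⟨N, hN, hNinj⟩ : ∃ N ∈ 𝓝 y₀, InjOn κ N := by
        have hstrict := hκ.hasStrictFDerivAt one_ne_zero
        obtain ⟨L, hL⟩ := LinearMap.exists_leftInverse_of_injective
          (fderiv ℝ κ y₀ : Euc c →ₗ[ℝ] Euc c₁ × Euc c₂) (LinearMap.ker_eq_bot.2 hinj)
        have h1 := (L.toContinuousLinearMap.hasStrictFDerivAt).comp y₀ hstrict
        have h2 : L.toContinuousLinearMap.comp (fderiv ℝ κ y₀) =
            (ContinuousLinearEquiv.refl ℝ (Euc c) : Euc c →L[ℝ] Euc c) := by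
          ext1 v
          exact LinearMap.congr_fun hL v
        rw [h2] at h1
        refine ⟨(h1.toOpenPartialHomeomorph _).source,
          (h1.toOpenPartialHomeomorph _).open_source.mem_nhds
            h1.mem_toOpenPartialHomeomorph_source, fun y hy y' hy' heq => ?_⟩
        exact (h1.toOpenPartialHomeomorph _).injOn hy hy' (congrArg L heq)
      have hcont : Tendsto γ (𝓝 t) (𝓝 (γ t)) := hγc.continuousAt
      have hy : ∀ᶠ q in 𝓝 (γ t), (φ q).2 ∈ N :=
        (continuousAt_snd.comp (φ.continuousAt hφt)).eventually hN
      have hpt : ∀ᶠ q in 𝓝 (γ t), (x₀, (φ q).2) ∈ φ.target ∧ φ.symm (x₀, (φ q).2) ∈ V := by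
        have c1 : ContinuousAt (fun q => (x₀, (φ q).2)) (γ t) :=
          continuousAt_const.prodMk (continuousAt_snd.comp (φ.continuousAt hφt))
        have c2 : ContinuousAt φ.symm (x₀, y₀) := φ.continuousAt_symm hz₀t
        refine (c1.eventually (φ.open_target.eventually_mem hz₀t)).and ?_
        refine (ContinuousAt.comp (f := fun q => (x₀, (φ q).2)) c2 c1).eventually ?_
        change V ∈ 𝓝 (φ.symm (x₀, y₀))
        rwa [hz₀s]
      filter_upwards [e₁, e₂, hcont.eventually hsrc, hcont.eventually hV, hcont.eventually hy,
        hcont.eventually hpt] with s h1 h2 h3 h4 h5 h6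
      refine SamePlaque.mem_leaf ⟨φ, hφ, hφt, h3.1, hNinj (mem_of_mem_nhds hN) h5 ?_⟩
      have h7 : h (γ s) = h (φ.symm (x₀, (φ (γ s)).2)) :=
        hV' _ h4 _ h6.2 (by rw [φ.right_inv h6.1])
      change h (φ.symm (x₀, y₀)) = h (φ.symm (x₀, (φ (γ s)).2))
      rw [hz₀s, ← h7]
      exact Prod.ext h1.2 h2.2
    have : ∀ t, γ t ∈ F.leaf (γ 0) := by
      intro t
      refine PreconnectedSpace.induction₂' (fun s t => γ t ∈ F.leaf (γ s)) (fun t => ?_)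
        ⟨fun a b c h h' => F.mem_leaf_trans h h'⟩ 0 t
      filter_upwards [main t] with s hs
      exact ⟨hs, F.mem_leaf_symm hs⟩
    rw [← hγ0, ← hγ1]
    exact this 1

end Tangency

end Foliation

/-- A complement of `ker D` is identified with `Euc c` by `D` itself, and `ker D` with `Euc d` by
dimension. This provides the linear coordinates that complete a submersion to a chart. -/
lemma exists_equiv_prod_of_surjective {V : Type*} [NormedAddCommGroup V] [NormedSpace ℝ V]
    [FiniteDimensional ℝ V] {d c : ℕ} (hV : Module.finrank ℝ V = d + c) (D : V →L[ℝ] Euc c)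
    (hD : Function.Surjective D) : ∃ e : V ≃L[ℝ] Euc d × Euc c, ∀ v, (e v).2 = D v := by
  obtain ⟨s, hs⟩ := LinearMap.exists_rightInverse_of_surjective (D : V →ₗ[ℝ] Euc c)
    (LinearMap.range_eq_top.2 hD)
  have hri : Function.RightInverse s.toContinuousLinearMap D := fun y => LinearMap.congr_fun hs y
  let e₁ := ContinuousLinearEquiv.equivOfRightInverse _ _ hri
  have he₁ : ∀ v, (e₁ v).1 = D v := fun v => rfl
  have hk : Module.finrank ℝ D.ker = Module.finrank ℝ (Euc d) := by
    have h1 := LinearMap.finrank_range_add_finrank_ker (D : V →ₗ[ℝ] Euc c)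
    rw [LinearMap.range_eq_top.2 hD, finrank_top, finrank_euclideanSpace_fin, hV] at h1
    rw [finrank_euclideanSpace_fin]
    omega
  let e₂ : D.ker ≃L[ℝ] Euc d := ContinuousLinearEquiv.ofFinrankEq hk
  refine ⟨(e₁.trans ((ContinuousLinearEquiv.refl ℝ (Euc c)).prodCongr e₂)).trans
    (ContinuousLinearEquiv.prodComm ℝ _ _), fun v => ?_⟩
  rw [← he₁]
  rfl

/-! ### From first integrals to foliated charts. -/

section

variable {n : ℕ} {M : Type*} [TopologicalSpace M] [ChartedSpace (Euc n) M]
  [IsManifold (𝓡 n) ∞ M]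

/-- `E` is near `p` the kernel of the derivative of a `C^1` map with values in `ℝ^c`. -/
def HasFirstIntegral (c : ℕ) (E : ∀ p : M, Submodule ℝ (TangentSpace (𝓡 n) p)) (p : M) : Prop :=
  ∃ U : Set M, IsOpen U ∧ p ∈ U ∧ ∃ u : M → Euc c, ContMDiffOn (𝓡 n) 𝓘(ℝ, Euc c) 1 u U ∧
    ∀ q ∈ U, (mfderiv (𝓡 n) 𝓘(ℝ, Euc c) u q).ker = E q

/-- By rank-nullity the first integral is a submersion at `p`. Completed by `d` linear coordinates
it is a local diffeomorphism, whose second component is the first integral itself. -/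
lemma HasFirstIntegral.exists_chart {d c : ℕ} (hn : d + c = n)
    {E : ∀ p : M, Submodule ℝ (TangentSpace (𝓡 n) p)} {p : M} (hE : HasFirstIntegral c E p)
    (hd : Module.finrank ℝ (E p) = d) :
    ∃ φ : OpenPartialHomeomorph M (Euc d × Euc c), p ∈ φ.source ∧
      ContMDiffOn (𝓡 n) 𝓘(ℝ, Euc d × Euc c) 1 φ φ.source ∧
      ContMDiffOn 𝓘(ℝ, Euc d × Euc c) (𝓡 n) 1 φ.symm φ.target ∧
      (∃ z r, φ.target = Metric.ball z r) ∧
      ∀ q ∈ φ.source, (mfderiv (𝓡 n) 𝓘(ℝ, Euc c) (fun q => (φ q).2) q).ker = E q := by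
  obtain ⟨U, hU, hpU, u, hu, hker⟩ := hE
  let e := chartAt (Euc n) p
  have he : ContMDiffOn (𝓡 n) (𝓡 n) 1 e e.source := (contMDiffOn_chart (n := ∞)).of_le (by exact_mod_cast le_top)
  have hes : ContMDiffOn (𝓡 n) (𝓡 n) 1 e.symm e.target := (contMDiffOn_chart_symm (n := ∞)).of_le
    (by exact_mod_cast le_top)
  let O : Set (Euc n) := e.target ∩ e.symm ⁻¹' U
  have hO : IsOpen O := e.isOpen_inter_preimage_symm hU
  have hps : p ∈ e.source := mem_chart_source _ p
  have hpO : e p ∈ O := ⟨e.map_source hps, by rwa [mem_preimage, e.left_inv hps]⟩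
  let w : Euc n → Euc c := fun y => u (e.symm y)
  have hw : ContDiffOn ℝ 1 w O :=
    (hu.comp (hes.mono inter_subset_left) fun y hy => hy.2).contDiffOn
  have hmd : (chartAt (Euc n) p).MDifferentiable (𝓡 n) (𝓡 n) := mdifferentiable_chart p
  have hD : Function.Surjective (fderiv ℝ w (e p)) := by
    have h1 : MDifferentiableAt (𝓡 n) 𝓘(ℝ, Euc c) u (e.symm (e p)) := by
      rw [e.left_inv hps]
      exact (hu.mdifferentiableOn one_ne_zero p hpU).mdifferentiableAt (hU.mem_nhds hpU)
    have h2 := hmd.symm.mdifferentiableAt (e.map_source hps)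
    let B : Euc n →L[ℝ] Euc c := (mfderiv (𝓡 n) 𝓘(ℝ, Euc c) u (e.symm (e p))).comp
        (mfderiv (𝓡 n) (𝓡 n) e.symm (e p))
    have h3 : HasFDerivAt w B (e p) :=
      (h1.hasMFDerivAt.comp _ h2.hasMFDerivAt).hasFDerivAt
    rw [h3.fderiv]
    refine Function.Surjective.comp (g := mfderiv (𝓡 n) 𝓘(ℝ, Euc c) u (e.symm (e p)))
      (f := mfderiv (𝓡 n) (𝓡 n) e.symm (e p)) ?_ (hmd.symm.mfderiv_surjective (e.map_source hps))
    rw [e.left_inv hps]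
    let B' : Euc n →L[ℝ] Euc c := mfderiv (𝓡 n) 𝓘(ℝ, Euc c) u p
    have h4 := LinearMap.finrank_range_add_finrank_ker (B' : Euc n →ₗ[ℝ] Euc c)
    have h5 : Module.finrank ℝ (LinearMap.ker (B' : Euc n →ₗ[ℝ] Euc c)) = d := by
      rw [← hd]
      exact congrArg (fun S : Submodule ℝ (Euc n) => Module.finrank ℝ S) (hker p hpU)
    rw [h5, finrank_euclideanSpace_fin] at h4
    refine LinearMap.range_eq_top.1 (Submodule.eq_top_of_finrank_eq
      (K := ℝ) (S := LinearMap.range (B' : Euc n →ₗ[ℝ] Euc c)) ?_)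
    rw [finrank_euclideanSpace_fin]
    omega
  obtain ⟨A, hA⟩ := exists_equiv_prod_of_surjective (d := d) (c := c)
    (by rw [finrank_euclideanSpace_fin, hn]) _ hD
  let G : Euc n → Euc d × Euc c := fun y => ((A y).1, w y)
  have hG : ContDiffOn ℝ 1 G O :=
    (contDiff_fst.comp A.contDiff).contDiffOn.prodMk hw
  have hGd : fderiv ℝ G (e p) = A := by
    have h1 : HasFDerivAt (fun y => (A y).1)
        ((ContinuousLinearMap.fst ℝ (Euc d) (Euc c)).comp (A : Euc n →L[ℝ] Euc d × Euc c)) (e p) :=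
      ((ContinuousLinearMap.fst ℝ (Euc d) (Euc c)).comp
        (A : Euc n →L[ℝ] Euc d × Euc c)).hasFDerivAt
    have h2 := (h1.prodMk ((hw.contDiffAt (hO.mem_nhds hpO)).differentiableAt
      one_ne_zero).hasFDerivAt).fderiv
    change fderiv ℝ G (e p) = _ at h2
    rw [h2]
    ext1 v
    exact Prod.ext rfl (hA v).symm
  obtain ⟨ψ, hψp, hψO, hψG, ⟨r, hr, hψt⟩, hψC, -⟩ := exists_chart_of_fderiv_equiv hO hG hpO A hGd
  have hψsrc : ContDiffOn ℝ 1 ψ ψ.source := by rw [hψG]; exact hG.mono hψO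
  have htgt : (e.trans ψ).target = ψ.target := by
    rw [OpenPartialHomeomorph.trans_target]
    refine inter_eq_left.2 fun z hz => ?_
    exact (hψO (ψ.map_target hz)).1
  have hsnd : ∀ q ∈ (e.trans ψ).source, ((e.trans ψ) q).2 = u q := by
    intro q hq
    rw [OpenPartialHomeomorph.trans_source] at hq
    change (ψ (e q)).2 = u q
    rw [hψG]
    change u (e.symm (e q)) = u q
    rw [e.left_inv hq.1]
  refine ⟨e.trans ψ, ?_, ?_, ?_, ⟨G (e p), r, htgt.trans hψt⟩, ?_⟩
  · rw [OpenPartialHomeomorph.trans_source]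
    exact ⟨hps, hψp⟩
  · rw [OpenPartialHomeomorph.trans_source]
    exact hψsrc.contMDiffOn.comp (he.mono inter_subset_left) fun q hq => hq.2
  · rw [htgt]
    exact hes.comp hψC.contMDiffOn fun z hz => (hψO (ψ.map_target hz)).1
  · intro q hq
    have hqU : q ∈ U := by
      rw [OpenPartialHomeomorph.trans_source] at hq
      have := (hψO hq.2).2
      rwa [mem_preimage, e.left_inv hq.1] at this
    have h1 : (fun q => ((e.trans ψ) q).2) =ᶠ[𝓝 q] u := by
      filter_upwards [(e.trans ψ).open_source.mem_nhds hq] with q' hq' using hsnd q' hq'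
    rw [h1.mfderiv_eq]
    exact hker q hqU

/-- A family of subspaces which locally is the kernel of the derivative of a `C^1` map is tangent
to a foliation. -/
theorem exists_foliation_of_hasFirstIntegral [CompactSpace M] {d c : ℕ} (hn : d + c = n)
    {E : ∀ p : M, Submodule ℝ (TangentSpace (𝓡 n) p)} (hE : ∀ p, HasFirstIntegral c E p)
    (hd : ∀ p, Module.finrank ℝ (E p) = d) :
    ∃ F : Foliation n M 1 d c, F.charts.Countable ∧ F.IsTangentTo E := by
  choose φ hp hφ hφs hball hker using fun p => (hE p).exists_chart hn (hd p)
  -- A finite atlas: countability of the charts is what makes the plaques of a leaf countable in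
  -- each chart.
  obtain ⟨t, ht⟩ := isCompact_univ.elim_nhds_subcover (fun p => (φ p).source)
    (fun p _ => (φ p).open_source.mem_nhds (hp p))
  refine ⟨⟨φ '' t, fun p => ?_, ?_, ?_, ?_, ?_⟩, (t.countable_toSet).image _, ?_⟩
  · obtain ⟨x, hx, hpx⟩ := mem_iUnion₂.1 (ht.2 (mem_univ p))
    exact ⟨φ x, mem_image_of_mem _ hx, hpx⟩
  · rintro _ ⟨x, -, rfl⟩
    exact hφ x
  · rintro _ ⟨x, -, rfl⟩
    exact hφs x
  · rintro _ ⟨x, -, rfl⟩ y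
    obtain ⟨z, r, hz⟩ := hball x
    rw [hz]
    refine Convex.isPreconnected fun a ha b hb s s' hs hs' hss => ?_
    have := convex_ball z r ha hb hs hs' hss
    have e : s • y + s' • y = y := by rw [← add_smul, hss, one_smul]
    simpa [e] using this
  · rintro _ ⟨x, -, rfl⟩ _ ⟨x', -, rfl⟩ p ⟨hpx, hpx'⟩
    -- The transverse coordinates of both charts have the same kernel `E`, so each is locally
    -- constant on the plaques of the other.
    refine Foliation.eventually_eq_of_ker_le (hφ x) (hφs x) hpx ?_
    filter_upwards [(φ x).open_source.mem_nhds hpx, (φ x').open_source.mem_nhds hpx'] with q hq hq'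
    refine ⟨((ContinuousLinearMap.snd ℝ (Euc d) (Euc c)).mdifferentiable).mdifferentiableAt.comp _
      (((hφ x').mdifferentiableOn one_ne_zero _ hq').mdifferentiableAt
        ((φ x').open_source.mem_nhds hq')), fun v hv => ?_⟩
    have h1 : v ∈ (mfderiv (𝓡 n) 𝓘(ℝ, Euc c) (fun q => (φ x q).2) q).ker := hv
    rw [hker x q hq, ← hker x' q hq'] at h1
    exact h1
  · rintro _ ⟨x, -, rfl⟩ p hp
    exact hker x p hp

end

/-! ### Linear algebra of dominated cocycles along one orbit. -/

section LinearAlgebra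

variable {V : Type*} [AddCommGroup V] [Module ℝ V] {S C U : Submodule ℝ V}

lemma exists_smul_eq_of_finrank_eq_one (hS : Module.finrank ℝ S = 1) {s : V} (hs : s ∈ S)
    (hs0 : s ≠ 0) {v : V} (hv : v ∈ S) : ∃ t : ℝ, v = t • s := by
  have h0 : (⟨s, hs⟩ : S) ≠ 0 := fun h => hs0 (congrArg Subtype.val h)
  obtain ⟨t, ht⟩ := (finrank_eq_one_iff_of_nonzero' _ h0).1 hS ⟨v, hv⟩
  exact ⟨t, (congrArg Subtype.val ht).symm⟩

lemma eq_zero_of_forall_le_mul_pow {x A lam : ℝ} (h0 : 0 ≤ x) (hl : 0 < lam) (hl1 : lam < 1)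
    (h : ∀ m : ℕ, 1 ≤ m → x ≤ A * lam ^ m) : x = 0 := by
  have h1 : Tendsto (fun m : ℕ => A * lam ^ m) atTop (𝓝 (A * 0)) :=
    (tendsto_pow_atTop_nhds_zero_of_lt_one hl.le hl1).const_mul A
  rw [mul_zero] at h1
  exact le_antisymm (ge_of_tendsto h1 (eventually_atTop.2 ⟨1, h⟩)) h0

/-- If a linear cocycle (seen through the pulled back norms `ν m`) preserves a symplectic form and
dominates the line `S` by the plane `C` and `C` by `U`, then `S` is orthogonal to `C`. -/
lemma orthogonal_of_domination {σ : V →ₗ[ℝ] V →ₗ[ℝ] ℝ} (halt : σ.IsAlt)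
    (hS : Module.finrank ℝ S = 1) (hC : Module.finrank ℝ C = 2) {ν : ℕ → V → ℝ}
    (hν : ∀ m v, 0 ≤ ν m v) (hν0 : ∀ m v, v ≠ 0 → 0 < ν m v)
    {lam A K δ : ℝ} (hl : 0 < lam) (hl1 : lam < 1) (hA : 0 ≤ A) (hK : 0 ≤ K) (hδ : 0 < δ)
    (hsc : ∀ m, 1 ≤ m → ∀ v ∈ S, ∀ w ∈ C, ν m v * ν 0 w ≤ A * lam ^ m * (ν 0 v * ν m w))
    (hcu : ∀ m, 1 ≤ m → ∀ v ∈ C, ∀ w ∈ U, ν m v * ν 0 w ≤ A * lam ^ m * (ν 0 v * ν m w))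
    (hσ : ∀ m v w, |σ v w| ≤ K * (ν m v * ν m w))
    (hnd : ∀ m x ε, 0 ≤ ε → (∀ y ∈ S, |σ x y| ≤ ε * ν m y) → (∀ y ∈ C, |σ x y| ≤ ε * ν m y) →
      (∀ y ∈ U, |σ x y| ≤ ε * ν m y) → δ * ν m x ≤ ε) :
    ∀ s ∈ S, ∀ w ∈ C, σ s w = 0 := by
  intro s hs w₂ hw₂
  by_contra hne
  have hs0 : s ≠ 0 := by rintro rfl; simp at hne
  have hw₂0 : w₂ ≠ 0 := by rintro rfl; simp at hne
  have hd : 0 < |σ s w₂| := abs_pos.2 hne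
  have : FiniteDimensional ℝ C := FiniteDimensional.of_finrank_pos (by omega)
  -- If `σ s` is not zero on the plane `C`, its kernel there is a line. The images of a generator
  -- `w₁` turn out to be asymptotically orthogonal to `S`, `C` and `U`, against uniform
  -- nondegeneracy.
  obtain ⟨w₁, hw₁, hw₁0, hsw₁, hspan⟩ : ∃ w₁ ∈ C, w₁ ≠ 0 ∧ σ s w₁ = 0 ∧
      ∀ z ∈ C, σ s z = 0 → ∃ t : ℝ, z = t • w₁ := by
    let φ : C →ₗ[ℝ] ℝ := (σ s).comp C.subtype
    have h1 := LinearMap.finrank_range_add_finrank_ker φ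
    have h2 : LinearMap.range φ = ⊤ := LinearMap.range_eq_top.2
      (LinearMap.surjective fun h => hne (LinearMap.congr_fun h ⟨w₂, hw₂⟩))
    rw [h2, finrank_top, Module.finrank_self, hC] at h1
    have h3 : Module.finrank ℝ (LinearMap.ker φ) = 1 := by omega
    obtain ⟨⟨⟨w₁, hw₁⟩, hk⟩, h4, h5⟩ := finrank_eq_one_iff'.1 h3
    refine ⟨w₁, hw₁, fun h => h4 ?_, hk, fun z hz hsz => ?_⟩
    · exact Subtype.ext (Subtype.ext h)
    · obtain ⟨t, ht⟩ := h5 ⟨⟨z, hz⟩, hsz⟩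
      exact ⟨t, (congrArg (fun x : LinearMap.ker φ => ((x : C) : V)) ht).symm⟩
  have p0s := hν0 0 s hs0
  have p0w₁ := hν0 0 w₁ hw₁0
  set B₁ := K * |σ w₁ w₂| / |σ s w₂| * (A * ν 0 s / ν 0 w₁) with hB₁
  set B₂ := K / |σ s w₂| * K * (A * ν 0 s) * (A * ν 0 w₂) with hB₂
  have hB₁0 : 0 ≤ B₁ := by positivity
  have hB₂0 : 0 ≤ B₂ := by have := hν 0 w₂; positivity
  have main : ∀ m : ℕ, 1 ≤ m → δ ≤ (B₁ + B₂) * lam ^ m := by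
    intro m hm
    have hlm : 0 < lam ^ m := pow_pos hl m
    have hlm1 : lam ^ m ≤ 1 := pow_le_one₀ hl.le hl1.le
    have pw₁ := hν0 m w₁ hw₁0
    have psw₁ := hsc m hm s hs w₁ hw₁
    refine le_of_mul_le_mul_right ?_ pw₁
    refine hnd m w₁ ((B₁ + B₂) * lam ^ m * ν m w₁) (by positivity) (fun y hy => ?_) (fun z hz => ?_)
      (fun u hu => ?_)
    · obtain ⟨t, rfl⟩ := exists_smul_eq_of_finrank_eq_one hS hs hs0 hy
      have : σ w₁ s = 0 := by rw [← halt.neg, hsw₁, neg_zero]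
      rw [map_smul, this, smul_zero, abs_zero]
      exact mul_nonneg (by positivity) (hν _ _)
    -- Modulo `w₁`, every `z` in `C` is a multiple of `w₂` with coefficient proportional to `σ s z`,
    -- which is at most `K * (ν m s * ν m z)`; and `ν m s` is dominated by `ν m w₁`.
    · obtain ⟨t, ht⟩ := hspan (z - (σ s z / σ s w₂) • w₂) (C.sub_mem hz (C.smul_mem _ hw₂))
        (by rw [map_sub, map_smul, smul_eq_mul, div_mul_cancel₀ _ hne, sub_self])
      have h1 : σ w₁ z = σ s z / σ s w₂ * σ w₁ w₂ := by
        have := congrArg (σ w₁) ht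
        rw [map_sub, map_smul, map_smul, halt, smul_zero, smul_eq_mul] at this
        linarith
      have h2 : ν m s ≤ A * lam ^ m * (ν 0 s * ν m w₁) / ν 0 w₁ := (le_div_iff₀ p0w₁).2 psw₁
      have hz0 := hν m z
      rw [h1, abs_mul, abs_div]
      calc |σ s z| / |σ s w₂| * |σ w₁ w₂|
          ≤ (K * ((A * lam ^ m * (ν 0 s * ν m w₁) / ν 0 w₁) * ν m z)) / |σ s w₂| * |σ w₁ w₂| := by
            gcongr
            exact (hσ m s z).trans (by gcongr)
        _ = B₁ * lam ^ m * ν m w₁ * ν m z := by rw [hB₁]; ring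
        _ ≤ _ := by gcongr; linarith
    · have hu0 := hν m u
      have h0u := hν 0 u
      have h1 := hcu m hm w₂ hw₂ u hu
      have h2 := hσ m s w₂
      have h3 := hσ 0 w₁ u
      -- The nonzero number `σ s w₂` does not depend on `m`, so the product `ν m s * ν m w₂` is
      -- bounded below. The two dominations, of `s` by `w₁` and of `w₂` by `u`, then bound `ν 0 w₁ *
      -- ν 0 u`, and with it `σ w₁ u`, by `lam ^ (2 * m)` times `ν m w₁ * ν m u`.
      have h4 : |σ s w₂| * (ν 0 w₁ * ν 0 u) ≤
          K * ((A * lam ^ m * (ν 0 s * ν m w₁)) * (A * lam ^ m * (ν 0 w₂ * ν m u))) := by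
        have q1 := hν m s
        have q2 := hν m w₂
        calc |σ s w₂| * (ν 0 w₁ * ν 0 u) ≤ K * (ν m s * ν m w₂) * (ν 0 w₁ * ν 0 u) := by gcongr
          _ = K * ((ν m s * ν 0 w₁) * (ν m w₂ * ν 0 u)) := by ring
          _ ≤ _ := by gcongr
      have h5 : ν 0 w₁ * ν 0 u ≤
          K * ((A * lam ^ m * (ν 0 s * ν m w₁)) * (A * lam ^ m * (ν 0 w₂ * ν m u))) / |σ s w₂| :=
        (le_div_iff₀' hd).2 h4
      have q3 := hν 0 w₂
      calc |σ w₁ u| ≤ K * (K * ((A * lam ^ m * (ν 0 s * ν m w₁)) *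
            (A * lam ^ m * (ν 0 w₂ * ν m u))) / |σ s w₂|) := h3.trans (by gcongr)
        _ = B₂ * lam ^ m * ν m w₁ * ν m u * lam ^ m := by rw [hB₂]; ring
        _ ≤ B₂ * lam ^ m * ν m w₁ * ν m u := mul_le_of_le_one_right (by positivity) hlm1
        _ ≤ _ := by gcongr; linarith
  exact hδ.ne' (eq_zero_of_forall_le_mul_pow hδ.le hl hl1 main)

/-- A bilinear form on `S ⊕ C` that is carried along by a partially hyperbolic cocycle as a form
with values in `U` vanishes. -/
lemma curvature_eq_zero_of_domination {Λ : V →ₗ[ℝ] V →ₗ[ℝ] ℝ} (halt : Λ.IsAlt)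
    (hS : Module.finrank ℝ S = 1) {ν : ℕ → V → ℝ} (hν : ∀ m v, 0 ≤ ν m v) {u : V}
    (hu : ∀ m, 0 < ν m u) {lam A K : ℝ} (hl : 0 < lam) (hl1 : lam < 1) (hA : 0 ≤ A) (hK : 0 ≤ K)
    (hs : ∀ m, 1 ≤ m → ∀ v ∈ S, ν m v ≤ A * lam ^ m * ν 0 v)
    (hexp : ∀ m, 1 ≤ m → ν 0 u ≤ A * lam ^ m * ν m u)
    (hcu : ∀ m, 1 ≤ m → ∀ v ∈ C, ν m v * ν 0 u ≤ A * lam ^ m * (ν 0 v * ν m u))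
    (hΛ : ∀ m, ∀ v ∈ S, ∀ w ∈ C, |Λ v w| * ν m u ≤ K * (ν m v * ν m w))
    (hΛ' : ∀ v ∈ C, ∀ w ∈ C, ∃ B, ∀ m, |Λ v w| * ν m u ≤ B) :
    ∀ v ∈ S ⊔ C, ∀ w ∈ S ⊔ C, Λ v w = 0 := by
  have hSS : ∀ v ∈ S, ∀ w ∈ S, Λ v w = 0 := by
    intro v hv w hw
    by_cases h0 : v = 0
    · simp [h0]
    · obtain ⟨t, rfl⟩ := exists_smul_eq_of_finrank_eq_one hS hv h0 hw
      rw [map_smul, halt, smul_zero]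
  have hSC : ∀ v ∈ S, ∀ w ∈ C, Λ v w = 0 := by
    intro v hv w hw
    rw [← abs_eq_zero]
    refine eq_zero_of_forall_le_mul_pow (A := K * (A * ν 0 v) * (A * ν 0 w) / ν 0 u)
      (abs_nonneg _) hl hl1 fun m hm => ?_
    have hlm : 0 < lam ^ m := pow_pos hl m
    have hlm1 : lam ^ m ≤ 1 := pow_le_one₀ hl.le hl1.le
    have q1 := hν m w
    have q2 := hν 0 v
    have q3 := hν 0 w
    have h0u := hu 0
    have hmu := hu m
    -- Domination of `w` by `u` cancels the factor `ν m u` in `hΛ`, and the contraction of `v` is a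
    -- further gain.
    have h1 : ν m w ≤ A * lam ^ m * (ν 0 w * ν m u) / ν 0 u := (le_div_iff₀ h0u).2 (hcu m hm w hw)
    refine le_of_mul_le_mul_right ?_ hmu
    calc |Λ v w| * ν m u ≤ K * (ν m v * ν m w) := hΛ m v hv w hw
      _ ≤ K * ((A * lam ^ m * ν 0 v) * (A * lam ^ m * (ν 0 w * ν m u) / ν 0 u)) := by
        gcongr
        exact hs m hm v hv
      _ = K * (A * ν 0 v) * (A * ν 0 w) / ν 0 u * lam ^ m * ν m u * lam ^ m := by ring
      _ ≤ _ := mul_le_of_le_one_right (by positivity) hlm1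
  have hCC : ∀ v ∈ C, ∀ w ∈ C, Λ v w = 0 := by
    intro v hv w hw
    -- On `C × C` the bound is independent of `m`, while `ν m u` grows exponentially.
    obtain ⟨B, hB⟩ := hΛ' v hv w hw
    rw [← abs_eq_zero]
    refine eq_zero_of_forall_le_mul_pow (A := B * A / ν 0 u) (abs_nonneg _) hl hl1 fun m hm => ?_
    have hlm : 0 < lam ^ m := pow_pos hl m
    have h0u := hu 0
    have hB' := hB m
    refine le_of_mul_le_mul_right ?_ h0u
    calc |Λ v w| * ν 0 u ≤ |Λ v w| * (A * lam ^ m * ν m u) := by gcongr; exact hexp m hm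
      _ = (|Λ v w| * ν m u) * (A * lam ^ m) := by ring
      _ ≤ B * (A * lam ^ m) := by gcongr
      _ = _ := by field_simp
  intro v hv w hw
  obtain ⟨s, hs, c, hc, rfl⟩ := Submodule.mem_sup.1 hv
  obtain ⟨s', hs', c', hc', rfl⟩ := Submodule.mem_sup.1 hw
  have h1 : Λ c s' = 0 := by rw [← halt.neg, hSC s' hs' c hc, neg_zero]
  simp [map_add, LinearMap.add_apply, hSS s hs s' hs', hSC s hs c' hc', hCC c hc c' hc', h1]

end LinearAlgebra

/-! ### Partial hyperbolicity in homogeneous form. -/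

section Domination

variable {n : ℕ} {M : Type*} [TopologicalSpace M] [ChartedSpace (Euc n) M]
  [IsManifold (𝓡 n) ∞ M]
  (g : Bundle.ContMDiffRiemannianMetric (𝓡 n) ∞ (Euc n) (TangentSpace (𝓡 n) : M → Type))

lemma gnorm_nonneg {p : M} (v : TangentSpace (𝓡 n) p) : 0 ≤ gnorm g v := Real.sqrt_nonneg _

lemma gnorm_pos {p : M} {v : TangentSpace (𝓡 n) p} (hv : v ≠ 0) : 0 < gnorm g v :=
  Real.sqrt_pos.2 (g.pos p v hv)

lemma gnorm_smul {p : M} (t : ℝ) (v : TangentSpace (𝓡 n) p) :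
    gnorm g (t • v) = |t| * gnorm g v := by
  unfold gnorm
  have : g.inner p (t • v) (t • v) = t ^ 2 * g.inner p v v := by
    simp only [map_smul, smul_apply, smul_eq_mul]
    ring
  rw [this, Real.sqrt_mul (sq_nonneg t), Real.sqrt_sq_eq_abs]

lemma gnorm_zero {p : M} : gnorm g (0 : TangentSpace (𝓡 n) p) = 0 := by
  simp [gnorm]

lemma gnorm_congr {p p' : M} (h : p = p') (v v' : Euc n) (hv : v = v') :
    gnorm g (p := p) v = gnorm g (p := p') v' := by
  subst h; subst hv; rfl

lemma exists_unit_smul {p : M} {v : TangentSpace (𝓡 n) p} (hv : v ≠ 0) :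
    ∃ w : TangentSpace (𝓡 n) p, gnorm g w = 1 ∧ v = gnorm g v • w := by
  have h := gnorm_pos g hv
  refine ⟨(gnorm g v)⁻¹ • v, ?_, ?_⟩
  · rw [gnorm_smul, abs_of_pos (inv_pos.2 h), inv_mul_cancel₀ h.ne']
  · rw [smul_smul, mul_inv_cancel₀ h.ne', one_smul]

variable {k : ℕ∞ω}

/-- Homogeneous form of partial hyperbolicity. -/
structure IsDominated (f : M → M) (Es Ec Eu : ∀ p : M, Submodule ℝ (TangentSpace (𝓡 n) p))
    (lam A : ℝ) : Prop where
  contract : ∀ m, 1 ≤ m → ∀ p, ∀ v ∈ Es p,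
    gnorm g (mfderiv (𝓡 n) (𝓡 n) f^[m] p v) ≤ A * lam ^ m * gnorm g v
  expand : ∀ m, 1 ≤ m → ∀ p, ∀ v ∈ Eu p,
    gnorm g v ≤ A * lam ^ m * gnorm g (mfderiv (𝓡 n) (𝓡 n) f^[m] p v)
  dominate_sc : ∀ m, 1 ≤ m → ∀ p, ∀ v ∈ Es p, ∀ w ∈ Ec p,
    gnorm g (mfderiv (𝓡 n) (𝓡 n) f^[m] p v) * gnorm g w ≤
      A * lam ^ m * (gnorm g v * gnorm g (mfderiv (𝓡 n) (𝓡 n) f^[m] p w))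
  dominate_cu : ∀ m, 1 ≤ m → ∀ p, ∀ v ∈ Ec p, ∀ w ∈ Eu p,
    gnorm g (mfderiv (𝓡 n) (𝓡 n) f^[m] p v) * gnorm g w ≤
      A * lam ^ m * (gnorm g v * gnorm g (mfderiv (𝓡 n) (𝓡 n) f^[m] p w))

variable {g} {f : Diffeomorph (𝓡 n) (𝓡 n) M M k}
  {Es Ec Eu : ∀ p : M, Submodule ℝ (TangentSpace (𝓡 n) p)}

/-- Vectors are normalized and denominators cleared; these are positive because `Df^m` is
invertible. Contraction of `Eu` by the inverse becomes expansion by `f`. -/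
lemma IsPartiallyHyperbolic.exists_isDominated (hk : k ≠ 0)
    (h : IsPartiallyHyperbolic g f Es Ec Eu) :
    ∃ lam A, 0 < lam ∧ lam < 1 ∧ 0 < A ∧ IsDominated g f Es Ec Eu lam A := by
  obtain ⟨lam, A, hl, hl1, hA, hyp⟩ := h.hyperbolic
  have dom : ∀ m, 1 ≤ m → ∀ p (v w : TangentSpace (𝓡 n) p),
      (∀ t : ℝ, ∀ t' : ℝ, gnorm g (t • v) = 1 → gnorm g (t' • w) = 1 →
        gnorm g (mfderiv (𝓡 n) (𝓡 n) f^[m] p (t • v)) /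
          gnorm g (mfderiv (𝓡 n) (𝓡 n) f^[m] p (t' • w)) ≤ A * lam ^ m) →
      gnorm g (mfderiv (𝓡 n) (𝓡 n) f^[m] p v) * gnorm g w ≤
        A * lam ^ m * (gnorm g v * gnorm g (mfderiv (𝓡 n) (𝓡 n) f^[m] p w)) := by
    intro m hm p v w hvw
    by_cases hv : v = 0
    · rw [hv, map_zero, gnorm_zero, gnorm_zero]; simp
    by_cases hw : w = 0
    · rw [hw, map_zero, gnorm_zero, gnorm_zero]; simp
    have pv := gnorm_pos g hv
    have pw := gnorm_pos g hw
    have pw' : 0 < gnorm g (mfderiv (𝓡 n) (𝓡 n) f^[m] p w) := by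
      rw [← coe_diffeoIterate]
      exact gnorm_pos g (mfderiv_ne_zero _ hk p hw)
    have key := hvw (gnorm g v)⁻¹ (gnorm g w)⁻¹
      (by rw [gnorm_smul, abs_of_pos (inv_pos.2 pv), inv_mul_cancel₀ pv.ne'])
      (by rw [gnorm_smul, abs_of_pos (inv_pos.2 pw), inv_mul_cancel₀ pw.ne'])
    rw [map_smul, map_smul, gnorm_smul, gnorm_smul, abs_of_pos (inv_pos.2 pv),
      abs_of_pos (inv_pos.2 pw), div_le_iff₀ (by positivity)] at key
    have h1 := mul_le_mul_of_nonneg_left key (mul_pos pv pw).le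
    field_simp at h1
    linarith
  have hcon : ∀ m, 1 ≤ m → ∀ p, ∀ v ∈ Es p,
      gnorm g (mfderiv (𝓡 n) (𝓡 n) f^[m] p v) ≤ A * lam ^ m * gnorm g v := by
    intro m hm p v hv
    by_cases hv0 : v = 0
    · rw [hv0, map_zero, gnorm_zero, gnorm_zero]; simp
    obtain ⟨w, hw, hvw⟩ := exists_unit_smul g hv0
    have pv := gnorm_pos g hv0
    have hwE : w ∈ Es p := by
      rw [hvw] at hv
      exact (Submodule.smul_mem_iff _ pv.ne').1 hv
    conv_lhs => rw [hvw]
    rw [map_smul, gnorm_smul, abs_of_pos pv, mul_comm]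
    exact mul_le_mul_of_nonneg_right ((hyp m hm p).1 w hwE hw) pv.le
  have hcon' : ∀ m, 1 ≤ m → ∀ p, ∀ v ∈ Eu p,
      gnorm g (mfderiv (𝓡 n) (𝓡 n) f.symm^[m] p v) ≤ A * lam ^ m * gnorm g v := by
    intro m hm p v hv
    by_cases hv0 : v = 0
    · rw [hv0, map_zero, gnorm_zero, gnorm_zero]; simp
    obtain ⟨w, hw, hvw⟩ := exists_unit_smul g hv0
    have pv := gnorm_pos g hv0
    have hwE : w ∈ Eu p := by
      rw [hvw] at hv
      exact (Submodule.smul_mem_iff _ pv.ne').1 hv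
    conv_lhs => rw [hvw]
    rw [map_smul, gnorm_smul, abs_of_pos pv, mul_comm]
    exact mul_le_mul_of_nonneg_right ((hyp m hm p).2.1 w hwE hw) pv.le
  refine ⟨lam, A, hl, hl1, hA, hcon, fun m hm p v hv => ?_, fun m hm p v hv w hw => ?_,
    fun m hm p v hv w hw => ?_⟩
  · have h1 := h.invariant_u.iterate hk m p
    rw [coe_diffeoIterate] at h1
    have h2 : mfderiv (𝓡 n) (𝓡 n) f^[m] p v ∈ Eu (f^[m] p) := by
      rw [← h1]; exact Submodule.mem_map_of_mem hv
    refine Eq.trans_le ?_ (hcon' m hm _ _ h2)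
    rw [← coe_diffeoIterate f, ← coe_diffeoIterate_symm f]
    exact (gnorm_congr g ((diffeoIterate f m).symm_apply_apply p) _ _
      (mfderiv_symm_apply_mfderiv (diffeoIterate f m) hk p v)).symm
  · exact dom m hm p v w fun t t' ht ht' => (hyp m hm p).2.2.1 _ (Submodule.smul_mem _ _ hv) _
      (Submodule.smul_mem _ _ hw) ht ht'
  · exact dom m hm p v w fun t t' ht ht' => (hyp m hm p).2.2.2 _ (Submodule.smul_mem _ _ hv) _
      (Submodule.smul_mem _ _ hw) ht ht'

/-- Each inequality is a forward one at `f.symm^[m] p`, applied to the pulled back vectors; this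
exchanges the roles of `Es` and `Eu`. -/
lemma IsDominated.symm (hk : k ≠ 0) {lam A : ℝ} (h : IsDominated g f Es Ec Eu lam A)
    (hs : IsDInvariant f Es) (hc : IsDInvariant f Ec) (hu : IsDInvariant f Eu) :
    IsDominated g f.symm Eu Ec Es lam A := by
  have inv : ∀ {E : ∀ p : M, Submodule ℝ (TangentSpace (𝓡 n) p)}, IsDInvariant f E →
      ∀ m p, ∀ v ∈ E p, mfderiv (𝓡 n) (𝓡 n) f.symm^[m] p v ∈ E (f.symm^[m] p) := by
    intro E hE m p v hv
    have h1 := (hE.symm hk).iterate hk m p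
    rw [coe_diffeoIterate] at h1
    rw [← h1]
    exact Submodule.mem_map_of_mem hv
  refine ⟨fun m hm p v hv => ?_, fun m hm p v hv => ?_, fun m hm p v hv w hw => ?_,
    fun m hm p v hv w hw => ?_⟩
  all_goals obtain ⟨q, hq, hfq, hD⟩ := iterate_symm_data f hk m p
  all_goals subst hq
  · have := h.expand m hm _ _ (inv hu m p v hv)
    rwa [gnorm_congr g hfq _ _ (hD v)] at this
  · have := h.contract m hm _ _ (inv hs m p v hv)
    rwa [gnorm_congr g hfq _ _ (hD v)] at this
  · have := h.dominate_cu m hm _ _ (inv hc m p w hw) _ (inv hu m p v hv)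
    rw [gnorm_congr g hfq _ _ (hD v), gnorm_congr g hfq _ _ (hD w)] at this
    linarith
  · have := h.dominate_sc m hm _ _ (inv hs m p w hw) _ (inv hc m p v hv)
    rw [gnorm_congr g hfq _ _ (hD v), gnorm_congr g hfq _ _ (hD w)] at this
    linarith

end Domination

/-! ### Local bounds for homogeneous functions, and compactness. -/

section Homogeneous

variable {M E : Type*} [TopologicalSpace M] [NormedAddCommGroup E] [NormedSpace ℝ E]
  [FiniteDimensional ℝ E] {F : M × E → ℝ} {x₀ : M}

/-- Homogeneity reduces the claim to the unit sphere, whose compactness makes the neighborhood of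
`x₀` independent of `v`. -/
lemma eventually_le_mul_norm (hF : ∀ v, ContinuousAt F (x₀, v))
    (hhom : ∀ q (t : ℝ) v, F (q, t • v) = |t| * F (q, v)) :
    ∃ B > 0, ∀ᶠ q in 𝓝 x₀, ∀ v, F (q, v) ≤ B * ‖v‖ := by
  have hc : ContinuousOn (fun v => F (x₀, v)) (Metric.sphere (0 : E) 1) := fun v _ =>
    (ContinuousAt.comp (f := fun v : E => (x₀, v)) (hF v) (by fun_prop)).continuousWithinAt
  obtain ⟨B, hB⟩ := (isCompact_sphere (0 : E) 1).exists_bound_of_continuousOn hc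
  refine ⟨|B| + 1, by positivity, ?_⟩
  have h1 : ∀ᶠ q in 𝓝 x₀, ∀ v ∈ Metric.sphere (0 : E) 1, F (q, v) < |B| + 1 := by
    refine (isCompact_sphere (0 : E) 1).eventually_forall_of_forall_eventually fun v hv => ?_
    refine (hF v).eventually (gt_mem_nhds ?_)
    have := (le_abs_self _).trans ((hB v hv).trans (le_abs_self B))
    linarith
  filter_upwards [h1] with q hq v
  by_cases hv : v = 0
  · have := hhom q 0 v
    rw [zero_smul, abs_zero, zero_mul] at this
    rw [hv, this, norm_zero, mul_zero]
  · have hn : 0 < ‖v‖ := norm_pos_iff.2 hv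
    have h2 := hq (‖v‖⁻¹ • v) (by
      rw [mem_sphere_zero_iff_norm, norm_smul, norm_inv, norm_norm, inv_mul_cancel₀ hn.ne'])
    rw [hhom, abs_of_pos (inv_pos.2 hn), inv_mul_lt_iff₀ hn] at h2
    linarith

lemma eventually_mul_norm_le (hF : ∀ v, ContinuousAt F (x₀, v))
    (hhom : ∀ q (t : ℝ) v, F (q, t • v) = |t| * F (q, v)) (hpos : ∀ v ≠ 0, 0 < F (x₀, v)) :
    ∃ c > 0, ∀ᶠ q in 𝓝 x₀, ∀ v, c * ‖v‖ ≤ F (q, v) := by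
  have hc : ContinuousOn (fun v => F (x₀, v)) (Metric.sphere (0 : E) 1) := fun v _ =>
    (ContinuousAt.comp (f := fun v : E => (x₀, v)) (hF v) (by fun_prop)).continuousWithinAt
  obtain ⟨c, hc0, hc⟩ := (isCompact_sphere (0 : E) 1).exists_forall_le' hc (a := 0) fun v hv =>
    hpos v (by rintro rfl; simp at hv)
  refine ⟨c / 2, by positivity, ?_⟩
  have h1 : ∀ᶠ q in 𝓝 x₀, ∀ v ∈ Metric.sphere (0 : E) 1, c / 2 < F (q, v) := by
    refine (isCompact_sphere (0 : E) 1).eventually_forall_of_forall_eventually fun v hv => ?_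
    refine (hF v).eventually (lt_mem_nhds ?_)
    have := hc v hv
    linarith
  filter_upwards [h1] with q hq v
  by_cases hv : v = 0
  · have := hhom q 0 v
    rw [zero_smul, abs_zero, zero_mul] at this
    rw [hv, this, norm_zero, mul_zero]
  · have hn : 0 < ‖v‖ := norm_pos_iff.2 hv
    have h2 := hq (‖v‖⁻¹ • v) (by
      rw [mem_sphere_zero_iff_norm, norm_smul, norm_inv, norm_norm, inv_mul_cancel₀ hn.ne'])
    rw [hhom, abs_of_pos (inv_pos.2 hn), lt_inv_mul_iff₀ hn] at h2
    linarith

/-- On a compact space, a local bound is a global bound. -/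
lemma exists_uniform_constant {X : Type*} [TopologicalSpace X] [CompactSpace X] {P : X → ℝ → Prop}
    (hmono : ∀ p K K', K ≤ K' → P p K → P p K') (hloc : ∀ x, ∃ K, ∀ᶠ p in 𝓝 x, P p K) :
    ∃ K > 0, ∀ p, P p K := by
  obtain ⟨K, hK⟩ : ∃ K, ∀ p ∈ (univ : Set X), P p K := by
    refine isCompact_univ.induction_on (p := fun s => ∃ K, ∀ p ∈ s, P p K) ⟨0, by simp⟩ ?_ ?_ ?_
    · rintro s t hst ⟨K, hK⟩
      exact ⟨K, fun p hp => hK p (hst hp)⟩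
    · rintro s t ⟨K, hK⟩ ⟨K', hK'⟩
      refine ⟨max K K', ?_⟩
      rintro p (hp | hp)
      · exact hmono p K _ (le_max_left _ _) (hK p hp)
      · exact hmono p K' _ (le_max_right _ _) (hK' p hp)
    · intro x _
      obtain ⟨K, hK⟩ := hloc x
      exact ⟨_, mem_nhdsWithin_of_mem_nhds hK, K, fun p hp => hp⟩
  exact ⟨max K 1, by positivity, fun p => hmono p K _ (le_max_left _ _) (hK p (mem_univ p))⟩

end Homogeneous

/-! ### Comparison of the metric and of the form with their expressions in charts. -/

section Charts

variable {n : ℕ} {M : Type*} [TopologicalSpace M] [ChartedSpace (Euc n) M]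

/-- The derivative at `q` of the preferred chart at `x₀`. -/
def chartDeriv (x₀ q : M) : TangentSpace (𝓡 n) q →L[ℝ] Euc n :=
  mfderiv (𝓡 n) 𝓘(ℝ, Euc n) (extChartAt (𝓡 n) x₀) q

variable [IsManifold (𝓡 n) ∞ M]

lemma chartDeriv_eq {x₀ q : M} (hq : q ∈ (chartAt (Euc n) x₀).source) :
    chartDeriv (n := n) x₀ q =
      (trivializationAt (Euc n) (TangentSpace (𝓡 n) : M → Type) x₀).continuousLinearMapAt ℝ q :=
  (TangentBundle.continuousLinearMapAt_trivializationAt hq).symm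

lemma symmL_chartDeriv {x₀ q : M} (hq : q ∈ (chartAt (Euc n) x₀).source)
    (v : TangentSpace (𝓡 n) q) :
    (trivializationAt (Euc n) (TangentSpace (𝓡 n) : M → Type) x₀).symmL ℝ q (chartDeriv x₀ q v)
      = v := by
  rw [chartDeriv_eq hq]
  exact Bundle.Trivialization.symmL_continuousLinearMapAt _ (by simpa using hq) v

lemma chartDeriv_symmL {x₀ q : M} (hq : q ∈ (chartAt (Euc n) x₀).source) (v : Euc n) :
    chartDeriv x₀ q
      ((trivializationAt (Euc n) (TangentSpace (𝓡 n) : M → Type) x₀).symmL ℝ q v) = v := by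
  rw [chartDeriv_eq hq]
  exact Bundle.Trivialization.continuousLinearMapAt_symmL _ (by simpa using hq) v

lemma formInChart_apply (Ω : ∀ p : M, TangentSpace (𝓡 n) p [⋀^Fin 2]→L[ℝ] ℝ) {x₀ q : M}
    (hq : q ∈ (chartAt (Euc n) x₀).source) (v w : TangentSpace (𝓡 n) q) :
    formInChart Ω x₀ (extChartAt (𝓡 n) x₀ q) ![chartDeriv x₀ q v, chartDeriv x₀ q w] =
      Ω q ![v, w] := by
  have hq' : q ∈ (extChartAt (𝓡 n) x₀).source := by rwa [extChartAt_source]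
  have e : (extChartAt (𝓡 n) x₀).symm (extChartAt (𝓡 n) x₀ q) = q :=
    (extChartAt (𝓡 n) x₀).left_inv hq'
  have key : ∀ u : TangentSpace (𝓡 n) q,
      (mfderiv 𝓘(ℝ, Euc n) (𝓡 n) (extChartAt (𝓡 n) x₀).symm (extChartAt (𝓡 n) x₀ q)
        (chartDeriv x₀ q u) : Euc n) = u := by
    intro u
    have h1 := symmL_chartDeriv hq u
    rw [TangentBundle.symmL_trivializationAt hq] at h1
    have h2 : range (𝓡 n) = univ := ModelWithCorners.range_eq_univ _
    rw [h2, mfderivWithin_univ] at h1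
    exact h1
  -- The base points agree only propositionally, so `Ω` is transported along a variable point `p`.
  have aux : ∀ (p : M) (h : p = q) (a b : Euc n), a = v → b = w →
      Ω p (![a, b] : Fin 2 → Euc n) = Ω q ![v, w] := by
    rintro p rfl a b rfl rfl
    rfl
  refine Eq.trans ?_ (aux _ e _ _ (key v) (key w))
  refine congrArg (fun z : Fin 2 → Euc n =>
    Ω ((extChartAt (𝓡 n) x₀).symm (extChartAt (𝓡 n) x₀ q)) z) (a₁ := fun i =>
      (mfderiv 𝓘(ℝ, Euc n) (𝓡 n) (extChartAt (𝓡 n) x₀).symm (extChartAt (𝓡 n) x₀ q)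
        ((![chartDeriv x₀ q v, chartDeriv x₀ q w] : Fin 2 → Euc n) i) : Euc n)) ?_
  funext i
  fin_cases i <;> rfl

lemma contMDiffAt_chartDeriv_section {k : ℕ∞ω} {X : ∀ q : M, TangentSpace (𝓡 n) q} {x₀ : M}
    (hX : ContMDiffAt (𝓡 n) (𝓡 n).tangent k (fun q => (⟨q, X q⟩ : TangentBundle (𝓡 n) M)) x₀) :
    ContMDiffAt (𝓡 n) 𝓘(ℝ, Euc n) k (fun q => chartDeriv x₀ q (X q)) x₀ := by
  have h1 := (Bundle.contMDiffAt_section (IB := 𝓡 n) x₀).1 hX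
  refine h1.congr_of_eventuallyEq ?_
  filter_upwards [(chartAt (Euc n) x₀).open_source.mem_nhds (mem_chart_source _ x₀)] with q hq
  rw [chartDeriv_eq hq]
  exact Bundle.Trivialization.continuousLinearMapAt_apply_of_mem _ _ (by simpa using hq) _

variable (g : Bundle.ContMDiffRiemannianMetric (𝓡 n) ∞ (Euc n) (TangentSpace (𝓡 n) : M → Type))

lemma continuous_gnorm : Continuous fun x : TangentBundle (𝓡 n) M => gnorm g x.2 := by
  refine Real.continuous_sqrt.comp (continuous_iff_continuousAt.2 fun x => ?_)
  have h1 : ContinuousAt (fun x : TangentBundle (𝓡 n) M =>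
      (Bundle.TotalSpace.mk' ℝ (E := Bundle.Trivial M ℝ) x.1 (g.inner x.1 x.2 x.2))) x := by
    refine ContinuousAt.clm_bundle_apply₂ (F₁ := Euc n) (F₂ := Euc n) ?_ continuousAt_id
      continuousAt_id
    exact (g.contMDiff.continuous.comp (FiberBundle.continuous_proj (Euc n) _)).continuousAt
  simp only [FiberBundle.continuousAt_totalSpace] at h1
  exact h1.2

lemma continuousAt_gnorm_symmL (x₀ : M) (v : Euc n) :
    ContinuousAt (fun z : M × Euc n => gnorm g
      ((trivializationAt (Euc n) (TangentSpace (𝓡 n) : M → Type) x₀).symmL ℝ z.1 z.2))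
      (x₀, v) := by
  let e := trivializationAt (Euc n) (TangentSpace (𝓡 n) : M → Type) x₀
  have h1 := e.continuousOn_symm.continuousAt (x := (x₀, v))
    ((e.open_baseSet.prod isOpen_univ).mem_nhds
      ⟨FiberBundle.mem_baseSet_trivializationAt' x₀, mem_univ _⟩)
  refine ((continuous_gnorm g).continuousAt.comp h1).congr_of_eventuallyEq ?_
  filter_upwards [(e.open_baseSet.prod isOpen_univ).mem_nhds
    ⟨FiberBundle.mem_baseSet_trivializationAt' x₀, mem_univ v⟩] with z hz
  exact congrArg (gnorm g) (e.symmL_apply (R := ℝ) hz.1 z.2)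

/-- Near `x₀` the Riemannian length is comparable to the Euclidean length in the chart at `x₀`. -/
lemma gnorm_comparable (x₀ : M) : ∃ c > 0, ∃ B > 0, ∀ᶠ q in 𝓝 x₀, ∀ v : TangentSpace (𝓡 n) q,
    c * ‖chartDeriv x₀ q v‖ ≤ gnorm g v ∧ gnorm g v ≤ B * ‖chartDeriv x₀ q v‖ := by
  have hhom : ∀ q (t : ℝ) (v : Euc n), gnorm g
      ((trivializationAt (Euc n) (TangentSpace (𝓡 n) : M → Type) x₀).symmL ℝ q (t • v)) =
      |t| * gnorm g
        ((trivializationAt (Euc n) (TangentSpace (𝓡 n) : M → Type) x₀).symmL ℝ q v) :=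
    fun q t v => by rw [map_smul, gnorm_smul]
  obtain ⟨c, hc, h1⟩ := eventually_mul_norm_le (continuousAt_gnorm_symmL g x₀) hhom fun v hv => by
    refine gnorm_pos g fun h => hv ?_
    rw [← chartDeriv_symmL (mem_chart_source (Euc n) x₀) v, h, map_zero]
  obtain ⟨B, hB, h2⟩ := eventually_le_mul_norm (continuousAt_gnorm_symmL g x₀) hhom
  refine ⟨c, hc, B, hB, ?_⟩
  filter_upwards [h1, h2,
    (chartAt (Euc n) x₀).open_source.mem_nhds (mem_chart_source _ x₀)] with q h1 h2 hq v
  have h3 := h1 (chartDeriv x₀ q v)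
  have h4 := h2 (chartDeriv x₀ q v)
  simp only [symmL_chartDeriv hq] at h3 h4
  exact ⟨h3, h4⟩

lemma exists_frame_bound {r : ℕ} {x₀ : M}
    {X : Fin r → ∀ q : M, TangentSpace (𝓡 n) q}
    (hX : ∀ i, ContMDiffAt (𝓡 n) (𝓡 n).tangent 0
      (fun q => (⟨q, X i q⟩ : TangentBundle (𝓡 n) M)) x₀) :
    ∃ B > 0, ∀ᶠ q in 𝓝 x₀, ∀ i, gnorm g (X i q) ≤ B := by
  have : ∀ i, ∃ B > 0, ∀ᶠ q in 𝓝 x₀, gnorm g (X i q) ≤ B := fun i => by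
    have h1 : ContinuousAt (fun q => gnorm g (X i q)) x₀ :=
      (continuous_gnorm g).continuousAt.comp
        (f := fun q => (⟨q, X i q⟩ : TangentBundle (𝓡 n) M)) (hX i).continuousAt
    refine ⟨gnorm g (X i x₀) + 1, by have := gnorm_nonneg g (X i x₀); positivity, ?_⟩
    filter_upwards [h1.eventually (gt_mem_nhds (lt_add_one _))] with q hq using hq.le
  choose B hB hBe using this
  -- The summand 1 keeps the constant positive when the frame is empty.
  refine ⟨∑ i, B i + 1, by have := Finset.sum_nonneg fun i (_ : i ∈ Finset.univ) => (hB i).le; linarith, ?_⟩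
  filter_upwards [eventually_all.2 hBe] with q hq i
  have := Finset.single_le_sum (fun i _ => (hB i).le) (Finset.mem_univ i)
  exact (hq i).trans (by linarith)

end Charts

section UniformBounds

variable {n : ℕ} {M : Type*} [TopologicalSpace M] [CompactSpace M] [ChartedSpace (Euc n) M]
  [IsManifold (𝓡 n) ∞ M]
  (g : Bundle.ContMDiffRiemannianMetric (𝓡 n) ∞ (Euc n) (TangentSpace (𝓡 n) : M → Type))
  {Ω : ∀ p : M, TangentSpace (𝓡 n) p [⋀^Fin 2]→L[ℝ] ℝ}

lemma continuousAt_formInChart {M : Type*} [TopologicalSpace M] [ChartedSpace (Euc n) M]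
    {Ω : ∀ p : M, TangentSpace (𝓡 n) p [⋀^Fin 2]→L[ℝ] ℝ} (hΩ : IsSymplecticForm Ω) (x₀ : M) :
    ContinuousAt (fun q => formInChart Ω x₀ (extChartAt (𝓡 n) x₀ q)) x₀ := by
  have h1 := (hΩ.smooth x₀).continuousOn.continuousAt
    (extChartAt_target_mem_nhds (I := 𝓡 n) x₀)
  exact ContinuousAt.comp (f := extChartAt (𝓡 n) x₀) h1 (continuousAt_extChartAt x₀)

/-- A symplectic form is uniformly bounded. -/
lemma exists_form_bound (hΩ : IsSymplecticForm Ω) : ∃ K > 0, ∀ (p : M) (v w : TangentSpace (𝓡 n) p),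
    |Ω p ![v, w]| ≤ K * (gnorm g v * gnorm g w) := by
  refine exists_uniform_constant (fun p K K' hKK h v w => (h v w).trans ?_) fun x₀ => ?_
  · exact mul_le_mul_of_nonneg_right hKK (mul_nonneg (gnorm_nonneg g v) (gnorm_nonneg g w))
  obtain ⟨c, hc, B, hB, hcB⟩ := gnorm_comparable g x₀
  have h1 := (continuousAt_formInChart hΩ x₀).norm.eventually
    (gt_mem_nhds (lt_add_one _))
  set K₀ := ‖formInChart Ω x₀ (extChartAt (𝓡 n) x₀ x₀)‖ + 1 with hK₀
  refine ⟨K₀ / c / c, ?_⟩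
  filter_upwards [hcB, h1,
    (chartAt (Euc n) x₀).open_source.mem_nhds (mem_chart_source _ x₀)] with q h2 h3 hq v w
  rw [← formInChart_apply Ω hq]
  have h4 := (formInChart Ω x₀ (extChartAt (𝓡 n) x₀ q)).le_opNorm
    ![chartDeriv x₀ q v, chartDeriv x₀ q w]
  rw [Fin.prod_univ_two, Real.norm_eq_abs] at h4
  simp only [Matrix.cons_val_zero, Matrix.cons_val_one] at h4
  refine h4.trans ?_
  have hv : ‖chartDeriv x₀ q v‖ ≤ gnorm g v / c := (le_div_iff₀' hc).2 (h2 v).1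
  have hw : ‖chartDeriv x₀ q w‖ ≤ gnorm g w / c := (le_div_iff₀' hc).2 (h2 w).1
  have hv0 := gnorm_nonneg g v
  have hK0 : 0 ≤ K₀ := by positivity
  calc _ ≤ K₀ * (gnorm g v / c * (gnorm g w / c)) := by gcongr
    _ = _ := by ring

end UniformBounds

/-! ### 2-forms as bilinear maps. -/

section TwoForms

lemma twoForm_swap {V : Type*} [AddCommGroup V] [Module ℝ V] [TopologicalSpace V]
    (A : V [⋀^Fin 2]→L[ℝ] ℝ) (v w : V) : A ![w, v] = -A ![v, w] := by
  have h := A.toAlternatingMap.map_swap ![v, w] (i := 0) (j := 1) (by decide)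
  have e : ![v, w] ∘ Equiv.swap (0 : Fin 2) 1 = ![w, v] := by
    ext i; fin_cases i <;> rfl
  rw [e] at h
  exact h

lemma twoForm_add_left {V : Type*} [AddCommGroup V] [Module ℝ V] [TopologicalSpace V]
    (A : V [⋀^Fin 2]→L[ℝ] ℝ) (v v' w : V) : A ![v + v', w] = A ![v, w] + A ![v', w] :=
  A.toAlternatingMap.map_vecCons_add ![w] v v'

lemma twoForm_smul_left {V : Type*} [AddCommGroup V] [Module ℝ V] [TopologicalSpace V]
    (A : V [⋀^Fin 2]→L[ℝ] ℝ) (t : ℝ) (v w : V) : A ![t • v, w] = t * A ![v, w] :=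
  A.toAlternatingMap.map_vecCons_smul ![w] t v

/-- A 2-form as a bilinear map. -/
def formLin {V : Type*} [AddCommGroup V] [Module ℝ V] [TopologicalSpace V]
    (A : V [⋀^Fin 2]→L[ℝ] ℝ) : V →ₗ[ℝ] V →ₗ[ℝ] ℝ :=
  LinearMap.mk₂ ℝ (fun v w => A ![v, w]) (twoForm_add_left A) (twoForm_smul_left A)
    (fun v w w' => by
      rw [twoForm_swap A _ v, twoForm_add_left, twoForm_swap A v w, twoForm_swap A v w']; ring)
    (fun t v w => by
      rw [twoForm_swap A _ v, twoForm_smul_left, twoForm_swap A v w]; simp)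

@[simp] lemma formLin_apply {V : Type*} [AddCommGroup V] [Module ℝ V] [TopologicalSpace V]
    (A : V [⋀^Fin 2]→L[ℝ] ℝ) (v w : V) : formLin A v w = A ![v, w] := rfl

lemma formLin_isAlt {V : Type*} [AddCommGroup V] [Module ℝ V] [TopologicalSpace V]
    (A : V [⋀^Fin 2]→L[ℝ] ℝ) : (formLin A).IsAlt := fun v => by
  have := twoForm_swap A v v
  rw [formLin_apply]
  linarith

variable {E : Type*} [NormedAddCommGroup E] [NormedSpace ℝ E]

lemma twoForm_bound (A : E [⋀^Fin 2]→L[ℝ] ℝ) (v w : E) : ‖A ![v, w]‖ ≤ ‖A‖ * ‖v‖ * ‖w‖ := by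
  have h := A.le_opNorm ![v, w]
  rw [Fin.prod_univ_two] at h
  simpa [mul_assoc] using h

/-- A continuous 2-form as a continuous bilinear map, depending linearly on the form. -/
def formBilin : (E [⋀^Fin 2]→L[ℝ] ℝ) →L[ℝ] E →L[ℝ] E →L[ℝ] ℝ :=
  LinearMap.mkContinuous
    { toFun := fun A => LinearMap.mkContinuous₂ (formLin A) ‖A‖ (twoForm_bound A)
      map_add' := fun A B => by ext v w; rfl
      map_smul' := fun t A => by ext v w; rfl } 1 fun A => by
    rw [one_mul]
    exact LinearMap.mkContinuous₂_norm_le (formLin A) (norm_nonneg A) (twoForm_bound A)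

lemma formBilin_apply (A : E [⋀^Fin 2]→L[ℝ] ℝ) (v w : E) : formBilin A v w = A ![v, w] := rfl

end TwoForms

/-! ### Uniform nondegeneracy of the symplectic form. -/

section Nondegeneracy

variable {n : ℕ} {M : Type*} [TopologicalSpace M] [CompactSpace M] [ChartedSpace (Euc n) M]
  [IsManifold (𝓡 n) ∞ M]
  (g : Bundle.ContMDiffRiemannianMetric (𝓡 n) ∞ (Euc n) (TangentSpace (𝓡 n) : M → Type))
  {Ω : ∀ p : M, TangentSpace (𝓡 n) p [⋀^Fin 2]→L[ℝ] ℝ}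

/-- A frame of a subbundle near a point. -/
lemma IsSubbundle.exists_frame {M : Type*} [TopologicalSpace M] [ChartedSpace (Euc n) M]
    [IsManifold (𝓡 n) ∞ M] {k : ℕ∞ω} {E : ∀ p : M, Submodule ℝ (TangentSpace (𝓡 n) p)}
    (h : IsSubbundle k E) (x₀ : M) : ∃ (r : ℕ) (X : Fin r → ∀ q : M, TangentSpace (𝓡 n) q),
      (∀ i, ContMDiffAt (𝓡 n) (𝓡 n).tangent k
        (fun q => (⟨q, X i q⟩ : TangentBundle (𝓡 n) M)) x₀) ∧
      ∀ᶠ q in 𝓝 x₀, LinearIndependent ℝ (fun i => X i q) ∧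
        Submodule.span ℝ (range fun i => X i q) = E q := by
  obtain ⟨U, hU, hx, r, X, hX, hXE⟩ := h x₀
  exact ⟨r, X, fun i => (hX i).contMDiffAt (hU.mem_nhds hx), by
    filter_upwards [hU.mem_nhds hx] with q hq using hXE q hq⟩

/-- A symplectic form is uniformly nondegenerate; it suffices to test it on three subbundles that
span the tangent bundle. -/
lemma exists_nondegenerate_bound (hΩ : IsSymplecticForm Ω)
    {E₁ E₂ E₃ : ∀ p : M, Submodule ℝ (TangentSpace (𝓡 n) p)} (h₁ : IsSubbundle 0 E₁)
    (h₂ : IsSubbundle 0 E₂) (h₃ : IsSubbundle 0 E₃) (hsup : ∀ p, E₁ p ⊔ (E₂ p ⊔ E₃ p) = ⊤) :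
    ∃ D > 0, ∀ (p : M) (x : TangentSpace (𝓡 n) p) (ε : ℝ), 0 ≤ ε →
      (∀ y ∈ E₁ p, |Ω p ![x, y]| ≤ ε * gnorm g y) → (∀ y ∈ E₂ p, |Ω p ![x, y]| ≤ ε * gnorm g y) →
      (∀ y ∈ E₃ p, |Ω p ![x, y]| ≤ ε * gnorm g y) → gnorm g x ≤ D * ε := by
  refine exists_uniform_constant (fun p K K' hKK h x ε hε a b c => (h x ε hε a b c).trans
    (mul_le_mul_of_nonneg_right hKK hε)) fun x₀ => ?_
  obtain ⟨r₁, X₁, hX₁, hE₁⟩ := h₁.exists_frame x₀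
  obtain ⟨r₂, X₂, hX₂, hE₂⟩ := h₂.exists_frame x₀
  obtain ⟨r₃, X₃, hX₃, hE₃⟩ := h₃.exists_frame x₀
  obtain ⟨B₁, hB₁, hb₁⟩ := exists_frame_bound g hX₁
  obtain ⟨B₂, hB₂, hb₂⟩ := exists_frame_bound g hX₂
  obtain ⟨B₃, hB₃, hb₃⟩ := exists_frame_bound g hX₃
  obtain ⟨c, hc, B, hB, hcB⟩ := gnorm_comparable g x₀
  let T : (r : ℕ) → (Fin r → ∀ q : M, TangentSpace (𝓡 n) q) → M × Euc n → ℝ := fun r X z =>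
    ∑ i, |formBilin (formInChart Ω x₀ (extChartAt (𝓡 n) x₀ z.1)) z.2 (chartDeriv x₀ z.1 (X i z.1))|
  have hTc : ∀ r X, (∀ i, ContMDiffAt (𝓡 n) (𝓡 n).tangent 0
        (fun q => (⟨q, X i q⟩ : TangentBundle (𝓡 n) M)) x₀) → ∀ v, ContinuousAt (T r X) (x₀, v) := by
    intro r X hX v
    refine tendsto_finsetSum _ fun i _ => ?_
    have c1 : ContinuousAt (fun z : M × Euc n =>
        formBilin (formInChart Ω x₀ (extChartAt (𝓡 n) x₀ z.1))) (x₀, v) :=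
      formBilin.continuous.continuousAt.comp (ContinuousAt.comp
        (g := fun q => formInChart Ω x₀ (extChartAt (𝓡 n) x₀ q)) (f := Prod.fst)
        (continuousAt_formInChart hΩ x₀) continuousAt_fst)
    have c2 : ContinuousAt (fun z : M × Euc n => chartDeriv x₀ z.1 (X i z.1)) (x₀, v) :=
      ContinuousAt.comp (g := fun q => (chartDeriv x₀ q (X i q) : Euc n)) (f := Prod.fst)
        (contMDiffAt_chartDeriv_section (hX i)).continuousAt continuousAt_fst
    exact ((c1.clm_apply continuousAt_snd).clm_apply c2).abs
  have hTh : ∀ r X q (t : ℝ) v, T r X (q, t • v) = |t| * T r X (q, v) := by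
    intro r X q t v
    simp only [T, map_smul, smul_apply, smul_eq_mul, abs_mul, Finset.mul_sum]
  -- `F` sums the pairings of `v` with all the frame vectors. It is homogeneous in `v`, and positive
  -- at `x₀` since the frames span and `Ω` is nondegenerate; hence it is at least `c' * ‖v‖` near
  -- `x₀`. The tests on the three subbundles bound it from above by a multiple of `ε`.
  let F : M × Euc n → ℝ := fun z => T r₁ X₁ z + (T r₂ X₂ z + T r₃ X₃ z)
  have hTn : ∀ r X z, 0 ≤ T r X z := fun r X z => Finset.sum_nonneg fun i _ => abs_nonneg _
  have hx₀ : x₀ ∈ (chartAt (Euc n) x₀).source := mem_chart_source _ x₀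
  have hT0 : ∀ r X (E : ∀ p : M, Submodule ℝ (TangentSpace (𝓡 n) p)),
      Submodule.span ℝ (range fun i => X i x₀) = E x₀ → ∀ v : TangentSpace (𝓡 n) x₀,
      T r X (x₀, chartDeriv x₀ x₀ v) = 0 → ∀ y ∈ E x₀, Ω x₀ ![v, y] = 0 := by
    intro r X E hE v hv y hy
    rw [Finset.sum_eq_zero_iff_of_nonneg fun i _ => abs_nonneg _] at hv
    rw [← hE] at hy
    change formLin (Ω x₀) v y = 0
    have : Submodule.span ℝ (range fun i => X i x₀) ≤ LinearMap.ker (formLin (Ω x₀) v) := by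
      rw [Submodule.span_le]
      rintro _ ⟨i, rfl⟩
      have h1 := abs_eq_zero.1 (hv i (Finset.mem_univ i))
      rw [formBilin_apply] at h1
      exact (formInChart_apply Ω hx₀ v (X i x₀)).symm.trans h1
    exact this hy
  have hpos : ∀ v ≠ 0, 0 < F (x₀, v) := by
    intro v hv
    by_contra hneg
    have n₁ := hTn r₁ X₁ (x₀, v)
    have n₂ := hTn r₂ X₂ (x₀, v)
    have n₃ := hTn r₃ X₃ (x₀, v)
    have hF : F (x₀, v) = T r₁ X₁ (x₀, v) + (T r₂ X₂ (x₀, v) + T r₃ X₃ (x₀, v)) := rfl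
    obtain ⟨v', rfl⟩ : ∃ v' : TangentSpace (𝓡 n) x₀, chartDeriv x₀ x₀ v' = v :=
      ⟨_, chartDeriv_symmL hx₀ v⟩
    have z₁ := hT0 r₁ X₁ E₁ hE₁.self_of_nhds.2 v' (by linarith)
    have z₂ := hT0 r₂ X₂ E₂ hE₂.self_of_nhds.2 v' (by linarith)
    have z₃ := hT0 r₃ X₃ E₃ hE₃.self_of_nhds.2 v' (by linarith)
    refine hv ?_
    rw [hΩ.nondegenerate x₀ v' fun w => ?_, map_zero]
    have hw : w ∈ E₁ x₀ ⊔ (E₂ x₀ ⊔ E₃ x₀) := by rw [hsup]; trivial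
    have hle : E₁ x₀ ⊔ (E₂ x₀ ⊔ E₃ x₀) ≤ LinearMap.ker (formLin (Ω x₀) v') :=
      sup_le z₁ (sup_le z₂ z₃)
    exact hle hw
  obtain ⟨c', hc', hlow⟩ := eventually_mul_norm_le (F := F)
    (fun v => (hTc r₁ X₁ hX₁ v).add ((hTc r₂ X₂ hX₂ v).add (hTc r₃ X₃ hX₃ v)))
    (fun q t v => by simp only [F, hTh]; ring) hpos
  refine ⟨B * ((r₁ * B₁ + (r₂ * B₂ + r₃ * B₃)) / c'), ?_⟩
  filter_upwards [hE₁, hE₂, hE₃, hb₁, hb₂, hb₃, hcB, hlow,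
    (chartAt (Euc n) x₀).open_source.mem_nhds hx₀] with q e₁ e₂ e₃ b₁ b₂ b₃ hcB hlow hq x ε hε
      y₁ y₂ y₃
  have hTb : ∀ r X (E : ∀ p : M, Submodule ℝ (TangentSpace (𝓡 n) p)) (b : ℝ),
      Submodule.span ℝ (range fun i => X i q) = E q → (∀ i, gnorm g (X i q) ≤ b) →
      (∀ y ∈ E q, |Ω q ![x, y]| ≤ ε * gnorm g y) →
      T r X (q, chartDeriv x₀ q x) ≤ r * b * ε := by
    intro r X E b hE hb hy
    have : ∀ i ∈ Finset.univ, |formBilin (formInChart Ω x₀ (extChartAt (𝓡 n) x₀ q))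
        (chartDeriv x₀ q x) (chartDeriv x₀ q (X i q))| ≤ ε * b := by
      intro i _
      rw [formBilin_apply, formInChart_apply Ω hq]
      refine (hy _ ?_).trans (mul_le_mul_of_nonneg_left (hb i) hε)
      rw [← hE]
      exact Submodule.subset_span ⟨i, rfl⟩
    refine (Finset.sum_le_card_nsmul _ _ _ this).trans (le_of_eq ?_)
    rw [Finset.card_univ, Fintype.card_fin, nsmul_eq_mul]
    ring
  have t₁ := hTb r₁ X₁ E₁ B₁ e₁.2 b₁ y₁
  have t₂ := hTb r₂ X₂ E₂ B₂ e₂.2 b₂ y₂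
  have t₃ := hTb r₃ X₃ E₃ B₃ e₃.2 b₃ y₃
  have h1 : c' * ‖chartDeriv x₀ q x‖ ≤ (r₁ * B₁ + (r₂ * B₂ + r₃ * B₃)) * ε :=
    (hlow _).trans (by change _ + (_ + _) ≤ _; linarith)
  calc gnorm g x ≤ B * ‖chartDeriv x₀ q x‖ := (hcB x).2
    _ ≤ B * ((r₁ * B₁ + (r₂ * B₂ + r₃ * B₃)) * ε / c') := by
      gcongr
      exact (le_div_iff₀' hc').2 h1
    _ = _ := by ring

end Nondegeneracy

/-! ### Local defining forms of hyperplane fields. -/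

section DefiningForms

variable {n : ℕ} {M : Type*} [TopologicalSpace M] [ChartedSpace (Euc n) M]

/-- `α` is, in the chart at `x₀` and over the open set `U`, a `C^1` form with kernel `E`. -/
structure IsDefiningForm (E : ∀ p : M, Submodule ℝ (TangentSpace (𝓡 n) p)) (x₀ : M) (U : Set M)
    (α : Euc n → Euc n →L[ℝ] ℝ) : Prop where
  isOpen : IsOpen U
  subset_source : U ⊆ (chartAt (Euc n) x₀).source
  contDiffOn : ContDiffOn ℝ 1 α (extChartAt (𝓡 n) x₀ '' U)
  ker : ∀ q ∈ U, ∀ v : TangentSpace (𝓡 n) q,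
    α (extChartAt (𝓡 n) x₀ q) (chartDeriv x₀ q v) = 0 ↔ v ∈ E q

/-- The exterior derivative at `q` of a form given in the chart at `x₀`. -/
def formCurvature (x₀ : M) (α : Euc n → Euc n →L[ℝ] ℝ) (q : M) :
    TangentSpace (𝓡 n) q →ₗ[ℝ] TangentSpace (𝓡 n) q →ₗ[ℝ] ℝ :=
  LinearMap.mk₂ ℝ (fun v w =>
      fderiv ℝ α (extChartAt (𝓡 n) x₀ q) (chartDeriv x₀ q v) (chartDeriv x₀ q w) -
      fderiv ℝ α (extChartAt (𝓡 n) x₀ q) (chartDeriv x₀ q w) (chartDeriv x₀ q v))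
    (fun v v' w => by simp only [map_add, add_apply]; ring)
    (fun t v w => by simp only [map_smul, smul_apply, smul_eq_mul]; ring)
    (fun v w w' => by simp only [map_add, add_apply]; ring)
    (fun t v w => by simp only [map_smul, smul_apply, smul_eq_mul]; ring)

lemma formCurvature_apply (x₀ : M) (α : Euc n → Euc n →L[ℝ] ℝ) (q : M)
    (v w : TangentSpace (𝓡 n) q) : formCurvature x₀ α q v w =
      fderiv ℝ α (extChartAt (𝓡 n) x₀ q) (chartDeriv x₀ q v) (chartDeriv x₀ q w) -
      fderiv ℝ α (extChartAt (𝓡 n) x₀ q) (chartDeriv x₀ q w) (chartDeriv x₀ q v) := rfl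

lemma formCurvature_isAlt (x₀ : M) (α : Euc n → Euc n →L[ℝ] ℝ) (q : M) :
    (formCurvature x₀ α q).IsAlt := fun _ => sub_self _

lemma IsDefiningForm.isOpen_image {E : ∀ p : M, Submodule ℝ (TangentSpace (𝓡 n) p)} {x₀ : M}
    {U : Set M} {α : Euc n → Euc n →L[ℝ] ℝ} (h : IsDefiningForm E x₀ U α) :
    IsOpen (extChartAt (𝓡 n) x₀ '' U) :=
  (chartAt (Euc n) x₀).isOpen_image_of_subset_source h.isOpen h.subset_source

end DefiningForms

/-- On a plane, a bounded 2-form is bounded by any 2-form that is nondegenerate there. -/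
lemma abs_le_of_nondegenerate_plane {V : Type*} [AddCommGroup V] [Module ℝ V] {C : Submodule ℝ V}
    {σ Λ : V →ₗ[ℝ] V →ₗ[ℝ] ℝ} (hσ : σ.IsAlt) (hΛ : Λ.IsAlt) (hC : Module.finrank ℝ C = 2)
    {ν : V → ℝ} (hν : ∀ v, 0 ≤ ν v) (hν0 : ∀ v, v ≠ 0 → 0 < ν v) {D κ : ℝ} (hD : 0 < D)
    (hnd : ∀ x ∈ C, ∀ ε, 0 ≤ ε → (∀ y ∈ C, |σ x y| ≤ ε * ν y) → ν x ≤ D * ε)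
    (hb : ∀ a ∈ C, ∀ b ∈ C, |Λ a b| ≤ κ * (ν a * ν b)) (hκ : 0 ≤ κ) {v w : V} (hv : v ∈ C)
    (hw : w ∈ C) : |Λ v w| ≤ 2 * D * κ * |σ v w| := by
  have : FiniteDimensional ℝ C := FiniteDimensional.of_finrank_pos (by omega)
  have : Nontrivial C := Module.finrank_pos_iff (R := ℝ).1 (by omega)
  obtain ⟨⟨a, ha⟩, ha0⟩ := exists_ne (0 : C)
  have ha0' : a ≠ 0 := fun h => ha0 (Subtype.ext h)
  have pa := hν0 a ha0'
  -- Otherwise nondegeneracy with `ε = ν a / (2 * D)` would give `ν a ≤ ν a / 2`.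
  obtain ⟨b, hb', hab⟩ : ∃ b ∈ C, ν a / (2 * D) * ν b < |σ a b| := by
    by_contra! h
    have h1 := hnd a ha (ν a / (2 * D)) (by positivity) h
    have h2 : D * (ν a / (2 * D)) = ν a / 2 := by field_simp
    linarith
  have hσab : σ a b ≠ 0 := by
    have := hν b
    exact abs_pos.1 (lt_of_le_of_lt (by positivity) hab)
  have hli : LinearIndependent ℝ ![(⟨a, ha⟩ : C), ⟨b, hb'⟩] := by
    refine LinearIndependent.pair_iff.2 fun s t hst => ?_
    have h1 : s • a + t • b = 0 := congrArg Subtype.val hst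
    have h2 := congrArg (σ a) h1
    have h3 := congrArg (fun x => σ x b) h1
    simp only [map_add, map_smul, hσ a, map_zero, smul_eq_mul, mul_zero, zero_add, hσ b, add_zero,
      LinearMap.add_apply, LinearMap.smul_apply, LinearMap.zero_apply] at h2 h3
    exact ⟨(mul_eq_zero.1 h3).resolve_right hσab, (mul_eq_zero.1 h2).resolve_right hσab⟩
  have hspan := hli.span_eq_top_of_card_eq_finrank (by rw [Fintype.card_fin, hC])
  have hrep : ∀ x ∈ C, ∃ s t : ℝ, x = s • a + t • b := by
    intro x hx
    have h1 : (⟨x, hx⟩ : C) ∈ Submodule.span ℝ (range ![(⟨a, ha⟩ : C), ⟨b, hb'⟩]) := by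
      rw [hspan]; trivial
    rw [Matrix.range_cons, Matrix.range_cons, Matrix.range_empty, union_empty,
      singleton_union] at h1
    obtain ⟨s, t, h⟩ := Submodule.mem_span_pair.1 h1
    exact ⟨s, t, (congrArg Subtype.val h).symm⟩
  obtain ⟨s, t, rfl⟩ := hrep v hv
  obtain ⟨s', t', rfl⟩ := hrep w hw
  -- On the plane every alternating form is its value on the basis times the same determinant, so
  -- the comparison need only be made on `(a, b)`.
  have exp : ∀ {τ : V →ₗ[ℝ] V →ₗ[ℝ] ℝ}, τ.IsAlt →
      τ (s • a + t • b) (s' • a + t' • b) = (s * t' - t * s') * τ a b := by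
    intro τ hτ
    have h1 : τ b a = -τ a b := (hτ.neg a b).symm
    simp only [map_add, map_smul, LinearMap.add_apply, LinearMap.smul_apply, hτ a, hτ b, h1,
      smul_eq_mul]
    ring
  rw [exp hσ, exp hΛ, abs_mul, abs_mul]
  have h1 : ν a * ν b ≤ 2 * D * |σ a b| := by
    have : ν a / (2 * D) * ν b = ν a * ν b / (2 * D) := by ring
    rw [this, div_lt_iff₀' (by positivity)] at hab
    exact hab.le
  calc |s * t' - t * s'| * |Λ a b| ≤ |s * t' - t * s'| * (κ * (2 * D * |σ a b|)) := by
        gcongr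
        exact (hb a ha b hb').trans (by gcongr)
    _ = _ := by ring

/-! ### Invariance of the symplectic form under iterates and inverse. -/

section Invariance

variable {n : ℕ} {M : Type*} [TopologicalSpace M] [ChartedSpace (Euc n) M] {k : ℕ∞ω}
  {Ω : ∀ p : M, TangentSpace (𝓡 n) p [⋀^Fin 2]→L[ℝ] ℝ} {f : Diffeomorph (𝓡 n) (𝓡 n) M M k}

lemma form_congr {p p' : M} (h : p = p') (v w v' w' : Euc n) (hv : v = v') (hw : w = w') :
    Ω p ![(v : TangentSpace (𝓡 n) p), (w : TangentSpace (𝓡 n) p)] =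
      Ω p' ![(v' : TangentSpace (𝓡 n) p'), (w' : TangentSpace (𝓡 n) p')] := by
  subst h; subst hv; subst hw; rfl

lemma PreservesForm.apply {f : M → M} (hf : PreservesForm f Ω) (p : M)
    (v w : TangentSpace (𝓡 n) p) :
    Ω (f p) ![mfderiv (𝓡 n) (𝓡 n) f p v, mfderiv (𝓡 n) (𝓡 n) f p w] = Ω p ![v, w] := by
  rw [← hf p, ContinuousAlternatingMap.compContinuousLinearMap_apply]
  congr 1
  funext i
  fin_cases i <;> rfl

lemma preservesForm_of_apply {f : M → M} (h : ∀ p (v w : TangentSpace (𝓡 n) p),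
    Ω (f p) ![mfderiv (𝓡 n) (𝓡 n) f p v, mfderiv (𝓡 n) (𝓡 n) f p w] = Ω p ![v, w]) :
    PreservesForm f Ω := by
  intro p
  ext v
  have e : v = ![v 0, v 1] := by funext i; fin_cases i <;> rfl
  rw [e, ← h p, ContinuousAlternatingMap.compContinuousLinearMap_apply]
  congr 1
  funext i
  fin_cases i <;> rfl

lemma PreservesForm.iterate (hk : k ≠ 0) (hf : PreservesForm f Ω) (m : ℕ) (p : M)
    (v w : TangentSpace (𝓡 n) p) :
    Ω (f^[m] p) ![mfderiv (𝓡 n) (𝓡 n) f^[m] p v, mfderiv (𝓡 n) (𝓡 n) f^[m] p w] =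
      Ω p ![v, w] := by
  rw [← coe_diffeoIterate]
  induction m with
  | zero =>
    change Ω (id p) ![mfderiv (𝓡 n) (𝓡 n) id p v, mfderiv (𝓡 n) (𝓡 n) id p w] = _
    rw [mfderiv_id]
    rfl
  | succ m ih =>
    have h1 := ((f.mdifferentiable hk (diffeoIterate f m p)).hasMFDerivAt.comp p
      ((diffeoIterate f m).mdifferentiable hk p).hasMFDerivAt).mfderiv
    change Ω (f (diffeoIterate f m p)) ![mfderiv (𝓡 n) (𝓡 n) (f ∘ diffeoIterate f m) p v,
      mfderiv (𝓡 n) (𝓡 n) (f ∘ diffeoIterate f m) p w] = _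
    rw [h1, ← ih]
    exact hf.apply _ _ _

lemma PreservesForm.symm (hk : k ≠ 0) (hf : PreservesForm f Ω) : PreservesForm f.symm Ω := by
  refine preservesForm_of_apply fun p v w => ?_
  rw [← hf.apply]
  exact form_congr (f.apply_symm_apply p) _ _ _ _ (mfderiv_symm_apply_mfderiv f.symm hk p v)
    (mfderiv_symm_apply_mfderiv f.symm hk p w)

end Invariance

/-! ### Symplectic orthogonality and the defining forms of `Es ⊕ Ec`. -/

section PartiallyHyperbolic

variable {n : ℕ} {M : Type*} [TopologicalSpace M] [ChartedSpace (Euc n) M] {k : ℕ∞ω}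

lemma IsDInvariant.mem_iterate {f : Diffeomorph (𝓡 n) (𝓡 n) M M k} (hk : k ≠ 0)
    {E : ∀ p : M, Submodule ℝ (TangentSpace (𝓡 n) p)} (h : IsDInvariant f E) (m : ℕ) {p : M}
    {v : TangentSpace (𝓡 n) p} (hv : v ∈ E p) : mfderiv (𝓡 n) (𝓡 n) f^[m] p v ∈ E (f^[m] p) := by
  have h1 := h.iterate hk m p
  rw [coe_diffeoIterate] at h1
  rw [← h1]
  exact Submodule.mem_map_of_mem hv

lemma IsDInvariant.exists_of_mem_iterate {f : Diffeomorph (𝓡 n) (𝓡 n) M M k} (hk : k ≠ 0)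
    {E : ∀ p : M, Submodule ℝ (TangentSpace (𝓡 n) p)} (h : IsDInvariant f E) (m : ℕ) {p : M}
    {w : TangentSpace (𝓡 n) (f^[m] p)} (hw : w ∈ E (f^[m] p)) :
    ∃ v ∈ E p, mfderiv (𝓡 n) (𝓡 n) f^[m] p v = w := by
  have h1 := h.iterate hk m p
  rw [coe_diffeoIterate] at h1
  rw [← h1] at hw
  exact hw

variable [IsManifold (𝓡 n) ∞ M]

lemma gnorm_mfderiv_iterate_zero
    (g : Bundle.ContMDiffRiemannianMetric (𝓡 n) ∞ (Euc n) (TangentSpace (𝓡 n) : M → Type))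
    (f : M → M) (p : M) (v : TangentSpace (𝓡 n) p) :
    gnorm g (mfderiv (𝓡 n) (𝓡 n) f^[0] p v) = gnorm g v := by
  change gnorm g (mfderiv (𝓡 n) (𝓡 n) id p v) = _
  rw [mfderiv_id]
  rfl

/-- A symplectic partially hyperbolic diffeomorphism with one-dimensional stable and unstable
bundles and two-dimensional center bundle, with rates in homogeneous form. -/
structure IsSymplecticallyDominated
    (g : Bundle.ContMDiffRiemannianMetric (𝓡 n) ∞ (Euc n) (TangentSpace (𝓡 n) : M → Type))
    (Ω : ∀ p : M, TangentSpace (𝓡 n) p [⋀^Fin 2]→L[ℝ] ℝ)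
    (f : Diffeomorph (𝓡 n) (𝓡 n) M M k) (Es Ec Eu : ∀ p : M, Submodule ℝ (TangentSpace (𝓡 n) p))
    (lam A : ℝ) : Prop where
  symplectic : IsSymplecticForm Ω
  preserves : PreservesForm f Ω
  dominated : IsDominated g f Es Ec Eu lam A
  rate_pos : 0 < lam
  rate_lt_one : lam < 1
  const_pos : 0 < A
  sup_eq_top : ∀ p, Es p ⊔ (Ec p ⊔ Eu p) = ⊤
  subbundle_s : IsSubbundle 0 Es
  subbundle_c : IsSubbundle 0 Ec
  subbundle_u : IsSubbundle 0 Eu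
  invariant_s : IsDInvariant f Es
  invariant_c : IsDInvariant f Ec
  invariant_u : IsDInvariant f Eu
  finrank_s : ∀ p, Module.finrank ℝ (Es p) = 1
  finrank_c : ∀ p, Module.finrank ℝ (Ec p) = 2
  finrank_u : ∀ p, Module.finrank ℝ (Eu p) = 1

namespace IsSymplecticallyDominated

variable {g : Bundle.ContMDiffRiemannianMetric (𝓡 n) ∞ (Euc n) (TangentSpace (𝓡 n) : M → Type)}
  {Ω : ∀ p : M, TangentSpace (𝓡 n) p [⋀^Fin 2]→L[ℝ] ℝ} {f : Diffeomorph (𝓡 n) (𝓡 n) M M k}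
  {Es Ec Eu : ∀ p : M, Submodule ℝ (TangentSpace (𝓡 n) p)} {lam A : ℝ}

lemma symm (hk : k ≠ 0) (h : IsSymplecticallyDominated g Ω f Es Ec Eu lam A) :
    IsSymplecticallyDominated g Ω f.symm Eu Ec Es lam A where
  symplectic := h.symplectic
  preserves := h.preserves.symm hk
  dominated := h.dominated.symm hk h.invariant_s h.invariant_c h.invariant_u
  rate_pos := h.rate_pos
  rate_lt_one := h.rate_lt_one
  const_pos := h.const_pos
  sup_eq_top p := by rw [← h.sup_eq_top p, sup_comm (Eu p), sup_comm (Ec p), sup_assoc]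
  subbundle_s := h.subbundle_u
  subbundle_c := h.subbundle_c
  subbundle_u := h.subbundle_s
  invariant_s := h.invariant_u.symm hk
  invariant_c := h.invariant_c.symm hk
  invariant_u := h.invariant_s.symm hk
  finrank_s := h.finrank_u
  finrank_c := h.finrank_c
  finrank_u := h.finrank_s

variable [CompactSpace M]

/-- The stable bundle is symplectically orthogonal to the center bundle. -/
lemma orthogonal (hk : k ≠ 0) (h : IsSymplecticallyDominated g Ω f Es Ec Eu lam A) (p : M) :
    ∀ s ∈ Es p, ∀ w ∈ Ec p, Ω p ![s, w] = 0 := by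
  obtain ⟨K, hK, hbound⟩ := exists_form_bound g h.symplectic
  obtain ⟨D, hD, hnd⟩ := exists_nondegenerate_bound g h.symplectic h.subbundle_s h.subbundle_c
    h.subbundle_u h.sup_eq_top
  have hinv := h.preserves.iterate hk
  have hzero := gnorm_mfderiv_iterate_zero g f p
  refine orthogonal_of_domination (formLin_isAlt (Ω p)) (h.finrank_s p) (h.finrank_c p) (U := Eu p)
    (ν := fun m v => gnorm g (mfderiv (𝓡 n) (𝓡 n) f^[m] p v)) (fun m v => gnorm_nonneg g _)
    (fun m v hv => ?_) h.rate_pos h.rate_lt_one h.const_pos.le hK.le (inv_pos.2 hD)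
    (fun m hm v hv w hw => ?_) (fun m hm v hv w hw => ?_) (fun m v w => ?_)
    (fun m x ε hε h₁ h₂ h₃ => ?_)
  · rw [← coe_diffeoIterate]
    exact gnorm_pos g (mfderiv_ne_zero _ hk p hv)
  · rw [hzero, hzero]
    exact h.dominated.dominate_sc m hm p v hv w hw
  · rw [hzero, hzero]
    exact h.dominated.dominate_cu m hm p v hv w hw
  · rw [formLin_apply, ← hinv m]
    exact hbound _ _ _
  · rw [inv_mul_le_iff₀ hD]
    -- By invariance of the bundles and of `Ω`, testing at `f^[m] p` amounts to testing at `p` with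
    -- the pulled back norms.
    have test : ∀ {E : ∀ p : M, Submodule ℝ (TangentSpace (𝓡 n) p)}, IsDInvariant f E →
        (∀ y ∈ E p, |formLin (Ω p) x y| ≤ ε * gnorm g (mfderiv (𝓡 n) (𝓡 n) f^[m] p y)) →
        ∀ y ∈ E (f^[m] p), |Ω (f^[m] p) ![mfderiv (𝓡 n) (𝓡 n) f^[m] p x, y]| ≤ ε * gnorm g y := by
      intro E hE hy y' hy'
      obtain ⟨y, hyE, rfl⟩ := hE.exists_of_mem_iterate hk m hy'
      rw [hinv]
      exact hy y hyE
    exact hnd _ _ ε hε (test h.invariant_s h₁) (test h.invariant_c h₂) (test h.invariant_u h₃)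

/-- The bundle `Es ⊕ Ec` is locally the kernel of a `C^1` form, with uniform bounds. -/
lemma exists_isDefiningForm (hk : k ≠ 0) (h : IsSymplecticallyDominated g Ω f Es Ec Eu lam A)
    (hs : IsSubbundle 1 Es) : ∃ K > 0, ∀ p : M, ∃ (x₀ : M) (U : Set M) (α : Euc n → Euc n →L[ℝ] ℝ),
      IsDefiningForm (fun p => Es p ⊔ Ec p) x₀ U α ∧ p ∈ U ∧
      (∀ v w, |formCurvature x₀ α p v w| ≤ K * (gnorm g v * gnorm g w)) ∧
      ∀ u ∈ Eu p, gnorm g u ≤ K * |α (extChartAt (𝓡 n) x₀ p) (chartDeriv x₀ p u)| := by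
  obtain ⟨D, hD, hnd⟩ := exists_nondegenerate_bound g h.symplectic h.subbundle_s h.subbundle_c
    h.subbundle_u h.sup_eq_top
  have horth := h.orthogonal hk
  refine exists_uniform_constant ?_ fun x₀ => ?_
  · rintro p K K' hKK ⟨x₀, U, α, hα, hp, h1, h2⟩
    refine ⟨x₀, U, α, hα, hp, fun v w => (h1 v w).trans ?_, fun u hu => (h2 u hu).trans ?_⟩
    · exact mul_le_mul_of_nonneg_right hKK (mul_nonneg (gnorm_nonneg g v) (gnorm_nonneg g w))
    · exact mul_le_mul_of_nonneg_right hKK (abs_nonneg _)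
  have hx₀ : x₀ ∈ (chartAt (Euc n) x₀).source := mem_chart_source _ x₀
  have hinv : ∀ {q}, q ∈ (chartAt (Euc n) x₀).source →
      (extChartAt (𝓡 n) x₀).symm (extChartAt (𝓡 n) x₀ q) = q := fun hq =>
    (extChartAt (𝓡 n) x₀).left_inv (by rwa [extChartAt_source])
  obtain ⟨r, Y, hY, hYE⟩ := hs.exists_frame x₀
  obtain rfl : r = 1 := by
    obtain ⟨h1, h2⟩ := hYE.self_of_nhds
    have h3 := finrank_span_eq_card h1
    rw [h2, h.finrank_s, Fintype.card_fin] at h3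
    exact h3.symm
  set X : ∀ q : M, TangentSpace (𝓡 n) q := Y 0 with hX
  have hXE : ∀ᶠ q in 𝓝 x₀, X q ≠ 0 ∧ X q ∈ Es q := by
    filter_upwards [hYE] with q hq
    exact ⟨hq.1.ne_zero 0, hq.2 ▸ Submodule.subset_span ⟨0, rfl⟩⟩
  let ξ : M → Euc n := fun q => chartDeriv x₀ q (X q)
  -- The contraction of `Ω` with the local `C^1` generator `X` of `Es`, in the chart at `x₀`. Only
  -- `Es` has to be `C^1` for this.
  let α : Euc n → Euc n →L[ℝ] ℝ := fun y =>
    formBilin (formInChart Ω x₀ y) (ξ ((extChartAt (𝓡 n) x₀).symm y))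
  have hα : ∀ q ∈ (chartAt (Euc n) x₀).source, ∀ v : TangentSpace (𝓡 n) q,
      α (extChartAt (𝓡 n) x₀ q) (chartDeriv x₀ q v) = Ω q ![X q, v] := by
    intro q hq v
    simp only [α, formBilin_apply, hinv hq]
    exact formInChart_apply Ω hq (X q) v
  have hαC : ContDiffAt ℝ 1 α (extChartAt (𝓡 n) x₀ x₀) := by
    have h1 : ContDiffAt ℝ 1 (formInChart Ω x₀) (extChartAt (𝓡 n) x₀ x₀) :=
      ((h.symplectic.smooth x₀).contDiffAt (extChartAt_target_mem_nhds x₀)).of_le (by simp)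
    have h2 : ContMDiffAt 𝓘(ℝ, Euc n) (𝓡 n) 1 (extChartAt (𝓡 n) x₀).symm
        (extChartAt (𝓡 n) x₀ x₀) :=
      ((contMDiffOn_extChartAt_symm (n := ∞) x₀).contMDiffAt
        (extChartAt_target_mem_nhds x₀)).of_le (by simp)
    have h3 : ContMDiffAt (𝓡 n) 𝓘(ℝ, Euc n) 1 ξ
        ((extChartAt (𝓡 n) x₀).symm (extChartAt (𝓡 n) x₀ x₀)) := by
      rw [hinv hx₀]
      exact contMDiffAt_chartDeriv_section (hY 0)
    exact (formBilin.contDiff.contDiffAt.comp _ h1).clm_apply (h3.comp _ h2).contDiffAt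
  have hψ := continuousAt_extChartAt (I := 𝓡 n) x₀
  have hαe := hψ.eventually (hαC.eventually (by simp))
  have hαd : ∀ᶠ q in 𝓝 x₀, ‖fderiv ℝ α (extChartAt (𝓡 n) x₀ q)‖ <
      ‖fderiv ℝ α (extChartAt (𝓡 n) x₀ x₀)‖ + 1 :=
    hψ.eventually ((hαC.fderiv_right (m := 0) (by simp)).continuousAt.norm.eventually
      (gt_mem_nhds (lt_add_one _)))
  set B := ‖fderiv ℝ α (extChartAt (𝓡 n) x₀ x₀)‖ + 1 with hB
  have hB0 : 0 < B := by positivity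
  obtain ⟨c, hc, B', -, hcB⟩ := gnorm_comparable g x₀
  have hXc : ∀ᶠ q in 𝓝 x₀, gnorm g (X x₀) / 2 < gnorm g (X q) := by
    have h1 : ContinuousAt (fun q => gnorm g (X q)) x₀ :=
      (continuous_gnorm g).continuousAt.comp
        (f := fun q => (⟨q, X q⟩ : TangentBundle (𝓡 n) M)) (hY 0).continuousAt
    refine h1.eventually (lt_mem_nhds ?_)
    have := gnorm_pos g hXE.self_of_nhds.1
    linarith
  set c' := gnorm g (X x₀) / 2 with hc'
  have hc'0 : 0 < c' := by have := gnorm_pos g hXE.self_of_nhds.1; positivity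
  obtain ⟨U, hU, hUo, hxU⟩ := mem_nhds_iff.1 (((hXE.and hαe).and (hαd.and hcB)).and
    (hXc.and ((chartAt (Euc n) x₀).open_source.mem_nhds hx₀)))
  -- `X` is orthogonal to `Es` and `Ec`, so uniform nondegeneracy must be realized on the line `Eu`.
  -- The same bound shows that `ker α` is not larger than `Es ⊕ Ec`.
  have hlow : ∀ q ∈ U, ∀ u ∈ Eu q, c' * gnorm g u ≤ D * |Ω q ![X q, u]| := by
    intro q hq u hu
    obtain ⟨⟨⟨⟨hX0, hXs⟩, -⟩, -⟩, hXq, -⟩ := hU hq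
    by_cases hu0 : u = 0
    · rw [hu0, gnorm_zero, mul_zero]
      positivity
    have pu := gnorm_pos g hu0
    have h1 := hnd q (X q) (|Ω q ![X q, u]| / gnorm g u) (by positivity) ?_ ?_ ?_
    · rw [← mul_div_assoc, le_div_iff₀ pu] at h1
      exact (mul_le_mul_of_nonneg_right hXq.le pu.le).trans h1
    · intro y hy
      obtain ⟨t, rfl⟩ := exists_smul_eq_of_finrank_eq_one (h.finrank_s q) hXs hX0 hy
      have : Ω q ![X q, t • X q] = 0 := by
        change formLin (Ω q) (X q) (t • X q) = 0
        rw [map_smul, formLin_isAlt, smul_zero]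
      rw [this, abs_zero]
      exact mul_nonneg (by positivity) (gnorm_nonneg g _)
    · intro y hy
      rw [horth q _ hXs y hy, abs_zero]
      exact mul_nonneg (by positivity) (gnorm_nonneg g _)
    · intro y hy
      obtain ⟨t, rfl⟩ := exists_smul_eq_of_finrank_eq_one (h.finrank_u q) hu hu0 hy
      have : Ω q ![X q, t • u] = t * Ω q ![X q, u] := by
        change formLin (Ω q) (X q) (t • u) = _
        rw [map_smul]; rfl
      rw [this, gnorm_smul, abs_mul]
      field_simp
      exact le_rfl
  have hdef : IsDefiningForm (fun p => Es p ⊔ Ec p) x₀ U α := by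
    refine ⟨hUo, fun q hq => (hU hq).2.2, ?_, fun q hq v => ?_⟩
    · rintro _ ⟨q, hq, rfl⟩
      exact (hU hq).1.1.2.contDiffWithinAt
    · obtain ⟨⟨⟨⟨hX0, hXs⟩, -⟩, -⟩, -, hqs⟩ := hU hq
      rw [hα q hqs]
      have hker : Es q ⊔ Ec q ≤ LinearMap.ker (formLin (Ω q) (X q)) := by
        refine sup_le (fun y hy => ?_) (horth q _ hXs)
        obtain ⟨t, rfl⟩ := exists_smul_eq_of_finrank_eq_one (h.finrank_s q) hXs hX0 hy
        rw [LinearMap.mem_ker, map_smul, formLin_isAlt, smul_zero]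
      refine ⟨fun hv => ?_, fun hv => hker hv⟩
      have hvt : v ∈ (Es q ⊔ Ec q) ⊔ Eu q := by rw [sup_assoc, h.sup_eq_top]; trivial
      obtain ⟨z, hz, u, hu, rfl⟩ := Submodule.mem_sup.1 hvt
      have h1 : Ω q ![X q, u] = 0 := by
        have h2 : formLin (Ω q) (X q) (z + u) = 0 := hv
        have h3 : formLin (Ω q) (X q) z = 0 := hker hz
        rw [map_add, h3, zero_add] at h2
        exact h2
      have h2 := hlow q hq u hu
      rw [h1, abs_zero, mul_zero] at h2
      have hu0 : u = 0 := by
        by_contra hu0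
        have := mul_pos hc'0 (gnorm_pos g hu0)
        linarith
      rw [hu0, add_zero]
      exact hz
  refine ⟨max (2 * B / (c * c)) (D / c'), ?_⟩
  filter_upwards [hUo.mem_nhds hxU] with q hq
  obtain ⟨⟨-, hd, hcq⟩, -, hqs⟩ := hU hq
  refine ⟨x₀, U, α, hdef, hq, fun v w => ?_, fun u hu => ?_⟩
  · have hv0 := gnorm_nonneg g v
    have hw0 := gnorm_nonneg g w
    have hv : ‖chartDeriv x₀ q v‖ ≤ gnorm g v / c := (le_div_iff₀' hc).2 (hcq v).1
    have hw : ‖chartDeriv x₀ q w‖ ≤ gnorm g w / c := (le_div_iff₀' hc).2 (hcq w).1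
    have h1 : ∀ a b : Euc n, |fderiv ℝ α (extChartAt (𝓡 n) x₀ q) a b| ≤ B * ‖a‖ * ‖b‖ := by
      intro a b
      refine ((fderiv ℝ α (extChartAt (𝓡 n) x₀ q)).le_opNorm₂ a b).trans ?_
      gcongr
    rw [formCurvature_apply]
    calc _ ≤ |_| + |_| := abs_sub _ _
      _ ≤ B * ‖chartDeriv x₀ q v‖ * ‖chartDeriv x₀ q w‖ +
          B * ‖chartDeriv x₀ q w‖ * ‖chartDeriv x₀ q v‖ := add_le_add (h1 _ _) (h1 _ _)
      _ = 2 * B * (‖chartDeriv x₀ q v‖ * ‖chartDeriv x₀ q w‖) := by ring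
      _ ≤ 2 * B * (gnorm g v / c * (gnorm g w / c)) := by gcongr
      _ = 2 * B / (c * c) * (gnorm g v * gnorm g w) := by field_simp
      _ ≤ _ := by gcongr; exact le_max_left _ _
  · rw [hα q hqs]
    have h1 := hlow q hq u hu
    calc gnorm g u ≤ D * |Ω q ![X q, u]| / c' := (le_div_iff₀' hc'0).2 h1
      _ = D / c' * |Ω q ![X q, u]| := by ring
      _ ≤ _ := by gcongr; exact le_max_right _ _

end IsSymplecticallyDominated

end PartiallyHyperbolic

/-! ### Transport of defining forms by diffeomorphisms. -/

section Transport

variable {n : ℕ} {M : Type*} [TopologicalSpace M] [ChartedSpace (Euc n) M]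

/-- A map of the manifold, read in two of its charts. -/
def chartConj (x₀ x₁ : M) (h : M → M) : Euc n → Euc n :=
  extChartAt (𝓡 n) x₁ ∘ h ∘ (extChartAt (𝓡 n) x₀).symm

lemma chartConj_apply {x₀ x₁ : M} (h : M → M) {q : M} (hq : q ∈ (chartAt (Euc n) x₀).source) :
    chartConj x₀ x₁ h (extChartAt (𝓡 n) x₀ q) = extChartAt (𝓡 n) x₁ (h q) := by
  have : (extChartAt (𝓡 n) x₀).symm (extChartAt (𝓡 n) x₀ q) = q :=
    (extChartAt (𝓡 n) x₀).left_inv (by rwa [extChartAt_source])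
  simp only [chartConj, Function.comp_apply, this]

variable [IsManifold (𝓡 n) ∞ M]

lemma contDiffAt_chartConj {k : ℕ∞} {x₀ x₁ : M} {h : M → M} {q : M}
    (hh : ContMDiffAt (𝓡 n) (𝓡 n) k h q) (hq : q ∈ (chartAt (Euc n) x₀).source)
    (hq' : h q ∈ (chartAt (Euc n) x₁).source) :
    ContDiffAt ℝ k (chartConj x₀ x₁ h) (extChartAt (𝓡 n) x₀ q) := by
  have hk : (k : ℕ∞ω) ≤ ∞ := mod_cast le_top
  have hqs : q ∈ (extChartAt (𝓡 n) x₀).source := by rwa [extChartAt_source]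
  have e : (extChartAt (𝓡 n) x₀).symm (extChartAt (𝓡 n) x₀ q) = q :=
    (extChartAt (𝓡 n) x₀).left_inv hqs
  have h1 : ContMDiffAt 𝓘(ℝ, Euc n) (𝓡 n) k (extChartAt (𝓡 n) x₀).symm (extChartAt (𝓡 n) x₀ q) :=
    ((contMDiffOn_extChartAt_symm (n := ∞) x₀).contMDiffAt
      (extChartAt_target_mem_nhds' ((extChartAt (𝓡 n) x₀).map_source hqs))).of_le hk
  have h2 : ContMDiffAt (𝓡 n) 𝓘(ℝ, Euc n) k (extChartAt (𝓡 n) x₁) (h q) :=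
    (contMDiffAt_extChartAt' (n := ∞) hq').of_le hk
  rw [← e] at hh h2
  exact (ContMDiffAt.comp (g := extChartAt (𝓡 n) x₁) (f := h ∘ (extChartAt (𝓡 n) x₀).symm) _ h2
    (hh.comp _ h1)).contDiffAt

lemma fderiv_chartConj {x₀ x₁ : M} {h : M → M} {q : M}
    (hh : ContMDiffAt (𝓡 n) (𝓡 n) 1 h q) (hq : q ∈ (chartAt (Euc n) x₀).source)
    (hq' : h q ∈ (chartAt (Euc n) x₁).source) (v : TangentSpace (𝓡 n) q) :
    fderiv ℝ (chartConj x₀ x₁ h) (extChartAt (𝓡 n) x₀ q) (chartDeriv x₀ q v) =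
      chartDeriv x₁ (h q) (mfderiv (𝓡 n) (𝓡 n) h q v) := by
  have d0 : MDifferentiableAt (𝓡 n) 𝓘(ℝ, Euc n) (extChartAt (𝓡 n) x₀) q :=
    mdifferentiableAt_extChartAt hq
  have d1 : MDifferentiableAt (𝓡 n) 𝓘(ℝ, Euc n) (extChartAt (𝓡 n) x₁) (h q) :=
    mdifferentiableAt_extChartAt hq'
  have d2 : DifferentiableAt ℝ (chartConj x₀ x₁ h) (extChartAt (𝓡 n) x₀ q) :=
    (contDiffAt_chartConj (k := 1) hh hq hq').differentiableAt one_ne_zero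
  have e : chartConj x₀ x₁ h ∘ extChartAt (𝓡 n) x₀ =ᶠ[𝓝 q] extChartAt (𝓡 n) x₁ ∘ h := by
    filter_upwards [(chartAt (Euc n) x₀).open_source.mem_nhds hq] with r hr
      using chartConj_apply h hr
  have h1 := e.mfderiv_eq (I := 𝓡 n) (I' := 𝓘(ℝ, Euc n))
  rw [mfderiv_comp q d2.mdifferentiableAt d0,
    mfderiv_comp q d1 (hh.mdifferentiableAt one_ne_zero), mfderiv_eq_fderiv] at h1
  exact congrArg (fun B : Euc n →L[ℝ] Euc n => B v) h1

variable {k : ℕ∞ω} {E : ∀ p : M, Submodule ℝ (TangentSpace (𝓡 n) p)}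

/-- Transformation of the curvature of a defining form under an invariant map. -/
lemma IsDefiningForm.curvature_transform {f : Diffeomorph (𝓡 n) (𝓡 n) M M k} (hk : 2 ≤ k)
    (hE : IsDInvariant f E) {x₀ x₁ : M} {U U' : Set M} {α α' : Euc n → Euc n →L[ℝ] ℝ}
    (hα : IsDefiningForm E x₀ U α) (hα' : IsDefiningForm E x₁ U' α') {q : M} (hq : q ∈ U)
    (hq' : f q ∈ U') (u : TangentSpace (𝓡 n) q) {v w : TangentSpace (𝓡 n) q} (hv : v ∈ E q)
    (hw : w ∈ E q) :
    formCurvature x₁ α' (f q) (mfderiv (𝓡 n) (𝓡 n) f q v) (mfderiv (𝓡 n) (𝓡 n) f q w) *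
        α (extChartAt (𝓡 n) x₀ q) (chartDeriv x₀ q u) =
      formCurvature x₀ α q v w * α' (extChartAt (𝓡 n) x₁ (f q))
        (chartDeriv x₁ (f q) (mfderiv (𝓡 n) (𝓡 n) f q u)) := by
  have hf2 : ContMDiff (𝓡 n) (𝓡 n) 2 f := f.contMDiff.of_le hk
  have hf1 : ContMDiff (𝓡 n) (𝓡 n) 1 f := hf2.of_le one_le_two
  have hqs := hα.subset_source hq
  have hqs' := hα'.subset_source hq'
  have hD := fun z => fderiv_chartConj (x₀ := x₀) (x₁ := x₁) hf1.contMDiffAt hqs hqs' z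
  have hF := chartConj_apply (x₀ := x₀) (x₁ := x₁) f hqs
  have key := extDeriv_transform (α := α) (α' := α') (F := chartConj x₀ x₁ f)
    (y := extChartAt (𝓡 n) x₀ q)
    (((hα.contDiffOn.differentiableOn one_ne_zero) _ (mem_image_of_mem _ hq)).differentiableAt
      (hα.isOpen_image.mem_nhds (mem_image_of_mem _ hq)))
    (by
      rw [hF]
      exact ((hα'.contDiffOn.differentiableOn one_ne_zero) _
        (mem_image_of_mem _ hq')).differentiableAt
          (hα'.isOpen_image.mem_nhds (mem_image_of_mem _ hq')))
    (contDiffAt_chartConj (k := 2) hf2.contMDiffAt hqs hqs') ?_ (chartDeriv x₀ q u)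
    ((hα.ker q hq v).2 hv) ((hα.ker q hq w).2 hw)
  · rw [hD, hD, hD, hF] at key
    exact key
  · have hO : IsOpen (U ∩ f ⁻¹' U') := hα.isOpen.inter (hα'.isOpen.preimage f.continuous)
    have hOi : IsOpen (extChartAt (𝓡 n) x₀ '' (U ∩ f ⁻¹' U')) :=
      (chartAt (Euc n) x₀).isOpen_image_of_subset_source hO
        (inter_subset_left.trans hα.subset_source)
    filter_upwards [hOi.mem_nhds (mem_image_of_mem _ ⟨hq, hq'⟩)]
    rintro _ ⟨r, ⟨hr, hr'⟩, rfl⟩ z hz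
    have hrs := hα.subset_source hr
    have hrs' := hα'.subset_source hr'
    obtain ⟨z', rfl⟩ : ∃ z' : TangentSpace (𝓡 n) r, chartDeriv x₀ r z' = z :=
      ⟨_, chartDeriv_symmL hrs z⟩
    rw [fderiv_chartConj hf1.contMDiffAt hrs hrs', chartConj_apply f hrs]
    rw [hα.ker r hr] at hz
    refine (hα'.ker _ hr' _).2 ?_
    rw [← hE r]
    exact Submodule.mem_map_of_mem hz

end Transport

/-! ### Constructing first integrals on the manifold. -/

section FirstIntegrals

variable {n : ℕ} {M : Type*} [TopologicalSpace M] [ChartedSpace (Euc n) M]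
  {E : ∀ p : M, Submodule ℝ (TangentSpace (𝓡 n) p)}

/-- Composition with a linear isomorphism keeps the kernel. It serves for values in `ℝ` and in a
product `Euc c × Euc c'`. -/
lemma HasFirstIntegral.of_ker {F : Type*} [NormedAddCommGroup F] [NormedSpace ℝ F]
    [FiniteDimensional ℝ F] {c : ℕ} (hF : Module.finrank ℝ F = c) {U : Set M} (hU : IsOpen U)
    {p : M} (hp : p ∈ U) {u : M → F} (hu : ContMDiffOn (𝓡 n) 𝓘(ℝ, F) 1 u U)
    (hk : ∀ q ∈ U, (mfderiv (𝓡 n) 𝓘(ℝ, F) u q).ker = E q) : HasFirstIntegral c E p := by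
  let L : F ≃L[ℝ] Euc c := ContinuousLinearEquiv.ofFinrankEq (by simp [hF])
  refine ⟨U, hU, hp, L ∘ u, L.contDiff.contMDiff.comp_contMDiffOn hu, fun q hq => ?_⟩
  have hd : MDifferentiableAt (𝓡 n) 𝓘(ℝ, F) u q :=
    ((hu.mdifferentiableOn one_ne_zero) q hq).mdifferentiableAt (hU.mem_nhds hq)
  have h1 : mfderiv (𝓡 n) 𝓘(ℝ, Euc c) (L ∘ u) q =
      (L : F →L[ℝ] Euc c).comp (mfderiv (𝓡 n) 𝓘(ℝ, F) u q) := by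
    rw [mfderiv_comp q (L.differentiableAt.mdifferentiableAt) hd, mfderiv_eq_fderiv, L.fderiv]
    rfl
  rw [← hk q hq, h1]
  ext v
  exact L.map_eq_zero_iff

lemma HasFirstIntegral.inf {c c' : ℕ} {E' : ∀ p : M, Submodule ℝ (TangentSpace (𝓡 n) p)} {p : M}
    (h : HasFirstIntegral c E p) (h' : HasFirstIntegral c' E' p) :
    HasFirstIntegral (c + c') (fun p => E p ⊓ E' p) p := by
  obtain ⟨U, hU, hp, u, hu, hk⟩ := h
  obtain ⟨U', hU', hp', u', hu', hk'⟩ := h'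
  have hud : ContMDiffOn (𝓡 n) 𝓘(ℝ, Euc c × Euc c') 1 (fun q => (u q, u' q)) (U ∩ U') :=
    (hu.mono inter_subset_left).prodMk_space (hu'.mono inter_subset_right)
  refine HasFirstIntegral.of_ker (by simp) (hU.inter hU') ⟨hp, hp'⟩ hud fun q hq => ?_
  have d : MDifferentiableAt (𝓡 n) 𝓘(ℝ, Euc c) u q :=
    ((hu.mdifferentiableOn one_ne_zero) q hq.1).mdifferentiableAt (hU.mem_nhds hq.1)
  have d' : MDifferentiableAt (𝓡 n) 𝓘(ℝ, Euc c') u' q :=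
    ((hu'.mdifferentiableOn one_ne_zero) q hq.2).mdifferentiableAt (hU'.mem_nhds hq.2)
  have h1 : mfderiv (𝓡 n) 𝓘(ℝ, Euc c × Euc c') (fun q => (u q, u' q)) q =
      (mfderiv (𝓡 n) 𝓘(ℝ, Euc c) u q).prod (mfderiv (𝓡 n) 𝓘(ℝ, Euc c') u' q) := by
    rw [modelWithCornersSelf_prod, ← chartedSpaceSelf_prod]
    exact mfderiv_prodMk d d'
  rw [← hk q hq.1, ← hk' q hq.2, h1]
  ext v
  exact Prod.ext_iff

variable [IsManifold (𝓡 n) ∞ M]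

/-- A closed defining form has a first integral. -/
lemma IsDefiningForm.hasFirstIntegral {x₀ : M} {U : Set M} {α : Euc n → Euc n →L[ℝ] ℝ}
    (hα : IsDefiningForm E x₀ U α) {p : M} (hp : p ∈ U) (hne : E p ≠ ⊤)
    (hcurv : ∀ q ∈ U, ∀ v ∈ E q, ∀ w ∈ E q, formCurvature x₀ α q v w = 0) :
    HasFirstIntegral 1 E p := by
  have hps := hα.subset_source hp
  have hint : ∀ y ∈ extChartAt (𝓡 n) x₀ '' U, ∀ v w, α y v = 0 → α y w = 0 →
      fderiv ℝ α y v w = fderiv ℝ α y w v := by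
    rintro _ ⟨q, hq, rfl⟩ v w hv hw
    have hqs := hα.subset_source hq
    obtain ⟨v, rfl⟩ : ∃ v' : TangentSpace (𝓡 n) q, chartDeriv x₀ q v' = v :=
      ⟨_, chartDeriv_symmL hqs v⟩
    obtain ⟨w, rfl⟩ : ∃ w' : TangentSpace (𝓡 n) q, chartDeriv x₀ q w' = w :=
      ⟨_, chartDeriv_symmL hqs w⟩
    rw [hα.ker q hq] at hv hw
    exact sub_eq_zero.1 (hcurv q hq v hv w hw)
  obtain ⟨W, hW, hpW, hWU, u, hu, hk⟩ := exists_firstIntegral hα.isOpen_image hα.contDiffOn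
    (mem_image_of_mem _ hp)
    -- If `α` vanished at `p`, its kernel `E p` would be the whole tangent space.
    (fun h0 => hne (by
      rw [eq_top_iff]
      intro v _
      rw [← hα.ker p hp, h0, zero_apply])) hint
  have hV : IsOpen ((chartAt (Euc n) x₀).source ∩ extChartAt (𝓡 n) x₀ ⁻¹' W) :=
    (chartAt (Euc n) x₀).isOpen_inter_preimage hW
  have he : ContMDiffOn (𝓡 n) 𝓘(ℝ, Euc n) 1 (extChartAt (𝓡 n) x₀)
      (chartAt (Euc n) x₀).source :=
    (contMDiffOn_extChartAt (n := ∞)).of_le (by simp)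
  refine HasFirstIntegral.of_ker (F := ℝ) (by simp) hV ⟨hps, hpW⟩
    (u := u ∘ extChartAt (𝓡 n) x₀)
    (hu.contMDiffOn.comp (he.mono inter_subset_left) fun q hq => hq.2) fun q hq => ?_
  obtain ⟨r, hr, hrq⟩ := hWU hq.2
  obtain rfl : r = q := (chartAt (Euc n) x₀).injOn (hα.subset_source hr) hq.1 hrq
  have d : DifferentiableAt ℝ u (extChartAt (𝓡 n) x₀ r) :=
    (hu.differentiableOn one_ne_zero _ hq.2).differentiableAt (hW.mem_nhds hq.2)
  rw [mfderiv_comp r d.mdifferentiableAt (mdifferentiableAt_extChartAt hq.1), mfderiv_eq_fderiv]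
  ext v
  rw [← hα.ker r hr, ← hk _ hq.2]
  rfl

end FirstIntegrals

/-! ### The Frobenius condition for `Es ⊕ Ec`. -/

namespace IsSymplecticallyDominated

variable {n : ℕ} {M : Type*} [TopologicalSpace M] [CompactSpace M] [ChartedSpace (Euc n) M]
  [IsManifold (𝓡 n) ∞ M] {k : ℕ∞ω}
  {g : Bundle.ContMDiffRiemannianMetric (𝓡 n) ∞ (Euc n) (TangentSpace (𝓡 n) : M → Type)}
  {Ω : ∀ p : M, TangentSpace (𝓡 n) p [⋀^Fin 2]→L[ℝ] ℝ} {f : Diffeomorph (𝓡 n) (𝓡 n) M M k}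
  {Es Ec Eu : ∀ p : M, Submodule ℝ (TangentSpace (𝓡 n) p)} {lam A : ℝ}

/-- The forms defining `Es ⊕ Ec` are closed on `Es ⊕ Ec`. -/
lemma curvature_eq_zero (hk : 2 ≤ k) (h : IsSymplecticallyDominated g Ω f Es Ec Eu lam A)
    (hs : IsSubbundle 1 Es) {x₀ : M} {U : Set M} {α : Euc n → Euc n →L[ℝ] ℝ}
    (hα : IsDefiningForm (fun p => Es p ⊔ Ec p) x₀ U α) {q : M} (hq : q ∈ U) :
    ∀ v ∈ Es q ⊔ Ec q, ∀ w ∈ Es q ⊔ Ec q, formCurvature x₀ α q v w = 0 := by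
  have hk0 : k ≠ 0 := by rintro rfl; simp at hk
  obtain ⟨K, hK, hdef⟩ := h.exists_isDefiningForm hk0 hs
  obtain ⟨D, hD, hnd⟩ := exists_nondegenerate_bound g h.symplectic h.subbundle_s h.subbundle_c
    h.subbundle_u h.sup_eq_top
  have horth := h.orthogonal hk0
  have horth' := (h.symm hk0).orthogonal hk0
  have hzero := gnorm_mfderiv_iterate_zero g f q
  have hinv : IsDInvariant f fun p => Es p ⊔ Ec p := fun p => by
    rw [Submodule.map_sup, h.invariant_s, h.invariant_c]
  have : Nontrivial (Eu q) :=
    Module.nontrivial_of_finrank_pos (R := ℝ) (by rw [h.finrank_u]; exact one_pos)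
  obtain ⟨⟨u, hu⟩, hu0⟩ := exists_ne (0 : Eu q)
  have hu0 : u ≠ 0 := fun h => hu0 (Subtype.ext h)
  set a := |α (extChartAt (𝓡 n) x₀ q) (chartDeriv x₀ q u)|
  have ha : 0 ≤ a := abs_nonneg _
  -- `Λ'` is the curvature at `f^[m] q` of a defining form `α'` from the uniformly bounded family.
  -- In the transformation rule, `α' (Df^m u)` is replaced by `‖Df^m u‖`, to which it is comparable
  -- from below with a constant independent of `m`.
  have key : ∀ m, ∃ Λ' : TangentSpace (𝓡 n) (f^[m] q) →ₗ[ℝ] TangentSpace (𝓡 n) (f^[m] q) →ₗ[ℝ] ℝ,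
      Λ'.IsAlt ∧ (∀ v w, |Λ' v w| ≤ K * (gnorm g v * gnorm g w)) ∧
      ∀ v ∈ Es q ⊔ Ec q, ∀ w ∈ Es q ⊔ Ec q,
        |formCurvature x₀ α q v w| * gnorm g (mfderiv (𝓡 n) (𝓡 n) f^[m] q u) ≤
          K * a * |Λ' (mfderiv (𝓡 n) (𝓡 n) f^[m] q v) (mfderiv (𝓡 n) (𝓡 n) f^[m] q w)| := by
    intro m
    obtain ⟨x₁, U', α', hα', hq', hb, hlow⟩ := hdef (f^[m] q)
    refine ⟨formCurvature x₁ α' (f^[m] q), formCurvature_isAlt _ _ _, hb, fun v hv w hw => ?_⟩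
    have h1 := hα.curvature_transform (f := diffeoIterate f m) hk (hinv.iterate hk0 m) hα' hq
      (by rwa [coe_diffeoIterate]) u hv hw
    rw [coe_diffeoIterate] at h1
    have h2 := congrArg (fun x : ℝ => |x|) h1
    simp only [abs_mul] at h2
    have h3 := hlow _ (h.invariant_u.mem_iterate hk0 m hu)
    calc _ ≤ |formCurvature x₀ α q v w| * (K * |α' (extChartAt (𝓡 n) x₁ (f^[m] q))
          (chartDeriv x₁ (f^[m] q) (mfderiv (𝓡 n) (𝓡 n) f^[m] q u))|) := by gcongr
      _ = K * (|formCurvature x₀ α q v w| * |α' (extChartAt (𝓡 n) x₁ (f^[m] q))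
          (chartDeriv x₁ (f^[m] q) (mfderiv (𝓡 n) (𝓡 n) f^[m] q u))|) := by ring
      _ = _ := by rw [← h2]; ring
  refine curvature_eq_zero_of_domination (formCurvature_isAlt x₀ α q) (h.finrank_s q)
    (ν := fun m v => gnorm g (mfderiv (𝓡 n) (𝓡 n) f^[m] q v)) (u := u) (K := K * a * K)
    (fun m v => gnorm_nonneg g _) (fun m => ?_) h.rate_pos h.rate_lt_one h.const_pos.le
    (by positivity) (fun m hm v hv => ?_) (fun m hm => ?_) (fun m hm v hv => ?_)
    (fun m v hv w hw => ?_) (fun v hv w hw => ?_)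
  · rw [← coe_diffeoIterate]
    exact gnorm_pos g (mfderiv_ne_zero _ hk0 q hu0)
  · rw [hzero]
    exact h.dominated.contract m hm q v hv
  · rw [hzero]
    exact h.dominated.expand m hm q u hu
  · rw [hzero, hzero]
    exact h.dominated.dominate_cu m hm q v hv u hu
  · obtain ⟨Λ', -, hb, hΛ'⟩ := key m
    refine (hΛ' v (Submodule.mem_sup_left hv) w (Submodule.mem_sup_right hw)).trans ?_
    rw [mul_assoc (K * a)]
    exact mul_le_mul_of_nonneg_left (hb _ _) (by positivity)
  · refine ⟨K * a * (2 * D * K * |Ω q ![v, w]|), fun m => ?_⟩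
    obtain ⟨Λ', halt, hb, hΛ'⟩ := key m
    refine (hΛ' v (Submodule.mem_sup_right hv) w (Submodule.mem_sup_right hw)).trans ?_
    refine mul_le_mul_of_nonneg_left ?_ (by positivity)
    -- The bound is expressed through `Ω` at `f^[m] q`, against which `Λ'` can be compared on the
    -- plane `Ec`; its invariance makes the bound independent of `m`.
    rw [← h.preserves.iterate hk0 m]
    refine abs_le_of_nondegenerate_plane (formLin_isAlt (Ω (f^[m] q))) halt (h.finrank_c _)
      (ν := fun v => gnorm g v) (fun v => gnorm_nonneg g v) (fun v hv => gnorm_pos g hv) hD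
      (fun x hx ε hε hy => hnd _ x ε hε (fun y hy => ?_) hy fun y hy => ?_)
      (fun a _ b _ => hb a b) hK.le
      (h.invariant_c.mem_iterate hk0 m hv) (h.invariant_c.mem_iterate hk0 m hw)
    -- Since `Ec` is orthogonal to `Es` and, by time reversal, to `Eu`, testing on `Ec` alone
    -- suffices for vectors of `Ec`.
    · rw [twoForm_swap, horth _ y hy x hx, neg_zero, abs_zero]
      exact mul_nonneg hε (gnorm_nonneg g y)
    · rw [twoForm_swap, horth' _ y hy x hx, neg_zero, abs_zero]
      exact mul_nonneg hε (gnorm_nonneg g y)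

/-- If the stable bundle is of class `C^1`, then `Es ⊕ Ec` is integrable. -/
lemma hasFirstIntegral (hk : 2 ≤ k) (h : IsSymplecticallyDominated g Ω f Es Ec Eu lam A)
    (hs : IsSubbundle 1 Es) (hne : ∀ p, Es p ⊔ Ec p ≠ ⊤) (p : M) :
    HasFirstIntegral 1 (fun p => Es p ⊔ Ec p) p := by
  have hk0 : k ≠ 0 := by rintro rfl; simp at hk
  obtain ⟨K, -, hdef⟩ := h.exists_isDefiningForm hk0 hs
  obtain ⟨x₀, U, α, hα, hp, -, -⟩ := hdef p
  exact hα.hasFirstIntegral hp (hne p) fun q hq => h.curvature_eq_zero hk hs hα hq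

end IsSymplecticallyDominated

end SymplecticPH

end

/-! ### The main theorem. -/

theorem theorem1 {M : Type*} [TopologicalSpace M] [T2Space M] [CompactSpace M]
    [ChartedSpace (EuclideanSpace ℝ (Fin 4)) M] [IsManifold (𝓡 4) ∞ M]
    (g : Bundle.ContMDiffRiemannianMetric (𝓡 4) ∞ (EuclideanSpace ℝ (Fin 4))
      (TangentSpace (𝓡 4) : M → Type))
    (Ω : ∀ p : M, TangentSpace (𝓡 4) p [⋀^Fin 2]→L[ℝ] ℝ) (hΩ : IsSymplecticForm Ω)
    (f : Diffeomorph (𝓡 4) (𝓡 4) M M 2) (hf : PreservesForm f Ω)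
    (Es Ec Eu : ∀ p : M, Submodule ℝ (TangentSpace (𝓡 4) p))
    (hph : IsPartiallyHyperbolic g f Es Ec Eu)
    (hs1 : ∀ p, Module.finrank ℝ (Es p) = 1) (hu1 : ∀ p, Module.finrank ℝ (Eu p) = 1)
    (hs : IsSubbundle 1 Es) (hu : IsSubbundle 1 Eu) :
    ∃ (Fsc : Foliation 4 M 1 3 1) (Fcu : Foliation 4 M 1 3 1) (Fc : Foliation 4 M 1 2 2),
      (Fsc.IsTangentTo fun p => Es p ⊔ Ec p) ∧ (Fcu.IsTangentTo fun p => Ec p ⊔ Eu p) ∧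
      Fc.IsTangentTo Ec ∧
      Fsc.IsInvariant f ∧ Fcu.IsInvariant f ∧ Fc.IsInvariant f ∧
      ∀ p : M, Fc.leaf p = pathComponentIn (Fsc.leaf p ∩ Fcu.leaf p) p := by
  have h4 : ∀ p : M, Module.finrank ℝ (TangentSpace (𝓡 4) p) = 4 := fun p => by
    change Module.finrank ℝ (EuclideanSpace ℝ (Fin 4)) = 4
    simp
  have hfd : ∀ p : M, FiniteDimensional ℝ (TangentSpace (𝓡 4) p) := fun p =>
    FiniteDimensional.of_finrank_pos (by rw [h4]; norm_num)
  have hcu3 : ∀ p, Module.finrank ℝ ↥(Ec p ⊔ Eu p) = 3 := fun p => by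
    have h1 := Submodule.finrank_add_eq_of_isCompl (hph.isCompl p)
    rw [h4, hs1] at h1
    omega
  have hc2 : ∀ p, Module.finrank ℝ (Ec p) = 2 := fun p => by
    have h1 := Submodule.finrank_sup_add_finrank_inf_eq (Ec p) (Eu p)
    rw [(hph.disjoint p).eq_bot, finrank_bot, hu1, hcu3] at h1
    omega
  have hsc3 : ∀ p, Module.finrank ℝ ↥(Es p ⊔ Ec p) = 3 := fun p => by
    have h1 := Submodule.finrank_sup_add_finrank_inf_eq (Es p) (Ec p)
    rw [((hph.isCompl p).disjoint.mono_right le_sup_left).eq_bot, finrank_bot, hs1, hc2] at h1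
    omega
  have hne : ∀ (p : M) (E : Submodule ℝ (TangentSpace (𝓡 4) p)), Module.finrank ℝ E = 3 →
      E ≠ ⊤ := by
    rintro p _ hE rfl
    rw [finrank_top, h4] at hE
    omega
  -- The modular law, with `Es` and `Ec ⊕ Eu` in direct sum.
  have hinf : ∀ p, Ec p = (Es p ⊔ Ec p) ⊓ (Ec p ⊔ Eu p) := fun p => by
    rw [sup_comm (Es p), sup_inf_assoc_of_le _ le_sup_left, (hph.isCompl p).inf_eq_bot, sup_bot_eq]
  obtain ⟨lam, A, hl, hl1, hA, hdom⟩ := hph.exists_isDominated two_ne_zero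
  have H : IsSymplecticallyDominated g Ω f Es Ec Eu lam A :=
    ⟨hΩ, hf, hdom, hl, hl1, hA, fun p => (hph.isCompl p).sup_eq_top, hph.continuous_s,
      hph.continuous_c, hph.continuous_u, hph.invariant_s, hph.invariant_c, hph.invariant_u,
      hs1, hc2, hu1⟩
  have Isc := H.hasFirstIntegral le_rfl hs fun p => hne p _ (hsc3 p)
  -- The stable bundle of the inverse is `Eu`, so this is the previous statement for `f.symm`.
  have Icu : ∀ p, HasFirstIntegral 1 (fun p => Ec p ⊔ Eu p) p := by
    simp only [sup_comm (Ec _)]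
    exact (H.symm two_ne_zero).hasFirstIntegral le_rfl hu fun p => hne p _ (by
      rw [sup_comm]; exact hcu3 p)
  have Ic : ∀ p, HasFirstIntegral 2 Ec p := fun p => by
    rw [funext hinf]
    exact (Isc p).inf (Icu p)
  obtain ⟨Fsc, hsc, tsc⟩ := exists_foliation_of_hasFirstIntegral (d := 3) rfl Isc hsc3
  obtain ⟨Fcu, hcu, tcu⟩ := exists_foliation_of_hasFirstIntegral (d := 3) rfl Icu hcu3
  obtain ⟨Fc, -, tc⟩ := exists_foliation_of_hasFirstIntegral (d := 2) rfl Ic hc2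
  have : SecondCountableTopology M :=
    ChartedSpace.secondCountable_of_sigmaCompact (EuclideanSpace ℝ (Fin 4)) M
  refine ⟨Fsc, Fcu, Fc, tsc, tcu, tc, ?_, ?_, ?_,
    Foliation.leaf_eq_pathComponentIn_inter tc tsc tcu hinf hsc hcu⟩
  · refine Foliation.isInvariant_of_isDInvariant tsc f one_le_two fun p => ?_
    rw [Submodule.map_sup, hph.invariant_s, hph.invariant_c]
  · refine Foliation.isInvariant_of_isDInvariant tcu f one_le_two fun p => ?_
    rw [Submodule.map_sup, hph.invariant_c, hph.invariant_u]
  · exact Foliation.isInvariant_of_isDInvariant tc f one_le_two hph.invariant_c
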